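/- Let $p$ be an odd prime and let $a,b,d$ be integers with $d>0$, $-d=b^2-4a$ and $-d$ a quadratic non-residue modulo $p$. Thus $p$ is inert in $L=\mathbb Q(\sqrt{-d})$; put $L_p=L\otimes\mathbb Q_p=\mathbb Q_p(\sqrt{-d})$, with ring of integers $\mathbb Z_{L,p}=\mathbb Z_p+\mathbb Z_p\sqrt{-d}$, conjugation $x\mapsto\overline x$ and norm $N$. Let $\Gamma^0_{L,p}=\{x+y\sqrt{-d}\in\mathbb Z_{L,p}^\times: p\mid y\}$, and let $\Lambda_p$ be a unitary character of $L_p^\times$ that is trivial on $\mathbb Q_p^\times$ and on $\Gamma^0_{L,p}$ but not on $\mathbb Z_{L,p}^\times$. Let $J_n=\begin{pmatrix}0&I_n\\-I_n&0\end{pmatrix}$ and $GU(n,n)=\{g\in GL_{2n}(L_p):\overline g^tJ_ng=\mu(g)J_n,\ \mu(g)\in\mathbb Q_p^\times\}$. Write $\widetilde F=GU(1,1)$, $\widetilde F_1=\{h\in\widetilde F:\mu(h)=1\}$ and $\widetilde H=GU(3,3)$. Let $P_{\widetilde H}\subset\widetilde H$ be the group of products $n(c)\,m(A,t)$, where $n(c)=\begin{pmatrix}1&c\\0&1\end{pmatrix}$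 with $c\in M_3(L_p)$, $\overline c^t=c$, and $m(A,t)=\begin{pmatrix}A&0\\0&t(\overline A^{-1})^t\end{pmatrix}$ with $A\in GL_3(L_p)$, $t\in\mathbb Q_p^\times$. Let $I'$ be the group of all $k\in\widetilde H\cap GL_6(\mathbb Z_{L,p})$ whose reduction modulo $p$ has entries in $\mathbb F_p$ and has the form $\begin{pmatrix}A_0&B_0\\0&D_0\end{pmatrix}$ with $A_0$ lower triangular and $D_0$ upper triangular. Let $$Q=\begin{pmatrix}0&1&0&0&0&0\\1&0&0&0&0&0\\0&0&0&0&0&-1\\0&0&0&0&1&-1\\0&0&0&1&0&0\\0&1&1&0&0&0\end{pmatrix},\qquad \iota\left(\begin{pmatrix}A&B\\C&D\end{pmatrix},\begin{pmatrix}x&y\\z&w\end{pmatrix}\right)=\begin{pmatrix}A&0&B&0\\0&x&0&-y\\C&0&D&0\\0&-z&0&w\end{pmatrix}$$ ($A,B,C,D$ of size $2\times2$). For $s\in\mathbb C$ let $\Upsilon_p(\cdot,s)$ be the function supported on $P_{\widetilde H}QI'$ with $$\Upsilon_p(n(c)\,m(A,t)\,Qk,s)=|t|_p^{-9(s+1/2)}\,|N(\det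 A)|_p^{3(s+1/2)}\,\Lambda_p(\det A)\qquad(k\in I').$$ Let $\psi$ be a character of $\mathbb Q_p$ of conductor $\mathbb Z_p$, let $\xi$ be an unramified character of $\mathbb Q_p^\times$ with $\xi^2=1$, and let $W$ be an element of the $\psi$-Whittaker model of the representation $\xi\otimes\mathrm{St}$ of $GL_2(\mathbb Q_p)$ that is invariant under $\Gamma_{0,p}=\{\gamma\in GL_2(\mathbb Z_p):\gamma\equiv\begin{pmatrix}*&*\\0&*\end{pmatrix}\bmod p\}$; here $\mathrm{St}$ is the Steinberg representation. Extend it to $W_{\Psi,p}$ on $\widetilde F=L_p^\times\cdot GL_2(\mathbb Q_p)$ by $W_{\Psi,p}(xg)=W(g)$ for $x\in L_p^\times$, $g\in GL_2(\mathbb Q_p)$. (For the automorphic form $\Psi$ of a newform on $\Gamma_0(N)$ of squarefree level divisible by $p$, the local component at $p$ of its Whittaker function is of this kind.) For $g_p\in\widetilde F$ and $k_p\in GL_4(L_p)$ with $\overline{k_p}^tJ_2k_p=J_2$ put $$Z_p(g_p,k_p,s)=\int_{\widetilde F_1}\Upsilon_p(Q\cdot\iota(k_p,h),s)\,W_{\Psi,p}(g_ph)\,\Lambda_p^{-1}(\det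 h)\,dh,$$ where $dh$ is the Haar measure giving $\widetilde F_1\cap GL_2(\mathbb Z_{L,p})$ measure $1$. Let $Y_p=\{1,s_1,s_2,s_3,\Theta,\Theta s_2,\Theta s_4,\Theta s_5\}$, where $$s_1=\begin{pmatrix}0&1&0&0\\1&0&0&0\\0&0&0&1\\0&0&1&0\end{pmatrix},\ s_2=\begin{pmatrix}0&0&0&1\\0&0&1&0\\0&-1&0&0\\-1&0&0&0\end{pmatrix},\ s_3=\begin{pmatrix}0&0&1&0\\0&0&0&1\\-1&0&0&0\\0&-1&0&0\end{pmatrix},$$ $$s_4=\begin{pmatrix}0&-1&0&0\\-1&0&0&0\\0&0&0&-1\\1&0&-1&0\end{pmatrix},\ s_5=\begin{pmatrix}0&-1&0&0\\-1&0&0&0\\0&1&0&-1\\0&0&-1&0\end{pmatrix},\ \Theta=\begin{pmatrix}1&0&0&0\\\alpha&1&0&0\\0&0&1&-\overline\alpha\\0&0&0&1\end{pmatrix},\ \alpha=\frac{b+\sqrt{-d}}2.$$ Then for every $g_p\in\widetilde F$ and $k_p\in Y_p$ the integral $Z_p(g_p,k_p,s)$ converges absolutely for $\operatorname{Re}(s)>-\frac16$,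 and for every $s\in\mathbb C$ for which it converges absolutely $$Z_p(g_p,k_p,s)=\begin{cases}\dfrac{W_{\Psi,p}(g_p)}{(p+1)^2}&\text{if }k_p=1\text{ or }k_p=s_1,\\[2mm]0&\text{otherwise.}\end{cases}$$ -/

import Mathlib

open MeasureTheory Matrix

noncomputable section

namespace LocalZeta

/-! ## The quadratic algebra `L_p`, its integers and units -/

/-- `L_p = L ⊗ ℚ_p` for `L = ℚ(√-d)`: elements `x + y √-d` with `x, y ∈ ℚ_p` are written `⟨x, y⟩`.
`star` is the conjugation of `L_p` over `ℚ_p` and `QuadraticAlgebra.norm` is `N_{L/ℚ}`. -/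
abbrev Lv (p : ℕ) [Fact p.Prime] (d : ℤ) : Type :=
  QuadraticAlgebra ℚ_[p] ((-d : ℤ) : ℚ_[p]) 0

variable {p : ℕ} [Fact p.Prime] {d : ℤ}

/-- The product topology on `L_p = ℚ_p ⊕ ℚ_p √-d`. -/
instance : TopologicalSpace (Lv p d) :=
  TopologicalSpace.induced (QuadraticAlgebra.equivProd _ _) inferInstance

/-- The elements `x + y √-d`, `x, y ∈ ℤ_p`; this is the ring of integers `ℤ_{L,p}` when `p` is odd
and does not divide `d`. -/
def IsInt (z : Lv p d) : Prop := ‖z.re‖ ≤ 1 ∧ ‖z.im‖ ≤ 1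

/-- The unit group `ℤ_{L,p}ˣ`, as a set of elements of `L_pˣ`. -/
def intUnits (p : ℕ) [Fact p.Prime] (d : ℤ) : Set (Lv p d)ˣ :=
  {u | IsInt (u : Lv p d) ∧ IsInt ((u⁻¹ : (Lv p d)ˣ) : Lv p d)}

/-- `Γ⁰_{L,p}`: the units `x + y √-d` of `ℤ_{L,p}` with `p ∣ y`. -/
def Gamma0L (p : ℕ) [Fact p.Prime] (d : ℤ) : Set (Lv p d)ˣ :=
  {u | u ∈ intUnits p d ∧ ‖(u : Lv p d).im‖ < 1}

/-- The inclusion `ℚ_pˣ → L_pˣ`. -/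
def baseUnits (p : ℕ) [Fact p.Prime] (d : ℤ) : ℚ_[p]ˣ →* (Lv p d)ˣ :=
  Units.map (algebraMap ℚ_[p] (Lv p d)).toMonoidHom

/-! ## Unitary groups -/

/-- `J_1`. -/
def J1 (R : Type) [CommRing R] : Matrix (Fin 2) (Fin 2) R := !![0, 1; -1, 0]

/-- `J_3`. -/
def J3 (R : Type) [CommRing R] : Matrix (Fin 6) (Fin 6) R :=
  !![ 0,  0,  0, 1, 0, 0;
      0,  0,  0, 0, 1, 0;
      0,  0,  0, 0, 0, 1;
     -1,  0,  0, 0, 0, 0;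
      0, -1,  0, 0, 0, 0;
      0,  0, -1, 0, 0, 0]

/-- The unitary group of the form `J` over `L_p`. -/
def U {n : ℕ} (J : Matrix (Fin n) (Fin n) (Lv p d)) : Subgroup (GL (Fin n) (Lv p d)) where
  carrier := {g | g.valᴴ * J * g.val = J}
  one_mem' := by
    change (1 : Matrix (Fin n) (Fin n) (Lv p d))ᴴ * J * 1 = J
    simp
  mul_mem' := by
    intro a b ha hb
    change (a.val * b.val)ᴴ * J * (a.val * b.val) = J
    change a.valᴴ * J * a.val = J at ha
    change b.valᴴ * J * b.val = J at hb
    rw [conjTranspose_mul]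
    calc _ = b.valᴴ * (a.valᴴ * J * a.val) * b.val := by simp only [Matrix.mul_assoc]
      _ = J := by rw [ha, hb]
  inv_mem' := by
    intro a ha
    change a.valᴴ * J * a.val = J at ha
    change a⁻¹.valᴴ * J * a⁻¹.val = J
    have h1 : a.val * a⁻¹.val = 1 := Units.mul_inv a
    have h2 : a⁻¹.valᴴ * a.valᴴ = 1 := by rw [← conjTranspose_mul, h1, conjTranspose_one]
    calc _ = a⁻¹.valᴴ * (a.valᴴ * J * a.val) * a⁻¹.val := by rw [ha]
      _ = (a⁻¹.valᴴ * a.valᴴ) * J * (a.val * a⁻¹.val) := by simp only [Matrix.mul_assoc]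
      _ = J := by rw [h1, h2, Matrix.one_mul, Matrix.mul_one]

/-- The group of unitary similitudes of the form `J` over `L_p`, with multiplier in `ℚ_pˣ`. -/
def GU {n : ℕ} (J : Matrix (Fin n) (Fin n) (Lv p d)) : Subgroup (GL (Fin n) (Lv p d)) where
  carrier := {g | ∃ μ : ℚ_[p]ˣ, g.valᴴ * J * g.val = (μ : ℚ_[p]) • J}
  one_mem' := by
    refine ⟨1, ?_⟩
    change (1 : Matrix (Fin n) (Fin n) (Lv p d))ᴴ * J * 1 = _
    simp
  mul_mem' := by
    rintro a b ⟨μ, ha⟩ ⟨ν, hb⟩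
    refine ⟨μ * ν, ?_⟩
    change (a.val * b.val)ᴴ * J * (a.val * b.val) = _
    rw [conjTranspose_mul]
    calc _ = b.valᴴ * (a.valᴴ * J * a.val) * b.val := by simp only [Matrix.mul_assoc]
      _ = _ := by rw [ha, Matrix.mul_smul, Matrix.smul_mul, hb, smul_smul, Units.val_mul]
  inv_mem' := by
    rintro a ⟨μ, ha⟩
    refine ⟨μ⁻¹, ?_⟩
    change a⁻¹.valᴴ * J * a⁻¹.val = _
    have h1 : a.val * a⁻¹.val = 1 := Units.mul_inv a
    have h2 : a⁻¹.valᴴ * a.valᴴ = 1 := by rw [← conjTranspose_mul, h1, conjTranspose_one]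
    have h3 : J = ((μ⁻¹ : ℚ_[p]ˣ) : ℚ_[p]) • (a.valᴴ * J * a.val) := by
      rw [ha, smul_smul, Units.inv_mul, one_smul]
    calc _ = ((μ⁻¹ : ℚ_[p]ˣ) : ℚ_[p]) • (a⁻¹.valᴴ * (a.valᴴ * J * a.val) * a⁻¹.val) := by
          conv_lhs => rw [h3]
          rw [Matrix.mul_smul, Matrix.smul_mul]
      _ = ((μ⁻¹ : ℚ_[p]ˣ) : ℚ_[p]) • ((a⁻¹.valᴴ * a.valᴴ) * J * (a.val * a⁻¹.val)) := by
          simp only [Matrix.mul_assoc]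
      _ = _ := by rw [h1, h2, Matrix.one_mul, Matrix.mul_one]

lemma U_le_GU {n : ℕ} (J : Matrix (Fin n) (Fin n) (Lv p d)) : U J ≤ GU J :=
  fun g hg => ⟨1, by
    change g.valᴴ * J * g.val = J at hg
    rw [hg, Units.val_one, one_smul]⟩

/-- `F̃(ℚ_p) = GU(1,1)(ℚ_p)`. -/
abbrev Ft (p : ℕ) [Fact p.Prime] (d : ℤ) : Subgroup (GL (Fin 2) (Lv p d)) := GU (J1 (Lv p d))

/-- `F̃₁(ℚ_p) = U(1,1)(ℚ_p)`, with the topology inherited from `GL₂(L_p)`. -/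
abbrev F1 (p : ℕ) [Fact p.Prime] (d : ℤ) : Subgroup (GL (Fin 2) (Lv p d)) := U (J1 (Lv p d))

/-- The Borel σ-algebra on `F̃₁(ℚ_p)`. -/
instance : MeasurableSpace (F1 p d) := borel _

instance : BorelSpace (F1 p d) := ⟨rfl⟩

/-- `H̃(ℚ_p) = GU(3,3)(ℚ_p)`. -/
abbrev Ht (p : ℕ) [Fact p.Prime] (d : ℤ) : Subgroup (GL (Fin 6) (Lv p d)) := GU (J3 (Lv p d))

/-- An element of `GL_n(L_p)` lies in `GL_n(ℤ_{L,p})`. -/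
def IsIntegralGL {n : ℕ} (g : GL (Fin n) (Lv p d)) : Prop :=
  (∀ i j, IsInt (g i j)) ∧ ∀ i j, IsInt ((g⁻¹ : GL (Fin n) (Lv p d)) i j)

/-- The maximal compact subgroup `F̃₁(ℚ_p) ∩ GL₂(ℤ_{L,p})` of `F̃₁(ℚ_p)`. -/
def KF1 (p : ℕ) [Fact p.Prime] (d : ℤ) : Set (F1 p d) :=
  {h | IsIntegralGL (h : GL (Fin 2) (Lv p d))}

/-- The subgroup `I'_p` of `K_p = GU(3,3)(ℚ_p) ∩ GL₆(ℤ_{L,p})`: the elements whose reduction modulo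
`p` has entries in `𝔽_p` (i.e. all `√-d`-components are divisible by `p`) and lies in the Borel
subgroup of `GSp₆(𝔽_p)` of the block matrices `(A, B; 0, D)` with `A` lower triangular and
`D` (a multiple of the inverse transpose of `A`) upper triangular. -/
def IwahoriH (p : ℕ) [Fact p.Prime] (d : ℤ) : Set (GL (Fin 6) (Lv p d)) :=
  {k | k ∈ Ht p d ∧ IsIntegralGL k ∧ (∀ i j, ‖(k i j).im‖ < 1) ∧
    ∀ i j : Fin 6,
      ((i < 3 ∧ j < 3 ∧ i < j) ∨ (3 ≤ i ∧ j < 3) ∨ (3 ≤ i ∧ 3 ≤ j ∧ j < i)) → ‖(k i j).re‖ < 1}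

/-! ## Explicit matrices -/

/-- A `6 × 6` matrix from `3 × 3` blocks. -/
def blk {R : Type} (A B C D : Matrix (Fin 3) (Fin 3) R) : Matrix (Fin 6) (Fin 6) R :=
  Matrix.reindex (finSumFinEquiv : Fin 3 ⊕ Fin 3 ≃ Fin 6) (finSumFinEquiv : Fin 3 ⊕ Fin 3 ≃ Fin 6)
    (Matrix.fromBlocks A B C D)

/-- `m(A, t) = (A, 0; 0, t (A̅⁻¹)ᵗ)` in the Levi subgroup of the Siegel parabolic `P_{H̃}`. -/
def mSiegel (A : GL (Fin 3) (Lv p d)) (t : ℚ_[p]ˣ) : Matrix (Fin 6) (Fin 6) (Lv p d) :=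
  blk (A : Matrix _ _ (Lv p d)) 0 0
    ((t : ℚ_[p]) • ((A⁻¹ : GL (Fin 3) (Lv p d)) : Matrix (Fin 3) (Fin 3) (Lv p d))ᴴ)

/-- `n(b) = (1, b; 0, 1)`, in the unipotent radical of `P_{H̃}` when `b` is hermitian. -/
def nSiegel (b : Matrix (Fin 3) (Fin 3) (Lv p d)) : Matrix (Fin 6) (Fin 6) (Lv p d) :=
  blk 1 b 0 1

/-- The matrix `Q`. -/
def Qmat (R : Type) [CommRing R] : Matrix (Fin 6) (Fin 6) R :=
  !![0, 1, 0, 0, 0,  0;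
     1, 0, 0, 0, 0,  0;
     0, 0, 0, 0, 0, -1;
     0, 0, 0, 0, 1, -1;
     0, 0, 0, 1, 0,  0;
     0, 1, 1, 0, 0,  0]

/-- The embedding `ι` of pairs in `GU(2,2) × GU(1,1)` with equal multipliers into `GU(3,3)`. -/
def iota {R : Type} [CommRing R] (g : Matrix (Fin 4) (Fin 4) R) (h : Matrix (Fin 2) (Fin 2) R) :
    Matrix (Fin 6) (Fin 6) R :=
  !![g 0 0, g 0 1,        0, g 0 2, g 0 3,        0;
     g 1 0, g 1 1,        0, g 1 2, g 1 3,        0;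
         0,     0,    h 0 0,     0,     0, -(h 0 1);
     g 2 0, g 2 1,        0, g 2 2, g 2 3,        0;
     g 3 0, g 3 1,        0, g 3 2, g 3 3,        0;
         0,     0, -(h 1 0),     0,     0,    h 1 1]

def s1 (R : Type) [CommRing R] : Matrix (Fin 4) (Fin 4) R :=
  !![0, 1, 0, 0; 1, 0, 0, 0; 0, 0, 0, 1; 0, 0, 1, 0]

def s2 (R : Type) [CommRing R] : Matrix (Fin 4) (Fin 4) R :=
  !![0, 0, 0, 1; 0, 0, 1, 0; 0, -1, 0, 0; -1, 0, 0, 0]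

def s3 (R : Type) [CommRing R] : Matrix (Fin 4) (Fin 4) R :=
  !![0, 0, 1, 0; 0, 0, 0, 1; -1, 0, 0, 0; 0, -1, 0, 0]

def s4 (R : Type) [CommRing R] : Matrix (Fin 4) (Fin 4) R :=
  !![0, -1, 0, 0; -1, 0, 0, 0; 0, 0, 0, -1; 1, 0, -1, 0]

def s5 (R : Type) [CommRing R] : Matrix (Fin 4) (Fin 4) R :=
  !![0, -1, 0, 0; -1, 0, 0, 0; 0, 1, 0, -1; 0, 0, -1, 0]

/-- `α = (b + √-d) / 2` in `L_p`. -/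
def alpha (p : ℕ) [Fact p.Prime] (d b : ℤ) : Lv p d := ⟨(b : ℚ_[p]) / 2, 1 / 2⟩

/-- The matrix `Θ`. -/
def Theta (p : ℕ) [Fact p.Prime] (d b : ℤ) : Matrix (Fin 4) (Fin 4) (Lv p d) :=
  !![          1, 0, 0,                   0;
     alpha p d b, 1, 0,                   0;
               0, 0, 1, -star (alpha p d b);
               0, 0, 0,                   1]

/-- The set `Y_p` for a prime `p` dividing `M`. -/
def Y (p : ℕ) [Fact p.Prime] (d b : ℤ) : Set (Matrix (Fin 4) (Fin 4) (Lv p d)) :=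
  {1, s1 _, s2 _, s3 _, Theta p d b, Theta p d b * s2 _, Theta p d b * s4 _, Theta p d b * s5 _}

/-! ## The section `Υ_p` -/

/-- A decomposition `h = n(c) m(A, t) Q k` with `c` hermitian and `k ∈ I'_p`; it exists exactly when
`h ∈ P_{H̃}(ℚ_p) Q I'_p`. -/
structure SiegelDecomp (h : Matrix (Fin 6) (Fin 6) (Lv p d)) where
  c : Matrix (Fin 3) (Fin 3) (Lv p d)
  A : GL (Fin 3) (Lv p d)
  t : ℚ_[p]ˣ
  k : GL (Fin 6) (Lv p d)
  c_hermitian : cᴴ = c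
  k_mem : k ∈ IwahoriH p d
  eq : h = nSiegel c * mSiegel A t * Qmat _ * (k : Matrix _ _ (Lv p d))

open Classical in
/-- The section `Υ_p(·, s) ∈ I_p(Λ_p, s)` that is right invariant under `I'_p`, takes the value `1`
at `Q` and is supported on `P_{H̃}(ℚ_p) Q I'_p`. The value does not depend on the chosen decomposition: if
`n(c) m(A, t) ∈ Q I'_p Q⁻¹` then `t` is a `p`-adic unit and `det A ∈ Γ⁰_{L,p}`, a subgroup on which
`Λ` is assumed to be trivial. -/
def Upsilon (Λ : (Lv p d)ˣ →* Circle) (s : ℂ) (h : Matrix (Fin 6) (Fin 6) (Lv p d)) : ℂ :=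
  if H : Nonempty (SiegelDecomp h) then
    let D := H.some
    ((‖(D.t : ℚ_[p])‖ : ℝ) : ℂ) ^ (-9 * (s + 1 / 2)) *
      ((‖QuadraticAlgebra.norm (D.A : Matrix (Fin 3) (Fin 3) (Lv p d)).det‖ : ℝ) : ℂ) ^
        (3 * (s + 1 / 2)) *
      (Λ (Matrix.GeneralLinearGroup.det D.A) : ℂ)
  else 0

/-! ## Steinberg representations of `GL₂(ℚ_p)` and their Whittaker new vectors -/

/-- Locally constant functions `f` on `GL₂(ℚ_p)` with `f (b g) = f g` for all upper triangular `b`,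
i.e. locally constant functions on the projective line. -/
def indTrivial (p : ℕ) [Fact p.Prime] : Submodule ℂ (GL (Fin 2) ℚ_[p] → ℂ) where
  carrier := {f | IsLocallyConstant f ∧
    ∀ b g : GL (Fin 2) ℚ_[p], b 1 0 = 0 → f (b * g) = f g}
  zero_mem' := ⟨IsLocallyConstant.const 0, fun _ _ _ => rfl⟩
  add_mem' := fun {f g} hf hg => ⟨hf.1.add hg.1, fun b x hb => by
    simp [hf.2 b x hb, hg.2 b x hb]⟩
  smul_mem' := fun c f hf => ⟨hf.1.comp (fun z => c • z), fun b x hb => by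
    simp [hf.2 b x hb]⟩

/-- The action of `GL₂(ℚ_p)` on `indTrivial` by right translation. -/
def rightTranslation (p : ℕ) [Fact p.Prime] :
    Representation ℂ (GL (Fin 2) ℚ_[p]) (indTrivial p) where
  toFun g :=
    { toFun := fun f => ⟨fun x => f.1 (x * g),
        f.2.1.comp_continuous (continuous_mul_const g), fun b x hb => by
          simpa [mul_assoc] using f.2.2 b (x * g) hb⟩
      map_add' := fun _ _ => rfl
      map_smul' := fun _ _ => rfl }
  map_one' := by ext; simp
  map_mul' := fun _ _ => by ext; simp [mul_assoc]

/-- The constant functions in `indTrivial`. -/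
def constants (p : ℕ) [Fact p.Prime] : Submodule ℂ (indTrivial p) where
  carrier := {f | ∃ c : ℂ, ∀ x, f.1 x = c}
  zero_mem' := ⟨0, fun _ => rfl⟩
  add_mem' := by
    rintro f g ⟨c, hc⟩ ⟨c', hc'⟩
    exact ⟨c + c', fun x => by simp [hc, hc']⟩
  smul_mem' := by
    rintro a f ⟨c, hc⟩
    exact ⟨a * c, fun x => by simp [hc]⟩

/-- The space of the Steinberg representation: functions on the projective line modulo constants. -/
abbrev StSpace (p : ℕ) [Fact p.Prime] : Type := indTrivial p ⧸ constants p

/-- The Steinberg representation of `GL₂(ℚ_p)`. -/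
def steinberg (p : ℕ) [Fact p.Prime] : Representation ℂ (GL (Fin 2) ℚ_[p]) (StSpace p) :=
  (rightTranslation p).quotient (constants p) (by
    rintro g f ⟨c, hc⟩
    exact ⟨c, fun x => hc (x * g)⟩)

/-- The twist `ξ ⊗ St` of the Steinberg representation by a character `ξ` of `ℚ_pˣ`. -/
def twistedSteinberg (p : ℕ) [Fact p.Prime] (ξ : ℚ_[p]ˣ →* ℂˣ) :
    Representation ℂ (GL (Fin 2) ℚ_[p]) (StSpace p) where
  toFun g := (ξ (Matrix.GeneralLinearGroup.det g) : ℂ) • steinberg p g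
  map_one' := by simp
  map_mul' g h := by
    ext
    simp [mul_smul, smul_comm (ξ (Matrix.GeneralLinearGroup.det g) : ℂ)]

/-- The unipotent matrix `(1, x; 0, 1)` in `GL₂(ℚ_p)`. -/
def unip (x : ℚ_[p]) : GL (Fin 2) ℚ_[p] :=
  ⟨!![1, x; 0, 1], !![1, -x; 0, 1], by ext i j; fin_cases i <;> fin_cases j <;> simp,
    by ext i j; fin_cases i <;> fin_cases j <;> simp⟩

/-- `Γ_{0,p}`: the matrices in `GL₂(ℤ_p)` that are upper triangular modulo `p`. -/
def Gamma0p (p : ℕ) [Fact p.Prime] : Set (GL (Fin 2) ℚ_[p]) :=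
  {k | (∀ i j, ‖k i j‖ ≤ 1) ∧ (∀ i j, ‖(k⁻¹ : GL (Fin 2) ℚ_[p]) i j‖ ≤ 1) ∧ ‖k 1 0‖ < 1}

/-- `W₀` is a `Γ_{0,p}`-invariant vector in the `ψ`-Whittaker model of `ξ ⊗ St`. The Whittaker model
consists of the functions `g ↦ ℓ (π(g) v)`, with `v` a vector and `ℓ` a `ψ`-Whittaker
functional. -/
def IsWhittakerNewvector (ψ : AddChar ℚ_[p] Circle) (ξ : ℚ_[p]ˣ →* ℂˣ)
    (W₀ : GL (Fin 2) ℚ_[p] → ℂ) : Prop :=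
  ∃ (ℓ : StSpace p →ₗ[ℂ] ℂ) (v : StSpace p),
    (∀ x w, ℓ (twistedSteinberg p ξ (unip x) w) = (ψ x : ℂ) * ℓ w) ∧
    (∀ k ∈ Gamma0p p, twistedSteinberg p ξ k v = v) ∧
    ∀ g, W₀ g = ℓ (twistedSteinberg p ξ g v)

/-- `W` is the function on `F̃(ℚ_p) = L_pˣ · GL₂(ℚ_p)` with `W (a g) = W₀ g` for `a ∈ L_pˣ`,
`g ∈ GL₂(ℚ_p)`, where `W₀` is a `Γ_{0,p}`-invariant vector in the Whittaker model of `ξ ⊗ St`. -/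
def IsLocalWhittaker (ψ : AddChar ℚ_[p] Circle) (ξ : ℚ_[p]ˣ →* ℂˣ) (W : Ft p d → ℂ) : Prop :=
  ∃ W₀ : GL (Fin 2) ℚ_[p] → ℂ, IsWhittakerNewvector ψ ξ W₀ ∧
    ∀ (a : (Lv p d)ˣ) (g : GL (Fin 2) ℚ_[p]) (h : Ft p d),
      ((h : GL (Fin 2) (Lv p d)) : Matrix (Fin 2) (Fin 2) (Lv p d)) =
        (a : Lv p d) • (g : Matrix (Fin 2) (Fin 2) ℚ_[p]).map (algebraMap ℚ_[p] (Lv p d)) →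
      W h = W₀ g

/-! ## The local zeta integral -/

/-- The integrand `h ↦ Υ_p(Q ι(k, h), s) W(g h) Λ_p(det h)⁻¹` on `F̃₁(ℚ_p)`. -/
def zetaIntegrand (Λ : (Lv p d)ˣ →* Circle) (W : Ft p d → ℂ) (g : Ft p d)
    (k : Matrix (Fin 4) (Fin 4) (Lv p d)) (s : ℂ) (h : F1 p d) : ℂ :=
  Upsilon Λ s (Qmat _ * iota k ((h : GL (Fin 2) (Lv p d)) : Matrix (Fin 2) (Fin 2) (Lv p d))) *
    W (g * Subgroup.inclusion (U_le_GU _) h) *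
    ((Λ (Matrix.GeneralLinearGroup.det (h : GL (Fin 2) (Lv p d))))⁻¹ : Circle)

/-- The local zeta integral `Z_p(g, k, s)`, with respect to the measure `μ` on `F̃₁(ℚ_p)`. -/
def zetaIntegral (μ : Measure (F1 p d)) (Λ : (Lv p d)ˣ →* Circle) (W : Ft p d → ℂ)
    (g : Ft p d) (k : Matrix (Fin 4) (Fin 4) (Lv p d)) (s : ℂ) : ℂ :=
  ∫ h, zetaIntegrand Λ W g k s h ∂μ

end LocalZeta

end

set_option linter.unusedSimpArgs false
set_option linter.unusedSectionVars false

noncomputable section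

namespace LocalZeta

variable {p : ℕ} [Fact p.Prime] {d : ℤ}

/-! ## Arithmetic of `L_p` -/

/-! Write `O = ℤ_p + pℤ_{L,p}` (`IsO`) and `𝔭 = pℤ_{L,p}` (`IsP`). The Siegel parabolic acts on the
lower half of a `6 × 6` matrix through the block `t(A̅⁻¹)ᵗ` alone. Hence the minor on columns 2, 3,
4 of the lower half of `n(c) m(A,t) Q k` is `t³ (star det A)⁻¹` times a unit of `O`, on which `Λ` is
trivial, and this minor computes the section (`Upsilon_eq`). The same action restricts the rows that
such a lower half can span (`SiegelDecomp.row_mem`), which yields necessary conditions for a point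
to lie in the support; explicit factorizations (`decomp_lowerLevi`, `decomp_swap`) show that they
suffice.

An element of the open cell of `U(1,1)` is `lower(γ) · diag(y⁻¹, star y) · upper(β)` with `β, γ ∈
ℚ_p`. For `k = 1` and `k = s₁` the section lives on `β ∈ ℤ_p`, `γ ∈ pℤ_p`, `y ∈ O`; for `k = Θ` the
last condition becomes `y ∈ 𝔭`; for the other five elements of `Y_p` it vanishes identically. On the
support the integrand is `|N y|^(3(s+1/2)) Λ(y) W(g h)` (`cellFn`).

An element of `O` is either a unit or in `𝔭`. Unit `y` gives the compact open group `K0`, on which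
the integrand is the constant `W g`; its volume is `(p+1)⁻²`, one factor `p+1` counting `ℙ¹(𝔽_p)`
(`measure_Kmax`), the other `𝔽_{p²}ˣ/𝔽_pˣ` (`measure_K1`). On the part with `y ∈ 𝔭`, right
translation by `κ ∈ K1` multiplies the integrand by `Λ(κ₀₀)⁻¹` (`suppFn_mul`). As `Λ` is nontrivial
on units, the integral over every coset of `K1` is zero, so this part contributes nothing whenever
the integral converges (`integral_suppFn`).

For convergence, the `y` with `|N y| = p^(-2m)` are covered by `p^(2m)` cosets of `K1`, and the
integrand there is `O(p^(-6m(Re s + 1/2)))` because `W` is bounded; the resulting geometric series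
converges for `Re s > -1/6` (`integrable_suppFn`). Boundedness of `W` comes from the model of
Steinberg on functions on the projective line: the Iwahori-fixed function takes two values, and an
`U_p`-type relation and an Atkin–Lehner relation, both modulo constants, control every translate
(`norm_apply_rightTranslation_le`). -/

lemma norm_intCast_sub_sq_eq_one [hin : Fact (legendreSym p (-d) = -1)] (r : ℚ_[p])
    (hr : ‖r‖ ≤ 1) : ‖r ^ 2 + d‖ = 1 := by
  have hle : ‖r ^ 2 + d‖ ≤ 1 := by
    refine (Padic.nonarchimedean _ _).trans (max_le ?_ (Padic.norm_int_le_one d))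
    rw [norm_pow]
    exact pow_le_one₀ (norm_nonneg _) hr
  refine le_antisymm hle (not_lt.1 fun hlt => ?_)
  let z : ℤ_[p] := ⟨r, hr⟩
  have hz : ‖z ^ 2 + (d : ℤ_[p])‖ < 1 := by
    rw [PadicInt.norm_def]
    push_cast
    exact hlt
  have hz' : (PadicInt.toZMod (z ^ 2 + (d : ℤ_[p])) : ZMod p) = 0 := by
    rw [← RingHom.mem_ker, PadicInt.ker_toZMod, IsLocalRing.mem_maximalIdeal, mem_nonunits_iff,
      PadicInt.isUnit_iff]
    exact hz.ne
  rw [map_add, map_pow, map_intCast] at hz'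
  -- If `r² + d` were not a unit, the residue of `r` would be a square root of `-d` modulo `p`.
  have h1 := (legendreSym.eq_neg_one_iff p).1 hin.out
  apply h1
  refine ⟨PadicInt.toZMod z, ?_⟩
  push_cast
  linear_combination -hz'

/-- This is the form of inertness that makes `Lv p d` a field: a square root of `-d` in `ℚ_p` would
be integral, and then `r² + d = 0` would be a unit. -/
instance inert_fact [Fact (legendreSym p (-d) = -1)] :
    Fact (∀ r : ℚ_[p], r ^ 2 ≠ ((-d : ℤ) : ℚ_[p]) + 0 * r) := by
  refine ⟨fun r hr => ?_⟩
  have hr' : r ^ 2 + d = 0 := by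
    rw [hr]; push_cast; ring
  have hle : ‖r‖ ≤ 1 := by
    have : ‖r‖ ^ 2 ≤ 1 := by
      rw [← norm_pow, hr]
      simpa using Padic.norm_int_le_one (p := p) d
    exact (pow_le_one_iff_of_nonneg (norm_nonneg _) two_ne_zero).1 this
  have := norm_intCast_sub_sq_eq_one (p := p) (d := d) r hle
  simp [hr'] at this

/-- The normalized absolute value of the norm of an element of `L_p`. -/
def nrm (z : Lv p d) : ℝ := ‖QuadraticAlgebra.norm z‖

lemma nrm_nonneg (z : Lv p d) : 0 ≤ nrm z := norm_nonneg _

@[simp] lemma nrm_mul (z w : Lv p d) : nrm (z * w) = nrm z * nrm w := by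
  simp [nrm, map_mul]

@[simp] lemma nrm_one : nrm (1 : Lv p d) = 1 := by simp [nrm]

@[simp] lemma nrm_zero : nrm (0 : Lv p d) = 0 := by simp [nrm]

@[simp] lemma nrm_star (z : Lv p d) : nrm (star z) = nrm z := by simp [nrm]

@[simp] lemma nrm_neg (z : Lv p d) : nrm (-z) = nrm z := by simp [nrm]

@[simp] lemma nrm_algebraMap (r : ℚ_[p]) : nrm (algebraMap ℚ_[p] (Lv p d) r) = ‖r‖ ^ 2 := by
  simp [nrm]

lemma nrm_pow (z : Lv p d) (n : ℕ) : nrm (z ^ n) = nrm z ^ n := by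
  simp [nrm, map_pow]

section inert
variable [hin : Fact (legendreSym p (-d) = -1)]

@[simp] lemma nrm_inv (z : Lv p d) : nrm z⁻¹ = (nrm z)⁻¹ := by
  by_cases hz : z = 0
  · simp [hz]
  · refine eq_inv_of_mul_eq_one_left ?_
    rw [← nrm_mul, inv_mul_cancel₀ hz, nrm_one]

lemma nrm_eq_zero {z : Lv p d} : nrm z = 0 ↔ z = 0 := by
  rw [nrm, norm_eq_zero, QuadraticAlgebra.norm_eq_zero_iff_eq_zero]

lemma nrm_pos {z : Lv p d} (hz : z ≠ 0) : 0 < nrm z :=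
  lt_of_le_of_ne (nrm_nonneg z) fun h => hz (nrm_eq_zero.1 h.symm)

lemma norm_d_eq_one : ‖(d : ℚ_[p])‖ = 1 := by
  simpa using norm_intCast_sub_sq_eq_one (p := p) (d := d) 0 (by simp)

/-- If the coordinates have different absolute values, the ultrametric inequality decides, `d` being
a unit. If they agree, dividing by the imaginary part leaves `r² + d` with `r` integral, a unit.
This turns `IsInt` and `IsP` into bounds on `nrm`. -/
lemma nrm_eq_max (z : Lv p d) : nrm z = max ‖z.re‖ ‖z.im‖ ^ 2 := by
  have hN : QuadraticAlgebra.norm z = z.re ^ 2 + d * z.im ^ 2 := by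
    rw [QuadraticAlgebra.norm_def]; push_cast; ring
  rw [nrm, hN]
  rcases lt_trichotomy ‖z.re‖ ‖z.im‖ with h | h | h
  · rw [max_eq_right h.le, add_comm, IsUltrametricDist.norm_add_eq_max_of_norm_ne_norm]
    · rw [norm_mul, norm_d_eq_one, one_mul, norm_pow, norm_pow, max_eq_left]
      gcongr
    · rw [norm_mul, norm_d_eq_one, one_mul, norm_pow, norm_pow]
      exact (pow_lt_pow_left₀ h (norm_nonneg _) two_ne_zero).ne'
  · rw [← h, max_self]
    by_cases h0 : z.im = 0
    · have : z.re = 0 := by simpa [h0] using h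
      simp [h0, this]
    · have : z.re ^ 2 + d * z.im ^ 2 = ((z.re / z.im) ^ 2 + d) * z.im ^ 2 := by
        field_simp
      rw [this, norm_mul, norm_intCast_sub_sq_eq_one, one_mul, norm_pow, h]
      rw [norm_div, h, div_self (norm_ne_zero_iff.2 h0)]
  · rw [max_eq_left h.le, IsUltrametricDist.norm_add_eq_max_of_norm_ne_norm]
    · rw [norm_mul, norm_d_eq_one, one_mul, norm_pow, norm_pow, max_eq_left]
      gcongr
    · rw [norm_mul, norm_d_eq_one, one_mul, norm_pow, norm_pow]
      exact (pow_lt_pow_left₀ h (norm_nonneg _) two_ne_zero).ne'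

end inert

/-- The elements of `ℤ_p + p ℤ_{L,p}`. -/
def IsO (z : Lv p d) : Prop := ‖z.re‖ ≤ 1 ∧ ‖z.im‖ < 1

/-- The elements of `p ℤ_{L,p}`. -/
def IsP (z : Lv p d) : Prop := ‖z.re‖ < 1 ∧ ‖z.im‖ < 1

lemma IsP.isO {z : Lv p d} (h : IsP z) : IsO z := ⟨h.1.le, h.2⟩

lemma IsO.isInt {z : Lv p d} (h : IsO z) : IsInt z := ⟨h.1, h.2.le⟩

lemma IsP.isInt {z : Lv p d} (h : IsP z) : IsInt z := h.isO.isInt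

/-! ### Closure properties of `ℤ_{L,p}`, the order `ℤ_p + pℤ_{L,p}` and the ideal `pℤ_{L,p}` -/

section closure

lemma padic_add_le {x y : ℚ_[p]} (hx : ‖x‖ ≤ 1) (hy : ‖y‖ ≤ 1) : ‖x + y‖ ≤ 1 :=
  (Padic.nonarchimedean _ _).trans (max_le hx hy)

lemma padic_add_lt {x y : ℚ_[p]} (hx : ‖x‖ < 1) (hy : ‖y‖ < 1) : ‖x + y‖ < 1 :=
  (Padic.nonarchimedean _ _).trans_lt (max_lt hx hy)

lemma padic_mul_le {x y : ℚ_[p]} (hx : ‖x‖ ≤ 1) (hy : ‖y‖ ≤ 1) : ‖x * y‖ ≤ 1 := by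
  rw [norm_mul]; exact mul_le_one₀ hx (norm_nonneg _) hy

lemma padic_mul_lt_left {x y : ℚ_[p]} (hx : ‖x‖ < 1) (hy : ‖y‖ ≤ 1) : ‖x * y‖ < 1 := by
  rw [norm_mul]; exact mul_lt_one_of_nonneg_of_lt_one_left (norm_nonneg _) hx hy

lemma padic_mul_lt_right {x y : ℚ_[p]} (hx : ‖x‖ ≤ 1) (hy : ‖y‖ < 1) : ‖x * y‖ < 1 := by
  rw [mul_comm]; exact padic_mul_lt_left hy hx

lemma padic_d_le : ‖((-d : ℤ) : ℚ_[p])‖ ≤ 1 := Padic.norm_int_le_one _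

variable {z w : Lv p d}

lemma IsInt.zero : IsInt (0 : Lv p d) := by simp [IsInt]

lemma IsInt.one : IsInt (1 : Lv p d) := by simp [IsInt, QuadraticAlgebra.re_one, QuadraticAlgebra.im_one]

lemma IsInt.neg (hz : IsInt z) : IsInt (-z) := by simpa [IsInt] using hz

lemma IsInt.add (hz : IsInt z) (hw : IsInt w) : IsInt (z + w) :=
  ⟨padic_add_le hz.1 hw.1, padic_add_le hz.2 hw.2⟩

lemma IsInt.sub (hz : IsInt z) (hw : IsInt w) : IsInt (z - w) := by
  rw [sub_eq_add_neg]; exact hz.add hw.neg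

lemma IsInt.mul (hz : IsInt z) (hw : IsInt w) : IsInt (z * w) := by
  refine ⟨?_, ?_⟩
  · rw [QuadraticAlgebra.re_mul]
    exact padic_add_le (padic_mul_le hz.1 hw.1) (padic_mul_le (padic_mul_le padic_d_le hz.2) hw.2)
  · rw [QuadraticAlgebra.im_mul, zero_mul, zero_mul, add_zero]
    exact padic_add_le (padic_mul_le hz.1 hw.2) (padic_mul_le hz.2 hw.1)

lemma IsInt.star (hz : IsInt z) : IsInt (star z) := by simpa [IsInt] using hz

lemma IsO.zero : IsO (0 : Lv p d) := by simp [IsO]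

lemma IsO.one : IsO (1 : Lv p d) := by simp [IsO, QuadraticAlgebra.re_one, QuadraticAlgebra.im_one]

lemma IsO.neg (hz : IsO z) : IsO (-z) := by simpa [IsO] using hz

lemma IsO.add (hz : IsO z) (hw : IsO w) : IsO (z + w) :=
  ⟨padic_add_le hz.1 hw.1, padic_add_lt hz.2 hw.2⟩

lemma IsO.sub (hz : IsO z) (hw : IsO w) : IsO (z - w) := by
  rw [sub_eq_add_neg]; exact hz.add hw.neg

lemma IsO.mul (hz : IsO z) (hw : IsO w) : IsO (z * w) := by
  refine ⟨?_, ?_⟩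
  · rw [QuadraticAlgebra.re_mul]
    exact padic_add_le (padic_mul_le hz.1 hw.1) (padic_mul_le (padic_mul_le padic_d_le hz.2.le) hw.2.le)
  · rw [QuadraticAlgebra.im_mul, zero_mul, zero_mul, add_zero]
    exact padic_add_lt (padic_mul_lt_right hz.1 hw.2) (padic_mul_lt_left hz.2 hw.1)

lemma IsO.star (hz : IsO z) : IsO (star z) := by simpa [IsO] using hz

lemma isO_algebraMap {r : ℚ_[p]} : IsO (algebraMap ℚ_[p] (Lv p d) r) ↔ ‖r‖ ≤ 1 := by
  simp [IsO]

lemma isP_algebraMap {r : ℚ_[p]} : IsP (algebraMap ℚ_[p] (Lv p d) r) ↔ ‖r‖ < 1 := by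
  simp [IsP]

lemma isInt_algebraMap {r : ℚ_[p]} : IsInt (algebraMap ℚ_[p] (Lv p d) r) ↔ ‖r‖ ≤ 1 := by
  simp [IsInt]

lemma IsP.zero : IsP (0 : Lv p d) := by simp [IsP]

lemma IsP.neg (hz : IsP z) : IsP (-z) := by simpa [IsP] using hz

lemma IsP.add (hz : IsP z) (hw : IsP w) : IsP (z + w) :=
  ⟨padic_add_lt hz.1 hw.1, padic_add_lt hz.2 hw.2⟩

lemma IsP.sub (hz : IsP z) (hw : IsP w) : IsP (z - w) := by
  rw [sub_eq_add_neg]; exact hz.add hw.neg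

lemma IsP.mul_int (hz : IsP z) (hw : IsInt w) : IsP (z * w) := by
  refine ⟨?_, ?_⟩
  · rw [QuadraticAlgebra.re_mul]
    exact padic_add_lt (padic_mul_lt_left hz.1 hw.1)
      (padic_mul_lt_left (padic_mul_lt_right padic_d_le hz.2) hw.2)
  · rw [QuadraticAlgebra.im_mul, zero_mul, zero_mul, add_zero]
    exact padic_add_lt (padic_mul_lt_left hz.1 hw.2) (padic_mul_lt_left hz.2 hw.1)

lemma IsInt.mul_isP (hz : IsInt z) (hw : IsP w) : IsP (z * w) := by
  rw [mul_comm]; exact hw.mul_int hz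

lemma IsP.star (hz : IsP z) : IsP (star z) := by simpa [IsP] using hz

variable [hin : Fact (legendreSym p (-d) = -1)]

lemma isInt_iff_nrm : IsInt z ↔ nrm z ≤ 1 := by
  rw [nrm_eq_max, pow_le_one_iff_of_nonneg (le_max_of_le_left (norm_nonneg _)) two_ne_zero, max_le_iff]
  rfl

lemma isP_iff_nrm : IsP z ↔ nrm z < 1 := by
  rw [nrm_eq_max, pow_lt_one_iff_of_nonneg (le_max_of_le_left (norm_nonneg _)) two_ne_zero, max_lt_iff]
  rfl

lemma IsO.nrm_lt_or_eq (hz : IsO z) : nrm z = 1 ∨ IsP z := by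
  rcases (isInt_iff_nrm.1 hz.isInt).lt_or_eq with h | h
  · exact .inr (isP_iff_nrm.2 h)
  · exact .inl h

/-- The inverse of a unit of the order is in the order. -/
lemma IsO.inv (hz : IsO z) (h1 : nrm z = 1) : IsO z⁻¹ := by
  have hN : ‖(QuadraticAlgebra.norm z)⁻¹‖ = 1 := by
    rw [norm_inv]; rw [nrm] at h1; rw [h1, inv_one]
  have hs := hz.star
  refine ⟨?_, ?_⟩
  · rw [QuadraticAlgebra.re_inv, norm_mul, hN, one_mul]
    exact hs.1
  · rw [QuadraticAlgebra.im_inv, norm_neg, norm_mul, hN, one_mul]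
    exact hz.2

lemma IsO.unit_of_mul (hz : IsInt z) (hw : IsInt w) (h : nrm (z * w) = 1) : nrm z = 1 := by
  rw [nrm_mul] at h
  have h1 := isInt_iff_nrm.1 hz
  have h2 := isInt_iff_nrm.1 hw
  have := nrm_nonneg z
  have := nrm_nonneg w
  nlinarith

lemma nrm_add_isP (hz : nrm z = 1) (hw : IsP w) : nrm (z + w) = 1 := by
  have hzi : IsInt z := isInt_iff_nrm.2 hz.le
  refine le_antisymm (isInt_iff_nrm.1 (hzi.add hw.isInt)) (not_lt.1 fun hlt => ?_)
  have := (isP_iff_nrm.2 hlt).sub hw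
  rw [add_sub_cancel_right, isP_iff_nrm] at this
  exact this.ne hz

end closure

/-! ### Characters of `L_pˣ` extended by zero -/

section character
variable [hin : Fact (legendreSym p (-d) = -1)]

/-- The extension by zero of a character of `L_pˣ` to `L_p`. -/
def charZ (Λ : (Lv p d)ˣ →* Circle) (z : Lv p d) : ℂ :=
  open Classical in if h : z = 0 then 0 else (Λ (Units.mk0 z h) : ℂ)

variable (Λ : (Lv p d)ˣ →* Circle)

@[simp] lemma charZ_coe (u : (Lv p d)ˣ) : charZ Λ (u : Lv p d) = Λ u := by
  rw [charZ, dif_neg u.ne_zero]; simp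

@[simp] lemma charZ_zero : charZ Λ 0 = 0 := by simp [charZ]

@[simp] lemma charZ_one : charZ Λ 1 = 1 := by simpa using charZ_coe Λ 1

@[simp] lemma charZ_mul (z w : Lv p d) : charZ Λ (z * w) = charZ Λ z * charZ Λ w := by
  by_cases hz : z = 0
  · simp [hz]
  by_cases hw : w = 0
  · simp [hw]
  lift z to (Lv p d)ˣ using isUnit_iff_ne_zero.2 hz
  lift w to (Lv p d)ˣ using isUnit_iff_ne_zero.2 hw
  rw [← Units.val_mul, charZ_coe, charZ_coe, charZ_coe, map_mul, Circle.coe_mul]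

@[simp] lemma charZ_inv (z : Lv p d) : charZ Λ z⁻¹ = (charZ Λ z)⁻¹ := by
  by_cases hz : z = 0
  · simp [hz]
  · refine eq_inv_of_mul_eq_one_left ?_
    rw [← charZ_mul, inv_mul_cancel₀ hz, charZ_one]

lemma norm_charZ {z : Lv p d} (hz : z ≠ 0) : ‖charZ Λ z‖ = 1 := by
  lift z to (Lv p d)ˣ using isUnit_iff_ne_zero.2 hz
  rw [charZ_coe, Circle.norm_coe]

variable {Λ}

lemma charZ_algebraMap (hΛ : ∀ x : ℚ_[p]ˣ, Λ (baseUnits p d x) = 1) {r : ℚ_[p]} (hr : r ≠ 0) :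
    charZ Λ (algebraMap ℚ_[p] (Lv p d) r) = 1 := by
  have := charZ_coe Λ (baseUnits p d (Units.mk0 r hr))
  rw [hΛ] at this
  simpa [baseUnits] using this

/-- The product `z * star z` is the norm, an element of `ℚ_p`, where `Λ` is trivial. -/
lemma charZ_star (hΛ : ∀ x : ℚ_[p]ˣ, Λ (baseUnits p d x) = 1) (z : Lv p d) :
    charZ Λ (star z) = (charZ Λ z)⁻¹ := by
  by_cases hz : z = 0
  · simp [hz]
  · refine eq_inv_of_mul_eq_one_right ?_
    rw [← charZ_mul, ← QuadraticAlgebra.algebraMap_norm_eq_mul_star, charZ_algebraMap hΛ]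
    rwa [Ne, QuadraticAlgebra.norm_eq_zero_iff_eq_zero]

lemma charZ_neg (hΛ : ∀ x : ℚ_[p]ˣ, Λ (baseUnits p d x) = 1) (z : Lv p d) :
    charZ Λ (-z) = charZ Λ z := by
  have := charZ_algebraMap (d := d) hΛ (r := -1) (by simp)
  rw [map_neg, map_one] at this
  rw [← neg_one_mul, charZ_mul, this, one_mul]

lemma charZ_unitO (hΛ : ∀ u ∈ Gamma0L p d, Λ u = 1) {z : Lv p d} (hz : IsO z) (h1 : nrm z = 1) :
    charZ Λ z = 1 := by
  have hz0 : z ≠ 0 := by rintro rfl; simp at h1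
  have hu : Units.mk0 z hz0 ∈ Gamma0L p d := by
    refine ⟨⟨hz.isInt, ?_⟩, hz.2⟩
    rw [Units.val_inv_eq_inv_val]
    exact (hz.inv h1).isInt
  have := charZ_coe Λ (Units.mk0 z hz0)
  rw [hΛ _ hu] at this
  simpa using this

end character

/-! ## Topology of `L_p` -/

lemma isInducing_equivProd :
    Topology.IsInducing (QuadraticAlgebra.equivProd ((-d : ℤ) : ℚ_[p]) 0) := ⟨rfl⟩

lemma continuous_re : Continuous fun z : Lv p d => z.re :=
  continuous_fst.comp isInducing_equivProd.continuous

lemma continuous_im : Continuous fun z : Lv p d => z.im :=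
  continuous_snd.comp isInducing_equivProd.continuous

lemma continuous_Lv_iff {X : Type*} [TopologicalSpace X] {f : X → Lv p d} :
    Continuous f ↔ Continuous (fun x => (f x).re) ∧ Continuous fun x => (f x).im := by
  rw [isInducing_equivProd.continuous_iff]
  exact continuous_prodMk

instance : ContinuousAdd (Lv p d) := ⟨by
  rw [continuous_Lv_iff]
  exact ⟨(continuous_re.comp continuous_fst).add (continuous_re.comp continuous_snd),
    (continuous_im.comp continuous_fst).add (continuous_im.comp continuous_snd)⟩⟩

instance : ContinuousMul (Lv p d) := ⟨by
  have h1 : Continuous fun x : Lv p d × Lv p d => x.1.re := continuous_re.comp continuous_fst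
  have h2 : Continuous fun x : Lv p d × Lv p d => x.2.re := continuous_re.comp continuous_snd
  have h3 : Continuous fun x : Lv p d × Lv p d => x.1.im := continuous_im.comp continuous_fst
  have h4 : Continuous fun x : Lv p d × Lv p d => x.2.im := continuous_im.comp continuous_snd
  rw [continuous_Lv_iff]
  simp only [QuadraticAlgebra.re_mul, QuadraticAlgebra.im_mul]
  constructor <;> fun_prop⟩

lemma isOpen_isInt : IsOpen {z : Lv p d | IsInt z} := by
  have h : IsOpen {x : ℚ_[p] | ‖x‖ ≤ 1} := by
    simpa [Metric.closedBall, dist_zero_right] using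
      IsUltrametricDist.isOpen_closedBall (0 : ℚ_[p]) one_ne_zero
  exact (h.preimage continuous_re).inter (h.preimage continuous_im)

lemma isOpen_isO : IsOpen {z : Lv p d | IsO z} := by
  have h : IsOpen {x : ℚ_[p] | ‖x‖ ≤ 1} := by
    simpa [Metric.closedBall, dist_zero_right] using
      IsUltrametricDist.isOpen_closedBall (0 : ℚ_[p]) one_ne_zero
  exact (h.preimage continuous_re).inter
    ((isOpen_lt continuous_norm continuous_const).preimage continuous_im)

lemma isOpen_isP : IsOpen {z : Lv p d | IsP z} := by
  have h : IsOpen {x : ℚ_[p] | ‖x‖ < 1} := isOpen_lt continuous_norm continuous_const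
  exact (h.preimage continuous_re).inter (h.preimage continuous_im)

/-! ## Block matrices -/

section blocks
variable {R : Type}

lemma blk_eq (A B C D : Matrix (Fin 3) (Fin 3) R) : blk A B C D =
    !![A 0 0, A 0 1, A 0 2, B 0 0, B 0 1, B 0 2;
       A 1 0, A 1 1, A 1 2, B 1 0, B 1 1, B 1 2;
       A 2 0, A 2 1, A 2 2, B 2 0, B 2 1, B 2 2;
       C 0 0, C 0 1, C 0 2, D 0 0, D 0 1, D 0 2;
       C 1 0, C 1 1, C 1 2, D 1 0, D 1 1, D 1 2;
       C 2 0, C 2 1, C 2 2, D 2 0, D 2 1, D 2 2] := by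
  ext i j
  fin_cases i <;> fin_cases j <;> rfl

lemma blk_smul {S : Type} [SMul S R] (t : S) (A B C D : Matrix (Fin 3) (Fin 3) R) :
    t • blk A B C D = blk (t • A) (t • B) (t • C) (t • D) := by
  rw [blk_eq, blk_eq]
  simp

variable [CommRing R]

lemma blk_mul (A B C D A' B' C' D' : Matrix (Fin 3) (Fin 3) R) :
    blk A B C D * blk A' B' C' D' =
      blk (A * A' + B * C') (A * B' + B * D') (C * A' + D * C') (C * B' + D * D') := by
  simp only [blk, Matrix.reindex_apply, Matrix.submatrix_mul_equiv, Matrix.fromBlocks_multiply]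

lemma blk_conjTranspose [StarRing R] (A B C D : Matrix (Fin 3) (Fin 3) R) :
    (blk A B C D)ᴴ = blk Aᴴ Cᴴ Bᴴ Dᴴ := by
  simp only [blk, Matrix.reindex_apply, Matrix.conjTranspose_submatrix,
    Matrix.fromBlocks_conjTranspose]

lemma J3_eq_blk : J3 R = blk 0 1 (-1) 0 := by
  rw [blk_eq]
  simp [J3]

/-- The lower half of a matrix with six rows. -/
def bot (X : Matrix (Fin 6) (Fin 6) R) : Matrix (Fin 3) (Fin 6) R :=
  X.submatrix ![3, 4, 5] id

/-- The columns `2, 3, 4` of a matrix with six columns. -/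
def midCols (X : Matrix (Fin 3) (Fin 6) R) : Matrix (Fin 3) (Fin 3) R :=
  X.submatrix id ![2, 3, 4]

lemma bot_blk_mul (A B D : Matrix (Fin 3) (Fin 3) R) (X : Matrix (Fin 6) (Fin 6) R) :
    bot (blk A B 0 D * X) = D * bot X := by
  rw [blk_eq]
  ext i j
  simp only [bot, Matrix.submatrix_apply, Matrix.mul_apply, Fin.sum_univ_six, Fin.sum_univ_three]
  fin_cases i <;> simp

lemma midCols_mul (M : Matrix (Fin 3) (Fin 3) R) (X : Matrix (Fin 3) (Fin 6) R) :
    midCols (M * X) = M * midCols X := rfl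

/-- The entries are integers, fixed by any involution, so one computation over `ℤ` serves every
ring. -/
lemma Q_unitary [StarRing R] : (Qmat R)ᴴ * J3 R * Qmat R = J3 R := by
  have hQ : Qmat R = (Qmat ℤ).map (Int.castRingHom R) := by
    ext i j; fin_cases i <;> fin_cases j <;> simp [Qmat]
  have hJ : J3 R = (J3 ℤ).map (Int.castRingHom R) := by
    ext i j; fin_cases i <;> fin_cases j <;> simp [J3]
  have hQs : (Qmat R)ᴴ = (Qmat ℤ)ᵀ.map (Int.castRingHom R) := by
    rw [hQ]; ext i j; simp [Matrix.conjTranspose_apply]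
  have h : (Qmat ℤ)ᵀ * J3 ℤ * Qmat ℤ = J3 ℤ := by decide +kernel
  rw [hQs, hQ, hJ, ← Matrix.map_mul, ← Matrix.map_mul, h]

lemma bot_Q_mul (k : Matrix (Fin 6) (Fin 6) R) :
    bot (Qmat R * k) = Matrix.of ![fun l => k 4 l - k 5 l, fun l => k 3 l, fun l => k 1 l + k 2 l] := by
  ext i l
  simp only [bot, Matrix.submatrix_apply, Matrix.mul_apply, Fin.sum_univ_six]
  fin_cases i <;> simp [Qmat, sub_eq_add_neg]

end blocks

/-! ## Elements of `I'_p` -/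

section iwahori
variable {k : GL (Fin 6) (Lv p d)}

lemma IsInt.sum {ι : Type*} {s : Finset ι} {f : ι → Lv p d} (h : ∀ i ∈ s, IsInt (f i)) :
    IsInt (∑ i ∈ s, f i) := by
  classical
  induction s using Finset.induction_on with
  | empty => simpa using IsInt.zero
  | insert a s ha ih =>
    rw [Finset.sum_insert ha]
    exact (h a (by simp)).add (ih fun i hi => h i (by simp [hi]))

lemma norm_le_one_of_integral {n : ℕ} {J : Matrix (Fin n) (Fin n) (Lv p d)}
    {k : Matrix (Fin n) (Fin n) (Lv p d)} (hJ : ∀ i j, IsInt (J i j)) (hk : ∀ i j, IsInt (k i j))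
    {ν : ℚ_[p]} {i j : Fin n} (hij : J i j = 1) (h : kᴴ * J * k = ν • J) : ‖ν‖ ≤ 1 := by
  have h1 := congrFun (congrFun h i) j
  rw [Matrix.smul_apply, hij] at h1
  have h2 : IsInt ((kᴴ * J * k) i j) := by
    rw [Matrix.mul_apply]
    refine IsInt.sum fun l _ => IsInt.mul ?_ (hk _ _)
    rw [Matrix.mul_apply]
    refine IsInt.sum fun m _ => IsInt.mul ?_ (hJ _ _)
    rw [Matrix.conjTranspose_apply]
    exact (hk _ _).star
  rw [h1, Algebra.smul_def, mul_one, isInt_algebraMap] at h2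
  exact h2

lemma isInt_J3 (i j : Fin 6) : IsInt (J3 (Lv p d) i j) := by
  fin_cases i <;> fin_cases j <;> simp [J3, IsInt.zero, IsInt.one, IsInt.one.neg]

/-- An entry of `J3` equal to `1` makes the multiplier an entry of an integral matrix; the same
holds for the inverse, so both are bounded by `1`. -/
lemma exists_multiplier_of_integral (hk : k ∈ Ht p d) (hint : IsIntegralGL k) :
    ∃ ν : ℚ_[p]ˣ, k.valᴴ * J3 _ * k.val = (ν : ℚ_[p]) • J3 _ ∧ ‖(ν : ℚ_[p])‖ = 1 := by
  obtain ⟨ν, hν⟩ := hk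
  have hν' : (k⁻¹).valᴴ * J3 _ * (k⁻¹).val = ((ν⁻¹ : ℚ_[p]ˣ) : ℚ_[p]) • J3 _ := by
    have h1 : k.val * k⁻¹.val = 1 := Units.mul_inv k
    have h2 : k⁻¹.valᴴ * k.valᴴ = 1 := by rw [← conjTranspose_mul, h1, conjTranspose_one]
    have h3 : J3 _ = ((ν⁻¹ : ℚ_[p]ˣ) : ℚ_[p]) • (k.valᴴ * J3 _ * k.val) := by
      rw [hν, smul_smul, Units.inv_mul, one_smul]
    calc _ = ((ν⁻¹ : ℚ_[p]ˣ) : ℚ_[p]) • (k⁻¹.valᴴ * (k.valᴴ * J3 _ * k.val) * k⁻¹.val) := by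
          conv_lhs => rw [h3]
          rw [Matrix.mul_smul, Matrix.smul_mul]
      _ = ((ν⁻¹ : ℚ_[p]ˣ) : ℚ_[p]) • ((k⁻¹.valᴴ * k.valᴴ) * J3 _ * (k.val * k⁻¹.val)) := by
          simp only [Matrix.mul_assoc]
      _ = _ := by rw [h1, h2, Matrix.one_mul, Matrix.mul_one]
  have hJ : J3 (Lv p d) 0 3 = 1 := by simp [J3]
  have a1 := norm_le_one_of_integral isInt_J3 hint.1 hJ hν
  have a2 := norm_le_one_of_integral isInt_J3 hint.2 hJ hν'
  refine ⟨ν, hν, le_antisymm a1 ?_⟩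
  rw [Units.val_inv_eq_inv_val, norm_inv] at a2
  exact (inv_le_one₀ (norm_pos_iff.2 ν.ne_zero)).1 a2

lemma conjTranspose_J3_mul_apply {R : Type} [CommRing R] [StarRing R]
    (k : Matrix (Fin 6) (Fin 6) R) (i j : Fin 6) :
    (kᴴ * J3 R * k) i j =
      star (k 0 i) * k 3 j + star (k 1 i) * k 4 j + star (k 2 i) * k 5 j
      - star (k 3 i) * k 0 j - star (k 4 i) * k 1 j - star (k 5 i) * k 2 j := by
  simp only [Matrix.mul_apply, Fin.sum_univ_six, Matrix.conjTranspose_apply]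
  simp [J3]
  ring

lemma IwahoriH.isO (hk : k ∈ IwahoriH p d) (i j : Fin 6) : IsO (k i j) :=
  ⟨(hk.2.1.1 i j).1, hk.2.2.1 i j⟩

lemma IwahoriH.isP (hk : k ∈ IwahoriH p d) (i j : Fin 6)
    (h : (i < 3 ∧ j < 3 ∧ i < j) ∨ (3 ≤ i ∧ j < 3) ∨ (3 ≤ i ∧ 3 ≤ j ∧ j < i)) : IsP (k i j) :=
  ⟨hk.2.2.2 i j h, hk.2.2.1 i j⟩

variable [hin : Fact (legendreSym p (-d) = -1)]

lemma nrm_eq_one_of_mul_add {x y z : Lv p d} {ν : ℚ_[p]} (hν : ‖ν‖ = 1) (hx : IsInt x)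
    (hy : IsInt y) (hz : IsP z) (h : star x * y + z = algebraMap _ _ ν) :
    nrm x = 1 ∧ nrm y = 1 := by
  have h1 : nrm (star x * y) = 1 := by
    rw [eq_sub_of_add_eq h, sub_eq_add_neg]
    exact nrm_add_isP (by simp [hν]) hz.neg
  have h2 := IsO.unit_of_mul hx.star hy h1
  rw [mul_comm] at h1
  exact ⟨by simpa using h2, IsO.unit_of_mul hy hx.star h1⟩

/-- In position `(i, i+3)` of the similitude relation every product except `star (k i i) * k (i+3)
(i+3)` contains an entry that vanishes modulo `p`, so these two diagonal entries multiply to the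
unit `ν` modulo `p`. -/
lemma IwahoriH.nrm_diag (hk : k ∈ IwahoriH p d) :
    nrm (k 2 2) = 1 ∧ nrm (k 3 3) = 1 ∧ nrm (k 4 4) = 1 := by
  obtain ⟨ν, hν, hν1⟩ := exists_multiplier_of_integral hk.1 hk.2.1
  have key : ∀ i j : Fin 6, star (k 0 i) * k 3 j + star (k 1 i) * k 4 j + star (k 2 i) * k 5 j
      - star (k 3 i) * k 0 j - star (k 4 i) * k 1 j - star (k 5 i) * k 2 j =
      (ν : ℚ_[p]) • J3 (Lv p d) i j := by
    intro i j
    rw [← Matrix.smul_apply, ← hν, conjTranspose_J3_mul_apply]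
  have hI : ∀ i j, IsInt (k i j) := hk.2.1.1
  have e1 : star (k 2 2) * k 5 5 + (star (k 0 2) * k 3 5 + star (k 1 2) * k 4 5
      - star (k 3 2) * k 0 5 - star (k 4 2) * k 1 5 - star (k 5 2) * k 2 5)
      = algebraMap _ _ (ν : ℚ_[p]) := by
    have := key 2 5
    simp only [J3, Algebra.smul_def] at this
    simp at this
    rw [← this]; ring
  have e2 : star (k 0 0) * k 3 3 + (star (k 1 0) * k 4 3 + star (k 2 0) * k 5 3
      - star (k 3 0) * k 0 3 - star (k 4 0) * k 1 3 - star (k 5 0) * k 2 3)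
      = algebraMap _ _ (ν : ℚ_[p]) := by
    have := key 0 3
    simp only [J3, Algebra.smul_def] at this
    simp at this
    rw [← this]; ring
  have e3 : star (k 1 1) * k 4 4 + (star (k 0 1) * k 3 4 + star (k 2 1) * k 5 4
      - star (k 3 1) * k 0 4 - star (k 4 1) * k 1 4 - star (k 5 1) * k 2 4)
      = algebraMap _ _ (ν : ℚ_[p]) := by
    have := key 1 4
    simp only [J3, Algebra.smul_def] at this
    simp at this
    rw [← this]; ring
  have hP := fun i j h => IwahoriH.isP hk i j h
  have L : ∀ i j i' j', ((i < 3 ∧ j < 3 ∧ i < j) ∨ (3 ≤ i ∧ j < 3) ∨ (3 ≤ i ∧ 3 ≤ j ∧ j < i)) →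
      IsP (star (k i j) * k i' j') := fun i j i' j' h => (hP i j h).star.mul_int (hI _ _)
  have R : ∀ i j i' j', ((i < 3 ∧ j < 3 ∧ i < j) ∨ (3 ≤ i ∧ j < 3) ∨ (3 ≤ i ∧ 3 ≤ j ∧ j < i)) →
      IsP (star (k i' j') * k i j) := fun i j i' j' h => (hI _ _).star.mul_isP (hP i j h)
  refine ⟨(nrm_eq_one_of_mul_add hν1 (hI _ _) (hI _ _) ?_ e1).1,
    (nrm_eq_one_of_mul_add hν1 (hI _ _) (hI _ _) ?_ e2).2,
    (nrm_eq_one_of_mul_add hν1 (hI _ _) (hI _ _) ?_ e3).2⟩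
  · exact (((L _ _ _ _ (by decide)).add (L _ _ _ _ (by decide))).sub (L _ _ _ _ (by decide))).sub
      (L _ _ _ _ (by decide)) |>.sub (L _ _ _ _ (by decide))
  · exact (((R _ _ _ _ (by decide)).add (R _ _ _ _ (by decide))).sub (L _ _ _ _ (by decide))).sub
      (L _ _ _ _ (by decide)) |>.sub (L _ _ _ _ (by decide))
  · exact (((L _ _ _ _ (by decide)).add (R _ _ _ _ (by decide))).sub (L _ _ _ _ (by decide))).sub
      (L _ _ _ _ (by decide)) |>.sub (L _ _ _ _ (by decide))

end iwahori

/-! ## Invariants of the decompositions `h = n(c) m(A, t) Q k` -/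

section decomp

lemma conjTranspose_smul_padic {m n : Type*} (t : ℚ_[p]) (M : Matrix m n (Lv p d)) :
    (t • M)ᴴ = t • Mᴴ := by
  ext i j <;> simp [Matrix.conjTranspose_apply]

variable {h : Matrix (Fin 6) (Fin 6) (Lv p d)}

lemma nSiegel_mul_mSiegel (c : Matrix (Fin 3) (Fin 3) (Lv p d)) (A : GL (Fin 3) (Lv p d))
    (t : ℚ_[p]ˣ) : nSiegel c * mSiegel A t =
      blk A.val (c * ((t : ℚ_[p]) • (A⁻¹).valᴴ)) 0 ((t : ℚ_[p]) • (A⁻¹).valᴴ) := by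
  rw [nSiegel, mSiegel, blk_mul]
  simp

lemma SiegelDecomp.bot_eq (D : SiegelDecomp h) :
    bot h = ((D.t : ℚ_[p]) • (D.A⁻¹).valᴴ) * bot (Qmat _ * D.k.val) := by
  conv_lhs => rw [D.eq, nSiegel_mul_mSiegel, Matrix.mul_assoc]
  rw [bot_blk_mul]

lemma nSiegel_unitary {c : Matrix (Fin 3) (Fin 3) (Lv p d)} (hc : cᴴ = c) :
    (nSiegel c)ᴴ * J3 _ * nSiegel c = J3 _ := by
  rw [nSiegel, J3_eq_blk, blk_conjTranspose, blk_mul, blk_mul]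
  simp [hc]

lemma mSiegel_similitude (A : GL (Fin 3) (Lv p d)) (t : ℚ_[p]ˣ) :
    (mSiegel A t)ᴴ * J3 _ * mSiegel A t = (t : ℚ_[p]) • J3 _ := by
  have h1 : (A⁻¹).val * A.val = 1 := Units.inv_mul A
  have h2 : A.valᴴ * (A⁻¹).valᴴ = 1 := by rw [← conjTranspose_mul, h1, conjTranspose_one]
  rw [mSiegel, J3_eq_blk, blk_conjTranspose, blk_mul, blk_mul, blk_smul,
    conjTranspose_smul_padic]
  simp only [Matrix.mul_zero, Matrix.zero_mul, add_zero, zero_add, mul_one, mul_neg, neg_mul,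
    smul_zero, conjTranspose_zero, conjTranspose_conjTranspose, Matrix.mul_smul, Matrix.smul_mul,
    h1, h2, smul_neg, neg_zero]

lemma SiegelDecomp.similitude (D : SiegelDecomp h) {ν : ℚ_[p]}
    (hν : D.k.valᴴ * J3 _ * D.k.val = ν • J3 _) :
    hᴴ * J3 _ * h = ((D.t : ℚ_[p]) * ν) • J3 _ := by
  conv_lhs => rw [D.eq]
  simp only [conjTranspose_mul]
  calc _ = D.k.valᴴ * ((Qmat _)ᴴ * ((mSiegel D.A D.t)ᴴ * ((nSiegel D.c)ᴴ * J3 _ * nSiegel D.c)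
        * mSiegel D.A D.t) * Qmat _) * D.k.val := by simp only [Matrix.mul_assoc]
    _ = _ := by
      rw [nSiegel_unitary D.c_hermitian, mSiegel_similitude, Matrix.mul_smul, Matrix.smul_mul,
        Q_unitary, Matrix.mul_smul, Matrix.smul_mul, hν, smul_smul]

lemma SiegelDecomp.norm_t (D : SiegelDecomp h) (hh : hᴴ * J3 _ * h = J3 _) :
    ‖(D.t : ℚ_[p])‖ = 1 := by
  obtain ⟨ν, hν, hν1⟩ := exists_multiplier_of_integral D.k_mem.1 D.k_mem.2.1
  have key := D.similitude hν
  rw [hh] at key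
  have := congrFun (congrFun key 0) 3
  rw [Matrix.smul_apply, show J3 (Lv p d) 0 3 = 1 by simp [J3], Algebra.smul_def, mul_one,
    ← map_one (algebraMap ℚ_[p] (Lv p d)), QuadraticAlgebra.algebraMap_inj] at this
  have h2 := congrArg norm this
  rw [norm_one, norm_mul, hν1, mul_one] at h2
  exact h2.symm

/-- The middle columns of the lower half of `Q k`. -/
def midQ (k : GL (Fin 6) (Lv p d)) : Matrix (Fin 3) (Fin 3) (Lv p d) :=
  midCols (bot (Qmat _ * k.val))

lemma IsO.det {M : Matrix (Fin 3) (Fin 3) (Lv p d)} (hM : ∀ i j, IsO (M i j)) : IsO M.det := by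
  rw [Matrix.det_fin_three]
  have := hM
  exact ((((((((hM _ _).mul (hM _ _)).mul (hM _ _)).sub (((hM _ _).mul (hM _ _)).mul (hM _ _))).sub
    (((hM _ _).mul (hM _ _)).mul (hM _ _))).add (((hM _ _).mul (hM _ _)).mul (hM _ _))).add
    (((hM _ _).mul (hM _ _)).mul (hM _ _))).sub (((hM _ _).mul (hM _ _)).mul (hM _ _)))

lemma SiegelDecomp.midCols_bot (D : SiegelDecomp h) :
    midCols (bot h) = ((D.t : ℚ_[p]) • (D.A⁻¹).valᴴ) * midQ D.k := by
  rw [D.bot_eq, midCols_mul, midQ]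

variable {Λ : (Lv p d)ˣ →* Circle}

lemma Upsilon_eq_zero (s : ℂ) (H : IsEmpty (SiegelDecomp h)) : Upsilon Λ s h = 0 := by
  rw [Upsilon, dif_neg (not_nonempty_iff.2 H)]

variable [hin : Fact (legendreSym p (-d) = -1)]

/-- For `k = 1` this is the antidiagonal permutation matrix. For `k` in `I'` the triangular shape
survives modulo `p`: zeros above the antidiagonal, units on it. That determines the determinant up
to a unit. -/
lemma midQ_facts {k : GL (Fin 6) (Lv p d)} (hk : k ∈ IwahoriH p d) :
    (∀ i j, IsO (midQ k i j)) ∧ IsP (midQ k 0 0) ∧ IsP (midQ k 0 1) ∧ IsP (midQ k 1 0) ∧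
      nrm (midQ k 0 2) = 1 ∧ nrm (midQ k 1 1) = 1 ∧ nrm (midQ k 2 0) = 1 := by
  obtain ⟨h2, h3, h4⟩ := IwahoriH.nrm_diag hk
  have hO : ∀ i j, IsO (k i j) := IwahoriH.isO hk
  have hP : ∀ i j, ((i < 3 ∧ j < 3 ∧ i < j) ∨ (3 ≤ i ∧ j < 3) ∨ (3 ≤ i ∧ 3 ≤ j ∧ j < i)) →
    IsP (k i j) := IwahoriH.isP hk
  have e : ∀ i j, midQ k i j = ![k 4 (![2, 3, 4] j) - k 5 (![2, 3, 4] j), k 3 (![2, 3, 4] j),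
      k 1 (![2, 3, 4] j) + k 2 (![2, 3, 4] j)] i := by
    intro i j
    rw [midQ, bot_Q_mul]
    fin_cases i <;> rfl
  refine ⟨fun i j => ?_, ?_, ?_, ?_, ?_, ?_, ?_⟩ <;> rw [e]
  · match i with
    | 0 => exact (hO _ _).sub (hO _ _)
    | 1 => exact hO _ _
    | 2 => exact (hO _ _).add (hO _ _)
  · exact (hP 4 2 (by decide)).sub (hP 5 2 (by decide))
  · exact (hP 4 3 (by decide)).sub (hP 5 3 (by decide))
  · exact hP 3 2 (by decide)
  · rw [Matrix.cons_val_zero, sub_eq_add_neg]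
    exact nrm_add_isP h4 (hP 5 4 (by decide)).neg
  · exact h3
  · have := nrm_add_isP h2 (hP 1 2 (by decide))
    rw [add_comm] at this
    exact this

lemma nrm_det_midQ {k : GL (Fin 6) (Lv p d)} (hk : k ∈ IwahoriH p d) :
    nrm (midQ k).det = 1 := by
  obtain ⟨hO, h00, h01, h10, h02, h11, h20⟩ := midQ_facts hk
  have e : (midQ k).det = -(midQ k 0 2 * midQ k 1 1 * midQ k 2 0) +
      (midQ k 0 0 * (midQ k 1 1 * midQ k 2 2 - midQ k 1 2 * midQ k 2 1) +
        midQ k 0 1 * (midQ k 1 2 * midQ k 2 0 - midQ k 1 0 * midQ k 2 2) +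
        midQ k 1 0 * (midQ k 0 2 * midQ k 2 1)) := by
    rw [Matrix.det_fin_three]; ring
  rw [e]
  refine nrm_add_isP (by simp [h02, h11, h20]) ?_
  have hI : ∀ i j, IsInt (midQ k i j) := fun i j => (hO i j).isInt
  exact ((h00.mul_int (((hI _ _).mul (hI _ _)).sub ((hI _ _).mul (hI _ _)))).add
    (h01.mul_int (((hI _ _).mul (hI _ _)).sub ((hI _ _).mul (hI _ _))))).add
    (h10.mul_int ((hI _ _).mul (hI _ _)))

/-- The left side depends on `h` alone, so the data of the chosen decomposition that enter the
section are recovered up to the factor `(midQ D.k).det`, a unit of the order. -/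
lemma SiegelDecomp.det_eq (D : SiegelDecomp h) :
    (midCols (bot h)).det =
      algebraMap _ _ (D.t : ℚ_[p]) ^ 3 * (star D.A.val.det)⁻¹ * (midQ D.k).det := by
  rw [D.midCols_bot, Matrix.det_mul, ← algebraMap_smul (Lv p d), Matrix.det_smul, Fintype.card_fin,
    Matrix.det_conjTranspose]
  congr 2
  refine eq_inv_of_mul_eq_one_left ?_
  rw [← star_mul', ← Matrix.det_mul, Units.inv_mul, Matrix.det_one, star_one]

lemma det_GL_ne_zero (A : GL (Fin 3) (Lv p d)) : A.val.det ≠ 0 :=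
  ((Matrix.isUnit_iff_isUnit_det _).1 A.isUnit).ne_zero

lemma SiegelDecomp.det_ne_zero (D : SiegelDecomp h) : (midCols (bot h)).det ≠ 0 := by
  rw [D.det_eq]
  have h1 : (midQ D.k).det ≠ 0 := fun h0 => by
    have := nrm_det_midQ D.k_mem
    simp [h0] at this
  have h2 := det_GL_ne_zero D.A
  have h3 : algebraMap ℚ_[p] (Lv p d) D.t ≠ 0 := by
    simp
  have h4 : star D.A.val.det ≠ 0 := by simpa using h2
  exact mul_ne_zero (mul_ne_zero (pow_ne_zero _ h3) (inv_ne_zero h4)) h1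

/-- For unitary `h` the factor `t` is a unit and drops out. No second conjugation is needed in the
character: `Λ((star det A)⁻¹) = Λ(det A)`, since `Λ` inverts under conjugation. -/
lemma Upsilon_eq (hΛ : ∀ x : ℚ_[p]ˣ, Λ (baseUnits p d x) = 1)
    (hΛ0 : ∀ u ∈ Gamma0L p d, Λ u = 1) (s : ℂ) (hh : hᴴ * J3 _ * h = J3 _)
    (H : Nonempty (SiegelDecomp h)) :
    Upsilon Λ s h = ((nrm (midCols (bot h)).det⁻¹ : ℝ) : ℂ) ^ (3 * (s + 1 / 2)) *
      charZ Λ (midCols (bot h)).det := by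
  rw [Upsilon, dif_pos H]
  generalize H.some = D
  have ht := D.norm_t hh
  have hE := nrm_det_midQ D.k_mem
  have e1 : nrm (midCols (bot h)).det⁻¹ = ‖QuadraticAlgebra.norm D.A.val.det‖ := by
    rw [D.det_eq]
    rw [nrm_inv, nrm_mul, nrm_mul, nrm_inv, nrm_pow, nrm_algebraMap, nrm_star, ht, hE]
    simp [nrm]
  have e2 : charZ Λ (midCols (bot h)).det = Λ (Matrix.GeneralLinearGroup.det D.A) := by
    rw [D.det_eq, charZ_mul, charZ_mul, ← map_pow, charZ_algebraMap hΛ (pow_ne_zero _ D.t.ne_zero),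
      charZ_inv, charZ_star hΛ, inv_inv, charZ_unitO hΛ0 (IsO.det (midQ_facts D.k_mem).1) hE,
      one_mul, mul_one, ← charZ_coe]
    rfl
  simp only [ht, e1, e2]
  simp

/-- The row lattice of the lower half of an element of `P Q I'` behaves, with respect to the columns
`2, 3, 4`, like that of `Q`. -/
lemma SiegelDecomp.row_mem (D : SiegelDecomp h) (x : Fin 3 → Lv p d)
    (h2 : IsO ((x ᵥ* bot h) 2)) (h3 : IsO ((x ᵥ* bot h) 3)) (h4 : IsO ((x ᵥ* bot h) 4)) :
    (∀ l, IsO ((x ᵥ* bot h) l)) ∧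
      (IsP ((x ᵥ* bot h) 2) → IsP ((x ᵥ* bot h) 0) ∧ IsP ((x ᵥ* bot h) 1)) := by
  obtain ⟨hO, h00, h01, h10, h02, h11, h20⟩ := midQ_facts D.k_mem
  set z : Fin 3 → Lv p d := x ᵥ* ((D.t : ℚ_[p]) • (D.A⁻¹).valᴴ) with hz
  have e : x ᵥ* bot h = z ᵥ* bot (Qmat _ * D.k.val) := by
    rw [hz, Matrix.vecMul_vecMul, ← D.bot_eq]
  have eE : z ᵥ* midQ D.k = fun j => (x ᵥ* bot h) (![2, 3, 4] j) := by
    rw [e]; rfl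
  have hE := nrm_det_midQ D.k_mem
  have hdet0 : (midQ D.k).det ≠ 0 := fun h0 => by simp [h0] at hE
  have hw : ∀ j, IsO ((z ᵥ* midQ D.k) j) := by
    rw [eE]
    intro j
    fin_cases j
    exacts [h2, h3, h4]
  have hadj : ∀ i j, IsO ((midQ D.k).adjugate i j) := by
    intro i j
    rw [Matrix.adjugate_apply]
    refine IsO.det fun a b => ?_
    rw [Matrix.updateRow_apply]
    split_ifs
    · rw [Pi.single_apply]
      split_ifs
      · exact IsO.one
      · exact IsO.zero
    · exact hO _ _
  have hzO : ∀ i, IsO (z i) := by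
    intro i
    -- Cramer's rule over the order: `midQ` has entries in `O` and unit determinant, so the
    -- coefficients `z` of the row in terms of `Q k` lie in `O`.
    have e1 : (z ᵥ* midQ D.k) ᵥ* (midQ D.k).adjugate = (midQ D.k).det • z := by
      rw [Matrix.vecMul_vecMul, Matrix.mul_adjugate, Matrix.vecMul_smul, Matrix.vecMul_one]
    have e2 : z i = (midQ D.k).det⁻¹ * ((z ᵥ* midQ D.k) ᵥ* (midQ D.k).adjugate) i := by
      rw [e1, Pi.smul_apply, smul_eq_mul, inv_mul_cancel_left₀ hdet0]
    rw [e2]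
    refine ((IsO.det hO).inv hE).mul ?_
    rw [Matrix.vecMul, dotProduct, Fin.sum_univ_three]
    exact (((hw _).mul (hadj _ _)).add ((hw _).mul (hadj _ _))).add ((hw _).mul (hadj _ _))
  have hk : ∀ i j, IsO (D.k i j) := IwahoriH.isO D.k_mem
  have hP : ∀ i j, ((i < 3 ∧ j < 3 ∧ i < j) ∨ (3 ≤ i ∧ j < 3) ∨ (3 ≤ i ∧ 3 ≤ j ∧ j < i)) →
    IsP (D.k i j) := IwahoriH.isP D.k_mem
  have eP : ∀ l, (x ᵥ* bot h) l = z 0 * (D.k 4 l - D.k 5 l) + z 1 * D.k 3 l +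
      z 2 * (D.k 1 l + D.k 2 l) := by
    intro l
    rw [e, bot_Q_mul, Matrix.vecMul, dotProduct, Fin.sum_univ_three]
    rfl
  refine ⟨fun l => ?_, fun hp => ?_⟩
  · rw [eP]
    exact (((hzO _).mul ((hk _ _).sub (hk _ _))).add ((hzO _).mul (hk _ _))).add
      ((hzO _).mul ((hk _ _).add (hk _ _)))
  -- Modulo `p` the first column of `midQ` is supported in its last row, so column 2 forces `z 2`
  -- into the ideal. The other two coefficients multiply rows of `k` from its lower half, which
  -- vanish modulo `p` in columns 0 and 1.
  · have hz2 : IsP (z 2) := by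
      have e3 : z 2 * midQ D.k 2 0 = (x ᵥ* bot h) 2 - z 0 * midQ D.k 0 0 - z 1 * midQ D.k 1 0 := by
        have := congrFun eE 0
        rw [Matrix.vecMul, dotProduct, Fin.sum_univ_three] at this
        simp only [Matrix.cons_val_zero] at this
        rw [← this]; ring
      have : IsP (z 2 * midQ D.k 2 0) := by
        rw [e3]
        exact (hp.sub ((hzO _).isInt.mul_isP h00)).sub ((hzO _).isInt.mul_isP h10)
      rw [isP_iff_nrm, nrm_mul, h20, mul_one] at this
      exact isP_iff_nrm.2 this
    have hI : ∀ i j, IsInt (D.k i j) := fun i j => (hk i j).isInt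
    constructor
    · rw [eP]
      exact (((hzO _).isInt.mul_isP ((hP 4 0 (by decide)).sub (hP 5 0 (by decide)))).add
        ((hzO _).isInt.mul_isP (hP 3 0 (by decide)))).add (hz2.mul_int ((hI _ _).add (hI _ _)))
    · rw [eP]
      exact (((hzO _).isInt.mul_isP ((hP 4 1 (by decide)).sub (hP 5 1 (by decide)))).add
        ((hzO _).isInt.mul_isP (hP 3 1 (by decide)))).add (hz2.mul_int ((hI _ _).add (hI _ _)))

end decomp

/-! ## Elements of `U(1,1)` -/

section F1

lemma eq_algebraMap_of_star {z : Lv p d} (h : star z = z) : z = algebraMap ℚ_[p] _ z.re := by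
  have h1 := congrArg QuadraticAlgebra.im h
  rw [QuadraticAlgebra.im_star] at h1
  have h2 : z.im = 0 := by linear_combination (-1 / 2 : ℚ_[p]) * h1
  ext <;> simp [h2]

@[simp] lemma star_algebraMap_padic (r : ℚ_[p]) :
    star (algebraMap ℚ_[p] (Lv p d) r) = algebraMap ℚ_[p] (Lv p d) r := by
  ext <;> simp

lemma conjTranspose_J1_mul_apply (h : Matrix (Fin 2) (Fin 2) (Lv p d)) (i j : Fin 2) :
    (hᴴ * J1 (Lv p d) * h) i j = star (h 0 i) * h 1 j - star (h 1 i) * h 0 j := by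
  simp only [Matrix.mul_apply, Fin.sum_univ_two, Matrix.conjTranspose_apply]
  simp [J1]
  ring

lemma U11_iff {h : Matrix (Fin 2) (Fin 2) (Lv p d)} :
    hᴴ * J1 (Lv p d) * h = J1 (Lv p d) ↔ star (h 0 0) * h 1 0 = star (h 1 0) * h 0 0 ∧
      star (h 0 1) * h 1 1 = star (h 1 1) * h 0 1 ∧
      star (h 0 0) * h 1 1 - star (h 1 0) * h 0 1 = 1 := by
  constructor
  · intro hh
    have key : ∀ i j, star (h 0 i) * h 1 j - star (h 1 i) * h 0 j = J1 (Lv p d) i j := fun i j => by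
      rw [← conjTranspose_J1_mul_apply, hh]
    exact ⟨sub_eq_zero.1 (key 0 0), sub_eq_zero.1 (key 1 1), key 0 1⟩
  · rintro ⟨h1, h2, h3⟩
    ext i j : 1
    rw [conjTranspose_J1_mul_apply]
    fin_cases i <;> fin_cases j
    · exact sub_eq_zero.2 h1
    · exact h3
    · have := congrArg star h3
      simp only [star_sub, star_mul', star_star, star_one] at this
      change star (h 0 1) * h 1 0 - star (h 1 1) * h 0 0 = -1
      linear_combination -this
    · exact sub_eq_zero.2 h2

variable [hin : Fact (legendreSym p (-d) = -1)]

/-- Elements of the open cell of `U(1,1)`. -/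
lemma exists_cell {h : Matrix (Fin 2) (Fin 2) (Lv p d)} (hh : hᴴ * J1 _ * h = J1 _)
    (ha : h 0 0 ≠ 0) : ∃ (y : Lv p d) (β γ : ℚ_[p]), y ≠ 0 ∧
      h = !![y⁻¹, y⁻¹ * algebraMap _ _ β; y⁻¹ * algebraMap _ _ γ,
        star y + y⁻¹ * algebraMap _ _ γ * algebraMap _ _ β] := by
  obtain ⟨h1, h2, h3⟩ := U11_iff.1 hh
  have ha' : star (h 0 0) ≠ 0 := by simpa using ha
  -- Unitarity makes `γ = h 1 0 / h 0 0` and `β = h 0 1 / h 0 0` invariant under conjugation, hence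
  -- elements of `ℚ_p`; with `y = (h 0 0)⁻¹` this is the factorization lower unipotent, diagonal,
  -- upper unipotent.
  have hγ : star (h 1 0 / h 0 0) = h 1 0 / h 0 0 := by
    rw [star_div₀, div_eq_div_iff ha' ha]
    linear_combination -h1
  have he : h 1 1 = star (h 0 0)⁻¹ + (h 1 0 / h 0 0) * h 0 1 := by
    rw [← hγ, star_div₀, star_inv₀]
    field_simp
    linear_combination h3
  have hβ : star (h 0 1 / h 0 0) = h 0 1 / h 0 0 := by
    rw [he] at h2
    have e : star (star (h 0 0)⁻¹ + (h 1 0 / h 0 0) * h 0 1) =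
        (h 0 0)⁻¹ + (h 1 0 / h 0 0) * star (h 0 1) := by
      rw [star_add, star_star, star_mul', hγ]
    rw [e, star_inv₀] at h2
    rw [star_div₀]
    field_simp at h2 ⊢
    linear_combination h2
  refine ⟨(h 0 0)⁻¹, (h 0 1 / h 0 0).re, (h 1 0 / h 0 0).re, inv_ne_zero ha, ?_⟩
  rw [← eq_algebraMap_of_star hγ, ← eq_algebraMap_of_star hβ, inv_inv]
  ext i j : 1
  fin_cases i <;> fin_cases j
  · rfl
  · change h 0 1 = h 0 0 * (h 0 1 / h 0 0)
    field_simp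
  · change h 1 0 = h 0 0 * (h 1 0 / h 0 0)
    field_simp
  · change h 1 1 = star (h 0 0)⁻¹ + h 0 0 * (h 1 0 / h 0 0) * (h 0 1 / h 0 0)
    rw [he]; field_simp

/-- The support conditions of the zeta integrand, with the condition `C` on the inverse of the
upper left entry. -/
def Supp (C : Lv p d → Prop) (h : Matrix (Fin 2) (Fin 2) (Lv p d)) : Prop :=
  h 0 0 ≠ 0 ∧ C (h 0 0)⁻¹ ∧ IsP (h 1 0 / h 0 0) ∧ IsInt (h 0 1 / h 0 0)

end F1

/-! ## The support of the section on the embedded group -/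

section support
variable {R : Type} [CommRing R]

lemma bot_Q_iota (g : Matrix (Fin 4) (Fin 4) R) (h : Matrix (Fin 2) (Fin 2) R) :
    bot (Qmat R * iota g h) =
      !![g 3 0, g 3 1, h 1 0, g 3 2, g 3 3, -(h 1 1);
         g 2 0, g 2 1, 0, g 2 2, g 2 3, 0;
         g 1 0, g 1 1, h 0 0, g 1 2, g 1 3, -(h 0 1)] := by
  rw [bot_Q_mul]
  ext i j : 1
  fin_cases i <;> fin_cases j <;> simp [iota]

lemma det_midCols_bot_Q_iota (g : Matrix (Fin 4) (Fin 4) R) (h : Matrix (Fin 2) (Fin 2) R) :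
    (midCols (bot (Qmat R * iota g h))).det =
      h 1 0 * (g 2 2 * g 1 3 - g 2 3 * g 1 2) + h 0 0 * (g 3 2 * g 2 3 - g 3 3 * g 2 2) := by
  rw [bot_Q_iota, Matrix.det_fin_three]
  simp [midCols]
  ring

lemma vecMul_bot_Q_iota (g : Matrix (Fin 4) (Fin 4) R) (h : Matrix (Fin 2) (Fin 2) R)
    (x y z : R) :
    ![x, y, z] ᵥ* bot (Qmat R * iota g h) =
      ![x * g 3 0 + y * g 2 0 + z * g 1 0, x * g 3 1 + y * g 2 1 + z * g 1 1,
        x * h 1 0 + z * h 0 0, x * g 3 2 + y * g 2 2 + z * g 1 2,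
        x * g 3 3 + y * g 2 3 + z * g 1 3, -(x * h 1 1) - z * h 0 1] := by
  rw [bot_Q_iota]
  ext j
  fin_cases j <;> simp [Matrix.vecMul, dotProduct, Fin.sum_univ_three] <;> ring

variable [hin : Fact (legendreSym p (-d) = -1)]
  {h : Matrix (Fin 2) (Fin 2) (Lv p d)} {g : Matrix (Fin 4) (Fin 4) (Lv p d)}

/-- The middle row of the minor on columns 2, 3, 4 is `(0, g 2 2, g 2 3)`, and this minor cannot
vanish on the support. -/
lemma isEmpty_decomp_of_row_two (h1 : g 2 2 = 0) (h2 : g 2 3 = 0) :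
    IsEmpty (SiegelDecomp (Qmat _ * iota g h)) := by
  refine ⟨fun D => D.det_ne_zero ?_⟩
  rw [det_midCols_bot_Q_iota, h1, h2]
  ring

end support

/-! ### Explicit factorizations over a commutative ring with involution -/

section generic
variable {R : Type} [CommRing R] [StarRing R]

lemma J3_mul_J3 : J3 R * J3 R = -1 := by
  rw [J3_eq_blk, blk_mul, blk_eq]
  ext i j : 1
  fin_cases i <;> fin_cases j <;> simp

lemma mat_ext_three {M N : Matrix (Fin 3) (Fin 3) R} (h00 : M 0 0 = N 0 0) (h01 : M 0 1 = N 0 1)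
    (h02 : M 0 2 = N 0 2) (h10 : M 1 0 = N 1 0) (h11 : M 1 1 = N 1 1) (h12 : M 1 2 = N 1 2)
    (h20 : M 2 0 = N 2 0) (h21 : M 2 1 = N 2 1) (h22 : M 2 2 = N 2 2) : M = N := by
  ext i j
  fin_cases i <;> fin_cases j <;> assumption

/-- A unitary matrix as an element of `GL₆`. -/
def unitaryGL (k : Matrix (Fin 6) (Fin 6) R) (hk : kᴴ * J3 R * k = J3 R) : GL (Fin 6) R :=
  have h : -(J3 R * kᴴ * J3 R) * k = 1 := by
    rw [neg_mul, Matrix.mul_assoc, Matrix.mul_assoc, ← Matrix.mul_assoc kᴴ, hk, J3_mul_J3, neg_neg]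
  ⟨k, -(J3 R * kᴴ * J3 R), mul_eq_one_comm.1 h, h⟩

/-- The Levi element `(A, 0; 0, (A̅⁻¹)ᵗ)` with `A = (1, 0; x, 1)`. -/
def lowerLevi (x : R) : Matrix (Fin 4) (Fin 4) R :=
  !![1, 0, 0, 0; x, 1, 0, 0; 0, 0, 1, -star x; 0, 0, 0, 1]

lemma lowerLevi_zero : lowerLevi (0 : R) = 1 := by
  ext i j : 1
  fin_cases i <;> fin_cases j <;> simp [lowerLevi]

/-- The factor in `I'` of the decomposition of `Q ι(lowerLevi x, h)`. -/
def kLower (x y B C : R) : Matrix (Fin 6) (Fin 6) R :=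
  !![1, 0, 0, 0, 0, 0;
     0, 1, 0, 0, 0, 0;
     x * y, y - 1, 1, 0, 0, -B;
     -(C * x * star x), -(C * star x), 0, 1, 0, -star (x * y);
     -(C * x), -C, 0, 0, 1, 1 - star y;
     0, 0, 0, 0, 0, 1]

/-- The factor in `I'` of the decomposition of `Q ι(s₁, h)`. -/
def kSwap (y B C : R) : Matrix (Fin 6) (Fin 6) R :=
  !![1, 0, 0, 0, 0, 0;
     0, 1, 0, 0, 0, 0;
     y, -1, 1, 0, 0, -B;
     -C, 0, 0, 1, 0, -star y;
     0, 0, 0, 0, 1, 1;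
     0, 0, 0, 0, 0, 1]

variable {x y a B C : R}

/-- Three block relations suffice, the fourth being the negative conjugate transpose of the third.
-/
lemma blk_unitary {A B C D : Matrix (Fin 3) (Fin 3) R} (h1 : Aᴴ * C = Cᴴ * A)
    (h2 : Bᴴ * D = Dᴴ * B) (h3 : Aᴴ * D - Cᴴ * B = !![1, 0, 0; 0, 1, 0; 0, 0, 1]) :
    (blk A B C D)ᴴ * J3 R * blk A B C D = J3 R := by
  rw [← Matrix.one_fin_three] at h3
  have h4 : Bᴴ * C - Dᴴ * A = -1 := by
    have := congrArg conjTranspose h3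
    rw [conjTranspose_sub, conjTranspose_mul, conjTranspose_mul, conjTranspose_conjTranspose,
      conjTranspose_conjTranspose, conjTranspose_one] at this
    rw [← this, neg_sub]
  rw [J3_eq_blk, blk_conjTranspose, blk_mul, blk_mul]
  simp only [mul_zero, mul_one, mul_neg, zero_add, add_zero, neg_mul]
  congr 1
  · rw [h1]; abel
  · rw [← h3]; abel
  · rw [← h4]; abel
  · rw [h2]; abel

lemma kLower_eq_blk : kLower x y B C =
    blk !![1, 0, 0; 0, 1, 0; x * y, y - 1, 1] !![0, 0, 0; 0, 0, 0; 0, 0, -B]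
      !![-(C * x * star x), -(C * star x), 0; -(C * x), -C, 0; 0, 0, 0]
      !![1, 0, -star (x * y); 0, 1, 1 - star y; 0, 0, 1] := by
  rw [blk_eq]; rfl

lemma kSwap_eq_blk : kSwap y B C =
    blk !![1, 0, 0; 0, 1, 0; y, -1, 1] !![0, 0, 0; 0, 0, 0; 0, 0, -B]
      !![-C, 0, 0; 0, 0, 0; 0, 0, 0] !![1, 0, -star y; 0, 1, 1; 0, 0, 1] := by
  rw [blk_eq]; rfl

lemma kLower_unitary (hB : star B = B) (hC : star C = C) :
    (kLower x y B C)ᴴ * J3 R * kLower x y B C = J3 R := by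
  rw [kLower_eq_blk]
  refine blk_unitary ?_ ?_ ?_ <;> refine mat_ext_three ?_ ?_ ?_ ?_ ?_ ?_ ?_ ?_ ?_ <;>
    simp only [Matrix.mul_apply, Matrix.sub_apply, Fin.sum_univ_three, Matrix.conjTranspose_apply,
      Matrix.of_apply, Matrix.cons_val, hB, hC, mul_zero, zero_mul, mul_one, one_mul, add_zero,
      zero_add, neg_zero, sub_zero, star_zero, star_one, star_neg, star_mul', star_sub,
      star_star] <;> ring

lemma kSwap_unitary (hB : star B = B) (hC : star C = C) :
    (kSwap y B C)ᴴ * J3 R * kSwap y B C = J3 R := by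
  rw [kSwap_eq_blk]
  refine blk_unitary ?_ ?_ ?_ <;> refine mat_ext_three ?_ ?_ ?_ ?_ ?_ ?_ ?_ ?_ ?_ <;>
    simp only [Matrix.mul_apply, Matrix.sub_apply, Fin.sum_univ_three, Matrix.conjTranspose_apply,
      Matrix.of_apply, Matrix.cons_val, hB, hC, mul_zero, zero_mul, mul_one, one_mul, add_zero,
      zero_add, neg_zero, sub_zero, star_zero, star_one, star_neg, star_mul', star_sub,
      star_star] <;> ring

/-- The Levi factor of the decomposition of `Q ι(lowerLevi x, h)`. -/
def aLower (x y a C : R) (h : y * a = 1) : GL (Fin 3) R :=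
  have h2 : star y * star a = 1 := by rw [← star_mul', h, star_one]
  have e : !![1, x, 0; 0, 1, 0; -C, -(C * x), star y] *
      !![1, -x, 0; 0, 1, 0; star a * C, 0, star a] = 1 := by
    rw [Matrix.one_fin_three]
    refine mat_ext_three ?_ ?_ ?_ ?_ ?_ ?_ ?_ ?_ ?_ <;>
      simp only [Matrix.mul_apply, Matrix.sub_apply, Fin.sum_univ_three,
        Matrix.conjTranspose_apply, Matrix.of_apply, Matrix.cons_val, h2, mul_zero, zero_mul,
        mul_one, one_mul, add_zero, zero_add, neg_zero, sub_zero, star_zero, star_one, star_neg,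
        star_mul', star_sub, star_star] <;> first | ring1 | linear_combination C * h2
  ⟨!![1, x, 0; 0, 1, 0; -C, -(C * x), star y],
    !![1, -x, 0; 0, 1, 0; star a * C, 0, star a], e, mul_eq_one_comm.1 e⟩

/-- The Levi factor of the decomposition of `Q ι(s₁, h)`. -/
def aSwap (y a C : R) (h : y * a = 1) : GL (Fin 3) R :=
  have h2 : star y * star a = 1 := by rw [← star_mul', h, star_one]
  have e : !![0, 1, 0; 1, 0, 0; 0, -C, star y] *
      !![0, 1, 0; 1, 0, 0; star a * C, 0, star a] = 1 := by
    rw [Matrix.one_fin_three]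
    refine mat_ext_three ?_ ?_ ?_ ?_ ?_ ?_ ?_ ?_ ?_ <;>
      simp only [Matrix.mul_apply, Matrix.sub_apply, Fin.sum_univ_three,
        Matrix.conjTranspose_apply, Matrix.of_apply, Matrix.cons_val, h2, mul_zero, zero_mul,
        mul_one, one_mul, add_zero, zero_add, neg_zero, sub_zero, star_zero, star_one, star_neg,
        star_mul', star_sub, star_star] <;> first | ring1 | linear_combination C * h2
  ⟨!![0, 1, 0; 1, 0, 0; 0, -C, star y],
    !![0, 1, 0; 1, 0, 0; star a * C, 0, star a], e, mul_eq_one_comm.1 e⟩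

/-- The upper half of a matrix with six rows. -/
def top (X : Matrix (Fin 6) (Fin 6) R) : Matrix (Fin 3) (Fin 6) R :=
  X.submatrix ![0, 1, 2] id

lemma ext_top_bot {X Y : Matrix (Fin 6) (Fin 6) R} (h1 : top X = top Y) (h2 : bot X = bot Y) :
    X = Y := by
  ext i j
  fin_cases i
  · exact congrFun (congrFun h1 0) j
  · exact congrFun (congrFun h1 1) j
  · exact congrFun (congrFun h1 2) j
  · exact congrFun (congrFun h2 0) j
  · exact congrFun (congrFun h2 1) j
  · exact congrFun (congrFun h2 2) j

lemma top_blk_mul (A B D : Matrix (Fin 3) (Fin 3) R) (X : Matrix (Fin 6) (Fin 6) R) :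
    top (blk A B 0 D * X) = A * top X + B * bot X := by
  rw [blk_eq]
  ext i j
  simp only [top, bot, Matrix.add_apply, Matrix.submatrix_apply, Matrix.mul_apply,
    Fin.sum_univ_six, Fin.sum_univ_three]
  fin_cases i <;> simp <;> ring

lemma top_Q_mul (k : Matrix (Fin 6) (Fin 6) R) :
    top (Qmat R * k) = Matrix.of ![k 1, k 0, -k 5] := by
  ext i l
  simp only [top, Matrix.submatrix_apply, Matrix.mul_apply, Fin.sum_univ_six]
  fin_cases i <;> simp [Qmat]

lemma top_Q_iota (g : Matrix (Fin 4) (Fin 4) R) (h : Matrix (Fin 2) (Fin 2) R) :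
    top (Qmat R * iota g h) =
      !![g 1 0, g 1 1, 0, g 1 2, g 1 3, 0;
         g 0 0, g 0 1, 0, g 0 2, g 0 3, 0;
         0, 0, h 1 0, 0, 0, -h 1 1] := by
  rw [top_Q_mul]
  ext i j : 1
  fin_cases i <;> fin_cases j <;> simp [iota]

/-- The matrix on the left is the cell element with lower parameter `C`, diagonal parameter `y =
a⁻¹` and upper parameter `B`. The identity is algebraic, with hermitian part `diag(0, 0, C)`;
integrality enters only when asking whether `kLower` lies in `I'`. -/
lemma decomp_lowerLevi (h : y * a = 1) (hC : star C = C) :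
    Qmat R * iota (lowerLevi x) !![a, a * B; a * C, star y + a * C * B] =
      blk (aLower x y a C h).val (!![0, 0, 0; 0, 0, 0; 0, 0, C] * ((aLower x y a C h)⁻¹).valᴴ) 0
        ((aLower x y a C h)⁻¹).valᴴ * (Qmat R * kLower x y B C) := by
  have e : ((aLower x y a C h)⁻¹).valᴴ = !![1, 0, a * C; -star x, 1, 0; 0, 0, a] := by
    change (!![1, -x, 0; 0, 1, 0; star a * C, 0, star a])ᴴ = _
    refine mat_ext_three ?_ ?_ ?_ ?_ ?_ ?_ ?_ ?_ ?_ <;>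
      simp only [Matrix.mul_apply, Matrix.sub_apply, Fin.sum_univ_three,
        Matrix.conjTranspose_apply, Matrix.of_apply, Matrix.cons_val, hC, mul_zero, zero_mul,
        mul_one, one_mul, add_zero, zero_add, neg_zero, sub_zero, star_zero, star_one, star_neg,
        star_mul', star_sub, star_star]
  have e' : (aLower x y a C h).val = !![1, x, 0; 0, 1, 0; -C, -(C * x), star y] := rfl
  have e2 : !![0, 0, 0; 0, 0, 0; 0, 0, C] * !![1, 0, a * C; -star x, 1, 0; 0, 0, a] =
      !![0, 0, 0; 0, 0, 0; 0, 0, C * a] := by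
    refine mat_ext_three ?_ ?_ ?_ ?_ ?_ ?_ ?_ ?_ ?_ <;>
      simp only [Matrix.mul_apply, Matrix.sub_apply, Fin.sum_univ_three,
        Matrix.conjTranspose_apply, Matrix.of_apply, Matrix.cons_val, mul_zero, zero_mul, mul_one,
        one_mul, add_zero, zero_add, neg_zero, sub_zero, star_zero, star_one, star_neg, star_mul',
        star_sub, star_star]
  rw [e, e', e2]
  refine ext_top_bot ?_ ?_
  · rw [top_blk_mul, top_Q_iota, top_Q_mul, bot_Q_mul]
    ext i j
    simp only [Matrix.add_apply, Matrix.mul_apply, Fin.sum_univ_three]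
    fin_cases i <;> fin_cases j <;>
      simp only [lowerLevi, kLower, Pi.neg_apply, Fin.zero_eta, Fin.mk_one, Fin.reduceFinMk,
        Matrix.of_apply, Matrix.cons_val, mul_zero, zero_mul, mul_one, one_mul, add_zero, zero_add,
        neg_zero, sub_zero, star_zero, star_one, star_neg, star_mul', star_sub, star_star] <;> grind
  · rw [bot_blk_mul, bot_Q_iota, bot_Q_mul]
    ext i j
    simp only [Matrix.mul_apply, Fin.sum_univ_three]
    fin_cases i <;> fin_cases j <;>
      simp only [lowerLevi, kLower, Pi.neg_apply, Fin.zero_eta, Fin.mk_one, Fin.reduceFinMk,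
        Matrix.of_apply, Matrix.cons_val, mul_zero, zero_mul, mul_one, one_mul, add_zero, zero_add,
        neg_zero, sub_zero, star_zero, star_one, star_neg, star_mul', star_sub, star_star] <;> grind

lemma decomp_swap (h : y * a = 1) (hC : star C = C) :
    Qmat R * iota (s1 R) !![a, a * B; a * C, star y + a * C * B] =
      blk (aSwap y a C h).val (!![0, 0, 0; 0, 0, 0; 0, 0, C] * ((aSwap y a C h)⁻¹).valᴴ) 0
        ((aSwap y a C h)⁻¹).valᴴ * (Qmat R * kSwap y B C) := by
  have e : ((aSwap y a C h)⁻¹).valᴴ = !![0, 1, a * C; 1, 0, 0; 0, 0, a] := by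
    change (!![0, 1, 0; 1, 0, 0; star a * C, 0, star a])ᴴ = _
    refine mat_ext_three ?_ ?_ ?_ ?_ ?_ ?_ ?_ ?_ ?_ <;>
      simp only [Matrix.mul_apply, Matrix.sub_apply, Fin.sum_univ_three,
        Matrix.conjTranspose_apply, Matrix.of_apply, Matrix.cons_val, hC, mul_zero, zero_mul,
        mul_one, one_mul, add_zero, zero_add, neg_zero, sub_zero, star_zero, star_one, star_neg,
        star_mul', star_sub, star_star]
  have e' : (aSwap y a C h).val = !![0, 1, 0; 1, 0, 0; 0, -C, star y] := rfl
  have e2 : !![0, 0, 0; 0, 0, 0; 0, 0, C] * !![0, 1, a * C; 1, 0, 0; 0, 0, a] =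
      !![0, 0, 0; 0, 0, 0; 0, 0, C * a] := by
    refine mat_ext_three ?_ ?_ ?_ ?_ ?_ ?_ ?_ ?_ ?_ <;>
      simp only [Matrix.mul_apply, Matrix.sub_apply, Fin.sum_univ_three,
        Matrix.conjTranspose_apply, Matrix.of_apply, Matrix.cons_val, mul_zero, zero_mul, mul_one,
        one_mul, add_zero, zero_add, neg_zero, sub_zero, star_zero, star_one, star_neg, star_mul',
        star_sub, star_star]
  rw [e, e', e2]
  refine ext_top_bot ?_ ?_
  · rw [top_blk_mul, top_Q_iota, top_Q_mul, bot_Q_mul]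
    ext i j
    simp only [Matrix.add_apply, Matrix.mul_apply, Fin.sum_univ_three]
    fin_cases i <;> fin_cases j <;>
      simp only [s1, kSwap, Pi.neg_apply, Fin.zero_eta, Fin.mk_one, Fin.reduceFinMk,
        Matrix.of_apply, Matrix.cons_val, mul_zero, zero_mul, mul_one, one_mul, add_zero, zero_add,
        neg_zero, sub_zero, star_zero, star_one, star_neg, star_mul', star_sub, star_star] <;> grind
  · rw [bot_blk_mul, bot_Q_iota, bot_Q_mul]
    ext i j
    simp only [Matrix.mul_apply, Fin.sum_univ_three]
    fin_cases i <;> fin_cases j <;>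
      simp only [s1, kSwap, Pi.neg_apply, Fin.zero_eta, Fin.mk_one, Fin.reduceFinMk,
        Matrix.of_apply, Matrix.cons_val, mul_zero, zero_mul, mul_one, one_mul, add_zero, zero_add,
        neg_zero, sub_zero, star_zero, star_one, star_neg, star_mul', star_sub, star_star] <;> grind

end generic

/-! ### Exact support of the section along `ι`, and its value there -/

section evaluation

/-- The inverse is `-J kᴴ J`, so its integrality follows from that of `k`. -/
lemma unitaryGL_mem_Iwahori {k : Matrix (Fin 6) (Fin 6) (Lv p d)} (hk : kᴴ * J3 _ * k = J3 _)
    (hO : ∀ i j, IsO (k i j))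
    (hP : ∀ i j : Fin 6, ((i < 3 ∧ j < 3 ∧ i < j) ∨ (3 ≤ i ∧ j < 3) ∨ (3 ≤ i ∧ 3 ≤ j ∧ j < i)) →
      IsP (k i j)) : unitaryGL k hk ∈ IwahoriH p d := by
  refine ⟨⟨1, by rw [Units.val_one, one_smul]; exact hk⟩, ⟨fun i j => (hO i j).isInt,
  fun i j => ?_⟩,
    fun i j => (hO i j).2, fun i j h => (hP i j h).1⟩
  change IsInt ((-(J3 (Lv p d) * kᴴ * J3 (Lv p d))) i j)
  rw [Matrix.neg_apply, Matrix.mul_apply]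
  refine (IsInt.sum fun l _ => IsInt.mul ?_ (isInt_J3 _ _)).neg
  rw [Matrix.mul_apply]
  exact IsInt.sum fun l _ => (isInt_J3 _ _).mul (hO _ _).isInt.star

variable [hin : Fact (legendreSym p (-d) = -1)]

lemma exists_decomp_of_eq {h : Matrix (Fin 6) (Fin 6) (Lv p d)} {k : Matrix (Fin 6) (Fin 6) (Lv p d)}
    {A : GL (Fin 3) (Lv p d)} {γ : ℚ_[p]} (hk : kᴴ * J3 _ * k = J3 _)
    (hkI : unitaryGL k hk ∈ IwahoriH p d)
    (h1 : h = blk A.val (!![0, 0, 0; 0, 0, 0; 0, 0, algebraMap _ _ γ] * (A⁻¹).valᴴ) 0 (A⁻¹).valᴴ *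
      (Qmat _ * k)) :
    Nonempty (SiegelDecomp h) ∧ hᴴ * J3 _ * h = J3 _ := by
  have hc : (!![0, 0, 0; 0, 0, 0; 0, 0, algebraMap ℚ_[p] (Lv p d) γ])ᴴ =
      !![0, 0, 0; 0, 0, 0; 0, 0, algebraMap ℚ_[p] (Lv p d) γ] := by
    refine mat_ext_three ?_ ?_ ?_ ?_ ?_ ?_ ?_ ?_ ?_ <;>
      simp only [Matrix.conjTranspose_apply, Matrix.of_apply, Matrix.cons_val, star_zero,
        star_algebraMap_padic]
  let D : SiegelDecomp h :=
    { c := !![0, 0, 0; 0, 0, 0; 0, 0, algebraMap ℚ_[p] (Lv p d) γ]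
      A := A
      t := 1
      k := unitaryGL k hk
      c_hermitian := hc
      k_mem := hkI
      eq := by
        rw [nSiegel_mul_mSiegel, Units.val_one, one_smul, Matrix.mul_assoc]
        exact h1 }
  refine ⟨⟨D⟩, ?_⟩
  have := D.similitude (ν := 1) (by rw [one_smul]; exact hk)
  simpa [D] using this

/-- The converse of `supp_of_decomp`: the conditions `y, x y ∈ O`, `β ∈ ℤ_p`, `γ ∈ pℤ_p` put each
entry of `kLower x y β γ` where `I'` requires it. -/
lemma decomp_lowerLevi_of_supp {x : Lv p d} (hx : IsInt x) {h : Matrix (Fin 2) (Fin 2) (Lv p d)}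
    (hh : hᴴ * J1 _ * h = J1 _) (hs : Supp (fun y => IsO y ∧ IsO (x * y)) h) :
    Nonempty (SiegelDecomp (Qmat _ * iota (lowerLevi x) h)) ∧
      (Qmat _ * iota (lowerLevi x) h)ᴴ * J3 _ * (Qmat _ * iota (lowerLevi x) h) = J3 _ := by
  obtain ⟨ha, ⟨hyO, hxy⟩, hc, hb⟩ := hs
  obtain ⟨y, β, γ, hy, rfl⟩ := exists_cell hh ha
  have hcγ : IsP (algebraMap ℚ_[p] (Lv p d) γ) := by
    simpa [mul_div_assoc, mul_comm y⁻¹, hy] using hc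
  have hbβ : IsInt (algebraMap ℚ_[p] (Lv p d) β) := by
    simpa [mul_div_assoc, mul_comm y⁻¹, hy] using hb
  have hBO : IsO (algebraMap ℚ_[p] (Lv p d) β) := isO_algebraMap.2 (isInt_algebraMap.1 hbβ)
  change IsO y⁻¹⁻¹ at hyO
  change IsO (x * y⁻¹⁻¹) at hxy
  rw [inv_inv] at hyO hxy
  refine exists_decomp_of_eq (kLower_unitary (x := x) (y := y) (star_algebraMap_padic β)
    (star_algebraMap_padic γ)) ?_ (decomp_lowerLevi (mul_inv_cancel₀ hy) (star_algebraMap_padic γ))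
  have c1 := (hcγ.mul_int hx).mul_int hx.star
  have c2 := hcγ.mul_int hx.star
  have c3 := hcγ.mul_int hx
  have o1 : IsO (y - 1) := hyO.sub IsO.one
  have o2 : IsO (1 - star y) := IsO.one.sub hyO.star
  refine unitaryGL_mem_Iwahori _ (fun i j => ?_) fun i j hij => ?_
  · fin_cases i <;> fin_cases j <;>
      simp only [kLower, Fin.zero_eta, Fin.mk_one, Fin.reduceFinMk, Matrix.of_apply,
        Matrix.cons_val] <;>
      with_reducible
        first
        | exact IsO.zero
        | exact IsO.one
        | exact o1
        | exact o2
        | exact hxy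
        | exact hxy.star.neg
        | exact hBO.neg
        | exact c1.isO.neg
        | exact c2.isO.neg
        | exact c3.isO.neg
        | exact hcγ.isO.neg
  · fin_cases i <;> fin_cases j <;>
      first
      | exact absurd hij (by decide)
      | simp only [kLower, Fin.zero_eta, Fin.mk_one, Fin.reduceFinMk, Matrix.of_apply,
      Matrix.cons_val]
        with_reducible
          first
          | exact IsP.zero
          | exact c1.neg
          | exact c2.neg
          | exact c3.neg
          | exact hcγ.neg

lemma decomp_swap_of_supp {h : Matrix (Fin 2) (Fin 2) (Lv p d)}
    (hh : hᴴ * J1 _ * h = J1 _) (hs : Supp IsO h) :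
    Nonempty (SiegelDecomp (Qmat _ * iota (s1 _) h)) ∧
      (Qmat _ * iota (s1 _) h)ᴴ * J3 _ * (Qmat _ * iota (s1 _) h) = J3 _ := by
  obtain ⟨ha, hyO, hc, hb⟩ := hs
  obtain ⟨y, β, γ, hy, rfl⟩ := exists_cell hh ha
  have hcγ : IsP (algebraMap ℚ_[p] (Lv p d) γ) := by
    simpa [mul_div_assoc, mul_comm y⁻¹, hy] using hc
  have hbβ : IsInt (algebraMap ℚ_[p] (Lv p d) β) := by
    simpa [mul_div_assoc, mul_comm y⁻¹, hy] using hb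
  have hBO : IsO (algebraMap ℚ_[p] (Lv p d) β) := isO_algebraMap.2 (isInt_algebraMap.1 hbβ)
  change IsO y⁻¹⁻¹ at hyO
  rw [inv_inv] at hyO
  refine exists_decomp_of_eq (kSwap_unitary (y := y) (star_algebraMap_padic β)
    (star_algebraMap_padic γ)) ?_ (decomp_swap (mul_inv_cancel₀ hy) (star_algebraMap_padic γ))
  refine unitaryGL_mem_Iwahori _ (fun i j => ?_) fun i j hij => ?_
  · fin_cases i <;> fin_cases j <;>
      simp only [kSwap, Fin.zero_eta, Fin.mk_one, Fin.reduceFinMk, Matrix.of_apply,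
        Matrix.cons_val] <;>
      with_reducible
        first
        | exact IsO.zero
        | exact IsO.one
        | exact IsO.one.neg
        | exact hyO
        | exact hyO.star.neg
        | exact hBO.neg
        | exact hcγ.isO.neg
  · fin_cases i <;> fin_cases j <;>
      first
      | exact absurd hij (by decide)
      | simp only [kSwap, Fin.zero_eta, Fin.mk_one, Fin.reduceFinMk, Matrix.of_apply,
      Matrix.cons_val]
        with_reducible
          first
          | exact IsP.zero
          | exact hcγ.neg

/-- Necessary conditions for `Q ι(g, h)` to lie in the support of the section, when `g` lies in the
Levi subgroup of the Siegel parabolic. -/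
lemma supp_of_decomp {h : Matrix (Fin 2) (Fin 2) (Lv p d)} {g : Matrix (Fin 4) (Fin 4) (Lv p d)}
    (g12 : g 1 2 = 0) (g13 : g 1 3 = 0) (g20 : g 2 0 = 0) (g21 : g 2 1 = 0) (g30 : g 3 0 = 0)
    (g31 : g 3 1 = 0) (g32 : IsO (g 3 2)) (g33 : IsO (g 3 3)) (hg : g 1 0 = 1 ∨ g 1 1 = 1)
    (D : SiegelDecomp (Qmat _ * iota g h)) :
    Supp (fun y => IsO (g 1 0 * y) ∧ IsO (g 1 1 * y)) h := by
  have ha : h 0 0 ≠ 0 := fun ha => D.det_ne_zero (by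
    rw [det_midCols_bot_Q_iota, g12, g13, ha]; ring)
  -- This combination has entries `1, 0, 0` in columns 2, 3, 4; integrality of the other columns
  -- bounds `y` and `β`.
  have r1 := D.row_mem ![0, 0, (h 0 0)⁻¹]
  -- The last coefficient cancels column 2, so the stronger half of `row_mem` applies and bounds `γ
  -- = h 1 0 / h 0 0`.
  have r2 := D.row_mem ![1, 0, -(h 1 0 / h 0 0)]
  rw [vecMul_bot_Q_iota] at r1 r2
  have e1 : (h 0 0)⁻¹ * h 0 0 = 1 := inv_mul_cancel₀ ha
  have e2 : h 1 0 + -(h 1 0 / h 0 0) * h 0 0 = 0 := by field_simp; ring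
  simp only [Matrix.cons_val, g12, g13, g20, g21, g30, g31, e1, e2, mul_zero, zero_mul, add_zero,
    zero_add, one_mul, neg_zero, zero_sub] at r1 r2
  obtain ⟨r1, -⟩ := r1 IsO.one IsO.zero IsO.zero
  obtain ⟨-, r2⟩ := r2 IsO.zero g32 g33
  have r10 := r1 0
  have r11 := r1 1
  have r15 := r1 5
  simp only [Matrix.cons_val] at r10 r11 r15
  obtain ⟨r20, r21⟩ := r2 IsP.zero
  refine ⟨ha, ⟨by rwa [mul_comm], by rwa [mul_comm]⟩, ?_, ?_⟩
  · rcases hg with hg | hg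
    · rw [hg, mul_one] at r20
      simpa using r20.neg
    · rw [hg, mul_one] at r21
      simpa using r21.neg
  · have := r15.neg.isInt
    rwa [neg_neg, mul_comm, ← div_eq_mul_inv] at this

lemma norm_two_inv (hp2 : p ≠ 2) : ‖(1 / 2 : ℚ_[p])‖ = 1 := by
  have h : ‖((2 : ℕ) : ℚ_[p])‖ = 1 := by
    rw [Padic.norm_natCast_eq_one_iff]
    exact (Nat.coprime_primes Fact.out Nat.prime_two).2 hp2
  push_cast at h
  rw [norm_div, norm_one, h, div_one]

lemma isInt_alpha (hp2 : p ≠ 2) (b : ℤ) : IsInt (alpha p d b) := by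
  refine ⟨?_, (norm_two_inv hp2).le⟩
  have : (alpha p d b).re = b * (1 / 2) := by simp [alpha, div_eq_mul_inv]
  rw [this]
  exact padic_mul_le (Padic.norm_int_le_one b) (norm_two_inv hp2).le

/-- As `α = (b + √-d)/2`, the imaginary part of `α y` is `y.re / 2` plus an integral multiple of
`y.im`; with `2` a unit, demanding that both imaginary parts vanish modulo `p` forces `y.re` to do
so too. -/
lemma isO_alpha_mul_iff (hp2 : p ≠ 2) (b : ℤ) {y : Lv p d} :
    (IsO y ∧ IsO (alpha p d b * y)) ↔ IsP y := by
  refine ⟨fun ⟨h1, h2⟩ => ⟨?_, h1.2⟩, fun h => ⟨h.isO, ((isInt_alpha hp2 b).mul_isP h).isO⟩⟩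
  have e : (1 / 2 : ℚ_[p]) * y.re = (alpha p d b * y).im + -((alpha p d b).re * y.im) := by
    rw [QuadraticAlgebra.im_mul]
    simp [alpha]
  have h3 : ‖(1 / 2 : ℚ_[p]) * y.re‖ < 1 := by
    rw [e]
    refine padic_add_lt h2.2 ?_
    rw [norm_neg]
    exact padic_mul_lt_right (isInt_alpha hp2 b).1 h1.2
  rwa [norm_mul, norm_two_inv hp2, one_mul] at h3

lemma not_isP_one : ¬ IsP (1 : Lv p d) := by
  rw [isP_iff_nrm, nrm_one]
  exact lt_irrefl _

variable (p d) in
lemma Theta_mul_s4 (b : ℤ) : Theta p d b * s4 _ =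
    !![0, -1, 0, 0; -1, -alpha p d b, 0, 0; -star (alpha p d b), 0, star (alpha p d b), -1;
      1, 0, -1, 0] := by
  ext i j : 1
  fin_cases i <;> fin_cases j <;> simp [Theta, s4, Matrix.mul_apply, Fin.sum_univ_four]

variable (p d) in
lemma Theta_mul_s5 (b : ℤ) : Theta p d b * s5 _ =
    !![0, -1, 0, 0; -1, -alpha p d b, 0, 0; 0, 1, star (alpha p d b), -1; 0, 0, -1, 0] := by
  ext i j : 1
  fin_cases i <;> fin_cases j <;> simp [Theta, s5, Matrix.mul_apply, Fin.sum_univ_four]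

/-- With `ρ = h 1 0 / h 0 0`, the row criterion puts `1 + ρ` and `ρ α` in `pℤ_{L,p}`, hence also
`α`, whose imaginary part `1/2` is a unit. -/
lemma isEmpty_decomp_Theta_s4 (hp2 : p ≠ 2) (b : ℤ) (h : Matrix (Fin 2) (Fin 2) (Lv p d)) :
    IsEmpty (SiegelDecomp (Qmat _ * iota (Theta p d b * s4 _) h)) := by
  refine ⟨fun D => ?_⟩
  rw [Theta_mul_s4] at D
  set α := alpha p d b with hα
  have ha : h 0 0 ≠ 0 := fun ha => D.det_ne_zero (by
    rw [det_midCols_bot_Q_iota, ha]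
    simp)
  have r2 := D.row_mem ![1, 0, -(h 1 0 / h 0 0)]
  rw [vecMul_bot_Q_iota] at r2
  have e2 : h 1 0 + -(h 1 0 / h 0 0 * h 0 0) = 0 := by field_simp; ring
  simp only [Matrix.of_apply, Matrix.cons_val, e2, mul_zero, zero_mul, add_zero, zero_add, one_mul,
    mul_neg, mul_one, neg_mul, neg_neg, neg_zero] at r2
  obtain ⟨-, r2⟩ := r2 IsO.zero IsO.one.neg IsO.zero
  obtain ⟨r20, r21⟩ := r2 IsP.zero
  have h3 : IsP α := by
    have := ((isInt_alpha hp2 b).mul_isP r20).sub r21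
    convert this using 1
    rw [hα]; ring
  have h4 := h3.2
  rw [hα] at h4
  exact h4.ne (norm_two_inv hp2)

/-- With `ρ = h 1 0 / h 0 0`, two applications of the row criterion put `ρ` and `1 + star α * ρ * α`
in `pℤ_{L,p}`, hence also `1`. -/
lemma isEmpty_decomp_Theta_s5 (hp2 : p ≠ 2) (b : ℤ) (h : Matrix (Fin 2) (Fin 2) (Lv p d)) :
    IsEmpty (SiegelDecomp (Qmat _ * iota (Theta p d b * s5 _) h)) := by
  refine ⟨fun D => ?_⟩
  rw [Theta_mul_s5] at D
  set α := alpha p d b with hα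
  have ha : h 0 0 ≠ 0 := fun ha => D.det_ne_zero (by
    rw [det_midCols_bot_Q_iota, ha]
    simp)
  have r2 := D.row_mem ![1, 0, -(h 1 0 / h 0 0)]
  -- The multiples of `star α` cancel columns 2 and 3, leaving `-1` in column 4.
  have r3 := D.row_mem ![star α, 1, -(star α * (h 1 0 / h 0 0))]
  rw [vecMul_bot_Q_iota] at r2 r3
  have e2 : h 1 0 + -(h 1 0 / h 0 0 * h 0 0) = 0 := by field_simp; ring
  have e3 : star α * h 1 0 + -(star α * (h 1 0 / h 0 0) * h 0 0) = 0 := by field_simp; ring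
  simp only [Matrix.of_apply, Matrix.cons_val, mul_zero, zero_mul, add_zero, zero_add, one_mul,
    mul_neg, mul_one, neg_mul, neg_neg, e2, e3, neg_add_cancel] at r2 r3
  obtain ⟨-, r2⟩ := r2 IsO.zero IsO.one.neg IsO.zero
  obtain ⟨-, r3⟩ := r3 IsO.zero IsO.zero IsO.one.neg
  obtain ⟨r20, -⟩ := r2 IsP.zero
  obtain ⟨-, r31⟩ := r3 IsP.zero
  have hI := isInt_alpha (d := d) hp2 b
  refine not_isP_one (p := p) (d := d) ?_
  have := r31.sub ((hI.star.mul_isP r20).mul_int hI)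
  convert this using 1
  ring

/-- The value of the zeta integrand on the support. -/
def cellFn (Λ : (Lv p d)ˣ →* Circle) (W : Ft p d → ℂ) (g : Ft p d) (s : ℂ) (h : F1 p d) : ℂ :=
  ((nrm ((h : GL (Fin 2) (Lv p d)) 0 0)⁻¹ : ℝ) : ℂ) ^ (3 * (s + 1 / 2)) *
    charZ Λ ((h : GL (Fin 2) (Lv p d)) 0 0)⁻¹ * W (g * Subgroup.inclusion (U_le_GU _) h)

variable {Λ : (Lv p d)ˣ →* Circle}

/-- In cell coordinates the determinant is `y⁻¹ * star y`, and `Λ (star y) = Λ(y)⁻¹`. -/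
lemma charZ_det (hΛ : ∀ x : ℚ_[p]ˣ, Λ (baseUnits p d x) = 1) (h : F1 p d)
    (ha : (h : GL (Fin 2) (Lv p d)) 0 0 ≠ 0) :
    (Λ (Matrix.GeneralLinearGroup.det (h : GL (Fin 2) (Lv p d))) : ℂ) =
      charZ Λ ((h : GL (Fin 2) (Lv p d)) 0 0) ^ 2 := by
  obtain ⟨y, β, γ, hy, e⟩ := exists_cell h.2 ha
  rw [← charZ_coe]
  have e1 : ((Matrix.GeneralLinearGroup.det (h : GL (Fin 2) (Lv p d)) : (Lv p d)ˣ) : Lv p d) =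
      y⁻¹ * star y := by
    change (h : GL (Fin 2) (Lv p d)).val.det = _
    rw [e, Matrix.det_fin_two]
    simp
    ring
  have e2 : (h : GL (Fin 2) (Lv p d)) 0 0 = y⁻¹ := by
    rw [e]; rfl
  rw [e1, e2, charZ_mul, charZ_star hΛ, charZ_inv, sq]

/-- Under these conditions on `k` the minor governing the section is `±h 0 0`. The section then
contributes `Λ(h 0 0)` and the determinant twist `Λ(h 0 0)⁻²`, which leaves `Λ(y)`. -/
lemma zetaIntegrand_eq_cellFn (hΛ : ∀ x : ℚ_[p]ˣ, Λ (baseUnits p d x) = 1)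
    (hΛ0 : ∀ u ∈ Gamma0L p d, Λ u = 1) {W : Ft p d → ℂ} {g : Ft p d}
    {k : Matrix (Fin 4) (Fin 4) (Lv p d)} {s : ℂ} {h : F1 p d}
    (hdet : k 2 2 * k 1 3 - k 2 3 * k 1 2 = 0)
    (hdet' : k 3 2 * k 2 3 - k 3 3 * k 2 2 = 1 ∨ k 3 2 * k 2 3 - k 3 3 * k 2 2 = -1)
    (H : Nonempty (SiegelDecomp (Qmat _ * iota k (h : GL (Fin 2) (Lv p d)).val)))
    (hU : (Qmat _ * iota k (h : GL (Fin 2) (Lv p d)).val)ᴴ * J3 _ *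
      (Qmat _ * iota k (h : GL (Fin 2) (Lv p d)).val) = J3 _) :
    zetaIntegrand Λ W g k s h = cellFn Λ W g s h := by
  have hd : (midCols (bot (Qmat _ * iota k (h : GL (Fin 2) (Lv p d)).val))).det =
      (h : GL (Fin 2) (Lv p d)) 0 0 ∨
      (midCols (bot (Qmat _ * iota k (h : GL (Fin 2) (Lv p d)).val))).det =
      -(h : GL (Fin 2) (Lv p d)) 0 0 := by
    rw [det_midCols_bot_Q_iota, hdet]
    rcases hdet' with e | e <;> simp [e]
  have ha : (h : GL (Fin 2) (Lv p d)) 0 0 ≠ 0 := by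
    obtain ⟨D⟩ := H
    intro h0
    exact D.det_ne_zero (by rcases hd with e | e <;> simp [e, h0])
  have hc : charZ Λ ((h : GL (Fin 2) (Lv p d)) 0 0) ≠ 0 := by
    intro h0
    have := norm_charZ Λ ha
    simp [h0] at this
  have hΥ : Upsilon Λ s (Qmat _ * iota k (h : GL (Fin 2) (Lv p d)).val) =
      ((nrm ((h : GL (Fin 2) (Lv p d)) 0 0)⁻¹ : ℝ) : ℂ) ^ (3 * (s + 1 / 2)) *
        charZ Λ ((h : GL (Fin 2) (Lv p d)) 0 0) := by
    rw [Upsilon_eq hΛ hΛ0 s hU H]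
    rcases hd with e | e <;> rw [e]
    rw [charZ_neg hΛ, inv_neg, nrm_neg]
  rw [zetaIntegrand, cellFn, hΥ, Circle.coe_inv, charZ_det hΛ h ha, charZ_inv]
  field_simp

end evaluation

/-! ### The integrand for each element of `Y_p` -/

section integrand
variable [hin : Fact (legendreSym p (-d) = -1)]
  {Λ : (Lv p d)ˣ →* Circle} {W : Ft p d → ℂ} {g : Ft p d} {s : ℂ}

/-- The function `cellFn` restricted to `Supp C`. -/
def suppFn (C : Lv p d → Prop) (Λ : (Lv p d)ˣ →* Circle) (W : Ft p d → ℂ) (g : Ft p d) (s : ℂ) :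
    F1 p d → ℂ :=
  Set.indicator {h | Supp C (h : GL (Fin 2) (Lv p d)).val} (cellFn Λ W g s)

lemma zetaIntegrand_of_isEmpty {k : Matrix (Fin 4) (Fin 4) (Lv p d)} {h : F1 p d}
    (H : IsEmpty (SiegelDecomp (Qmat _ * iota k (h : GL (Fin 2) (Lv p d)).val))) :
    zetaIntegrand Λ W g k s h = 0 := by
  rw [zetaIntegrand, Upsilon_eq_zero s H, zero_mul, zero_mul]

lemma zetaIntegrand_one (hΛ : ∀ x : ℚ_[p]ˣ, Λ (baseUnits p d x) = 1)
    (hΛ0 : ∀ u ∈ Gamma0L p d, Λ u = 1) :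
    zetaIntegrand Λ W g 1 s = suppFn IsO Λ W g s := by
  rw [← lowerLevi_zero]
  funext h
  by_cases H : Supp IsO (h : GL (Fin 2) (Lv p d)).val
  · rw [suppFn, Set.indicator_of_mem (by exact H)]
    have H' : Supp (fun y => IsO y ∧ IsO (0 * y)) (h : GL (Fin 2) (Lv p d)).val :=
      ⟨H.1, ⟨H.2.1, by rw [zero_mul]; exact IsO.zero⟩, H.2.2⟩
    obtain ⟨h1, h2⟩ := decomp_lowerLevi_of_supp IsInt.zero h.2 H'
    exact zetaIntegrand_eq_cellFn hΛ hΛ0 (by simp [lowerLevi]) (by simp [lowerLevi]) h1 h2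
  · rw [suppFn, Set.indicator_of_notMem (by exact H)]
    refine zetaIntegrand_of_isEmpty ⟨fun D => H ?_⟩
    have := supp_of_decomp (by simp [lowerLevi]) (by simp [lowerLevi]) (by simp [lowerLevi])
      (by simp [lowerLevi]) (by simp [lowerLevi]) (by simp [lowerLevi])
      (by simpa [lowerLevi] using IsO.zero) (by simpa [lowerLevi] using IsO.one)
      (by simp [lowerLevi]) D
    exact ⟨this.1, by simpa [lowerLevi] using this.2.1.2, this.2.2⟩

lemma zetaIntegrand_s1 (hΛ : ∀ x : ℚ_[p]ˣ, Λ (baseUnits p d x) = 1)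
    (hΛ0 : ∀ u ∈ Gamma0L p d, Λ u = 1) :
    zetaIntegrand Λ W g (s1 _) s = suppFn IsO Λ W g s := by
  funext h
  by_cases H : Supp IsO (h : GL (Fin 2) (Lv p d)).val
  · rw [suppFn, Set.indicator_of_mem (by exact H)]
    obtain ⟨h1, h2⟩ := decomp_swap_of_supp h.2 H
    exact zetaIntegrand_eq_cellFn hΛ hΛ0 (by simp [s1]) (by simp [s1]) h1 h2
  · rw [suppFn, Set.indicator_of_notMem (by exact H)]
    refine zetaIntegrand_of_isEmpty ⟨fun D => H ?_⟩
    have := supp_of_decomp (by simp [s1]) (by simp [s1]) (by simp [s1])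
      (by simp [s1]) (by simp [s1]) (by simp [s1])
      (by simpa [s1] using IsO.one) (by simpa [s1] using IsO.zero)
      (by simp [s1]) D
    exact ⟨this.1, by simpa [s1] using this.2.1.1, this.2.2⟩

/-- Since `Θ = lowerLevi α`, the support condition on `y` is `y, α y ∈ O`, that is `y ∈ pℤ_{L,p}`:
the part on `K0` is lost. -/
lemma zetaIntegrand_Theta (hp2 : p ≠ 2) (b : ℤ) (hΛ : ∀ x : ℚ_[p]ˣ, Λ (baseUnits p d x) = 1)
    (hΛ0 : ∀ u ∈ Gamma0L p d, Λ u = 1) :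
    zetaIntegrand Λ W g (Theta p d b) s = suppFn IsP Λ W g s := by
  rw [← show lowerLevi (alpha p d b) = Theta p d b from rfl]
  funext h
  by_cases H : Supp IsP (h : GL (Fin 2) (Lv p d)).val
  · rw [suppFn, Set.indicator_of_mem (by exact H)]
    obtain ⟨h1, h2⟩ := decomp_lowerLevi_of_supp (isInt_alpha hp2 b) h.2
      ⟨H.1, (isO_alpha_mul_iff hp2 b).2 H.2.1, H.2.2⟩
    exact zetaIntegrand_eq_cellFn hΛ hΛ0 (by simp [lowerLevi]) (by simp [lowerLevi]) h1 h2
  · rw [suppFn, Set.indicator_of_notMem (by exact H)]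
    refine zetaIntegrand_of_isEmpty ⟨fun D => H ?_⟩
    have := supp_of_decomp (by simp [lowerLevi]) (by simp [lowerLevi]) (by simp [lowerLevi])
      (by simp [lowerLevi]) (by simp [lowerLevi]) (by simp [lowerLevi])
      (by simpa [lowerLevi] using IsO.zero) (by simpa [lowerLevi] using IsO.one)
      (by simp [lowerLevi]) D
    refine ⟨this.1, (isO_alpha_mul_iff hp2 b).1 ⟨?_, ?_⟩, this.2.2⟩
    · simpa [lowerLevi] using this.2.1.2
    · simpa [lowerLevi] using this.2.1.1

/-- The remaining elements of `Y_p` do not contribute. -/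
lemma zetaIntegrand_eq_zero (hp2 : p ≠ 2) (b : ℤ) {k : Matrix (Fin 4) (Fin 4) (Lv p d)}
    (hk : k = s2 _ ∨ k = s3 _ ∨ k = Theta p d b * s2 _ ∨ k = Theta p d b * s4 _ ∨
      k = Theta p d b * s5 _) : zetaIntegrand Λ W g k s = 0 := by
  funext h
  refine zetaIntegrand_of_isEmpty ?_
  rcases hk with rfl | rfl | rfl | rfl | rfl
  · exact isEmpty_decomp_of_row_two (by simp [s2]) (by simp [s2])
  · exact isEmpty_decomp_of_row_two (by simp [s3]) (by simp [s3])
  · exact isEmpty_decomp_of_row_two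
      (by simp [Theta, s2, Matrix.mul_apply, Fin.sum_univ_four])
      (by simp [Theta, s2, Matrix.mul_apply, Fin.sum_univ_four])
  · exact isEmpty_decomp_Theta_s4 hp2 b _
  · exact isEmpty_decomp_Theta_s5 hp2 b _

end integrand

/-! ## Compact open subgroups of `U(1,1)` -/

section subgroups

/-- The entries of an element of `U(1,1)`. -/
def ent (h : F1 p d) : Matrix (Fin 2) (Fin 2) (Lv p d) := (h : GL (Fin 2) (Lv p d)).val

lemma ent_mul (h k : F1 p d) : ent (h * k) = ent h * ent k := rfl

@[simp] lemma ent_one : ent (1 : F1 p d) = 1 := rfl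

lemma ent_unitary (h : F1 p d) : (ent h)ᴴ * J1 _ * ent h = J1 _ := h.2

lemma ent_inv (h : F1 p d) : ent h⁻¹ =
    !![star (ent h 1 1), -star (ent h 0 1); -star (ent h 1 0), star (ent h 0 0)] := by
  have h1 : ent h⁻¹ * ent h = 1 := by rw [← ent_mul, inv_mul_cancel, ent_one]
  have h2 : ent h * ent h⁻¹ = 1 := by rw [← ent_mul, mul_inv_cancel, ent_one]
  obtain ⟨e1, e2, e3⟩ := U11_iff.1 (ent_unitary h)
  have e3' := congrArg star e3
  simp only [star_sub, star_mul', star_star, star_one] at e3'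
  have h3 : !![star (ent h 1 1), -star (ent h 0 1); -star (ent h 1 0), star (ent h 0 0)] * ent h
      = 1 := by
    ext i j : 1
    rw [Matrix.mul_apply, Fin.sum_univ_two]
    fin_cases i <;> fin_cases j <;> simp
    · linear_combination e3'
    · linear_combination -e2
    · linear_combination e1
    · linear_combination e3
  calc ent h⁻¹ = (!![star (ent h 1 1), -star (ent h 0 1); -star (ent h 1 0), star (ent h 0 0)] *
        ent h) * ent h⁻¹ := by rw [h3, one_mul]
    _ = _ := by rw [Matrix.mul_assoc, h2, mul_one]

/-- The element of `U(1,1)` with given entries. -/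
def ofEnt (M : Matrix (Fin 2) (Fin 2) (Lv p d)) (hM : Mᴴ * J1 _ * M = J1 _) : F1 p d :=
  have hJ : J1 (Lv p d) * J1 (Lv p d) = -1 := by
    ext i j : 1
    rw [Matrix.mul_apply, Fin.sum_univ_two]
    fin_cases i <;> fin_cases j <;> simp [J1]
  have h : -(J1 _ * Mᴴ * J1 _) * M = 1 := by
    rw [neg_mul, Matrix.mul_assoc, Matrix.mul_assoc, ← Matrix.mul_assoc Mᴴ, hM, hJ, neg_neg]
  ⟨⟨M, -(J1 _ * Mᴴ * J1 _), mul_eq_one_comm.1 h, h⟩, hM⟩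

@[simp] lemma ent_ofEnt (M : Matrix (Fin 2) (Fin 2) (Lv p d)) (hM : Mᴴ * J1 _ * M = J1 _) :
    ent (ofEnt M hM) = M := rfl

lemma ent_mul_apply (h k : F1 p d) (i j : Fin 2) :
    ent (h * k) i j = ent h i 0 * ent k 0 j + ent h i 1 * ent k 1 j := by
  rw [ent_mul, Matrix.mul_apply, Fin.sum_univ_two]

lemma mem_KF1_iff {h : F1 p d} : h ∈ KF1 p d ↔ ∀ i j, IsInt (ent h i j) := by
  refine ⟨fun hh => hh.1, fun hh => ⟨hh, fun i j => ?_⟩⟩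
  change IsInt (ent h⁻¹ i j)
  rw [ent_inv]
  fin_cases i <;> fin_cases j
  exacts [(hh 1 1).star, (hh 0 1).star.neg, (hh 1 0).star.neg, (hh 0 0).star]

variable (p d) in
/-- The maximal compact subgroup of `U(1,1)`. -/
def Kmax : Subgroup (F1 p d) where
  carrier := {h | ∀ i j, IsInt (ent h i j)}
  one_mem' i j := by
    rw [ent_one, Matrix.one_apply]
    split_ifs
    exacts [IsInt.one, IsInt.zero]
  mul_mem' := by
    intro h k hh hk i j
    rw [ent_mul_apply]
    exact ((hh _ _).mul (hk _ _)).add ((hh _ _).mul (hk _ _))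
  inv_mem' := by
    intro h hh i j
    rw [ent_inv]
    fin_cases i <;> fin_cases j
    exacts [(hh 1 1).star, (hh 0 1).star.neg, (hh 1 0).star.neg, (hh 0 0).star]

variable (p d) in
/-- The integral elements of `U(1,1)` that are upper triangular modulo `p`. -/
def K1 : Subgroup (F1 p d) where
  carrier := {h | (∀ i j, IsInt (ent h i j)) ∧ IsP (ent h 1 0)}
  one_mem' := ⟨(Kmax p d).one_mem, by simpa using IsP.zero⟩
  mul_mem' := by
    intro h k hh hk
    refine ⟨(Kmax p d).mul_mem hh.1 hk.1, ?_⟩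
    rw [ent_mul_apply]
    exact (hh.2.mul_int (hk.1 _ _)).add ((hh.1 _ _).mul_isP hk.2)
  inv_mem' := by
    intro h hh
    refine ⟨(Kmax p d).inv_mem hh.1, ?_⟩
    rw [ent_inv]
    exact hh.2.star.neg

variable (p d) in
/-- The elements of `U(1,1)` with entries in `ℤ_p + p ℤ_{L,p}` that are upper triangular modulo
`p`. -/
def K0 : Subgroup (F1 p d) where
  carrier := {h | (∀ i j, IsO (ent h i j)) ∧ IsP (ent h 1 0)}
  one_mem' := by
    refine ⟨fun i j => ?_, by simpa using IsP.zero⟩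
    rw [ent_one, Matrix.one_apply]
    split_ifs
    exacts [IsO.one, IsO.zero]
  mul_mem' := by
    intro h k hh hk
    refine ⟨fun i j => ?_, ?_⟩
    · rw [ent_mul_apply]
      exact ((hh.1 _ _).mul (hk.1 _ _)).add ((hh.1 _ _).mul (hk.1 _ _))
    · rw [ent_mul_apply]
      exact (hh.2.mul_int (hk.1 _ _).isInt).add ((hh.1 _ _).isInt.mul_isP hk.2)
  inv_mem' := by
    intro h hh
    refine ⟨fun i j => ?_, ?_⟩
    · rw [ent_inv]
      fin_cases i <;> fin_cases j
      exacts [(hh.1 1 1).star, (hh.1 0 1).star.neg, (hh.1 1 0).star.neg, (hh.1 0 0).star]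
    · rw [ent_inv]
      exact hh.2.star.neg

lemma K0_le_K1 : K0 p d ≤ K1 p d := fun _ h => ⟨fun i j => (h.1 i j).isInt, h.2⟩

lemma continuous_ent (i j : Fin 2) : Continuous fun h : F1 p d => ent h i j :=
  (Continuous.matrix_elem (Units.continuous_val.comp continuous_subtype_val) i j)

lemma isOpen_Kmax : IsOpen (Kmax p d : Set (F1 p d)) := by
  have : (Kmax p d : Set (F1 p d)) = ⋂ i, ⋂ j, {h | IsInt (ent h i j)} := by
    ext h; simp only [Set.mem_iInter]; rfl
  rw [this]
  exact isOpen_iInter_of_finite fun i => isOpen_iInter_of_finite fun j =>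
    isOpen_isInt.preimage (continuous_ent i j)

lemma isOpen_K1 : IsOpen (K1 p d : Set (F1 p d)) := by
  have : (K1 p d : Set (F1 p d)) = (Kmax p d : Set (F1 p d)) ∩ {h | IsP (ent h 1 0)} := rfl
  rw [this]
  exact isOpen_Kmax.inter (isOpen_isP.preimage (continuous_ent 1 0))

lemma isOpen_K0 : IsOpen (K0 p d : Set (F1 p d)) := by
  have : (K0 p d : Set (F1 p d)) = (⋂ i, ⋂ j, {h | IsO (ent h i j)}) ∩ {h | IsP (ent h 1 0)} := by
    ext h; simp only [Set.mem_inter_iff, Set.mem_iInter]; rfl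
  rw [this]
  exact (isOpen_iInter_of_finite fun i => isOpen_iInter_of_finite fun j =>
    isOpen_isO.preimage (continuous_ent i j)).inter (isOpen_isP.preimage (continuous_ent 1 0))

variable [hin : Fact (legendreSym p (-d) = -1)]

lemma K1_nrm {h : F1 p d} (hh : h ∈ K1 p d) : nrm (ent h 0 0) = 1 ∧ nrm (ent h 1 1) = 1 := by
  obtain ⟨-, -, e3⟩ := U11_iff.1 (ent_unitary h)
  refine nrm_eq_one_of_mul_add (ν := 1) norm_one (hh.1 0 0) (hh.1 1 1)
    (z := -(star (ent h 1 0) * ent h 0 1)) (hh.2.star.mul_int (hh.1 0 1)).neg ?_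
  rw [map_one, ← e3]; ring

end subgroups

/-! ## The volume of `K0` -/

/-- The hypotheses say that `A` is the disjoint union of the translates `x i * B`. -/
lemma measure_eq_card_mul {G ι : Type*} [Group G] [MeasurableSpace G] [MeasurableMul G] [Fintype ι]
    (μ : Measure G) [μ.IsMulLeftInvariant] {A : Set G} {B : Subgroup G}
    (hB : MeasurableSet (B : Set G)) (x : ι → G) (hcov : ∀ g ∈ A, ∃ i, (x i)⁻¹ * g ∈ B)
    (hsub : ∀ i, ∀ b ∈ B, x i * b ∈ A) (hinj : ∀ i j, (x i)⁻¹ * x j ∈ B → i = j) :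
    μ A = Fintype.card ι * μ B := by
  have hA : A = ⋃ i, (fun g => (x i)⁻¹ * g) ⁻¹' B := by
    ext g
    simp only [Set.mem_iUnion, Set.mem_preimage, SetLike.mem_coe]
    refine ⟨hcov g, fun ⟨i, hi⟩ => ?_⟩
    simpa using hsub i _ hi
  rw [hA, measure_iUnion]
  · simp [measure_preimage_mul, tsum_fintype]
  · intro i j hij
    refine Set.disjoint_left.2 fun g hi hj => hij (hinj i j ?_)
    have := B.mul_mem hi (B.inv_mem hj)
    simpa [mul_assoc] using this
  · exact fun i => hB.preimage (measurable_const_mul _)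

/-- Lower triangular unipotent elements of `U(1,1)`. -/
def lowerF (p : ℕ) [Fact p.Prime] (d : ℤ) (γ : ℚ_[p]) : F1 p d :=
  ofEnt !![1, 0; algebraMap _ _ γ, 1] (by rw [U11_iff]; simp)

/-- The Weyl element of `U(1,1)`. -/
def weylF (p : ℕ) [Fact p.Prime] (d : ℤ) : F1 p d :=
  ofEnt !![0, 1; -1, 0] (by rw [U11_iff]; simp)

lemma exists_nat_norm_sub_lt {x : ℚ_[p]} (hx : ‖x‖ ≤ 1) : ∃ j : Fin p, ‖x - (j : ℕ)‖ < 1 := by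
  obtain ⟨n, hn, h⟩ := PadicInt.exists_mem_range (p := p) ⟨x, hx⟩
  refine ⟨⟨n, hn⟩, ?_⟩
  rw [IsLocalRing.mem_maximalIdeal, PadicInt.mem_nonunits, PadicInt.norm_def] at h
  exact h

lemma fin_eq_of_norm_lt {i j : Fin p} (h : ‖((i : ℕ) : ℚ_[p]) - (j : ℕ)‖ < 1) : i = j := by
  have h1 : ‖(((i : ℕ) - (j : ℕ) : ℤ) : ℚ_[p])‖ < 1 := by push_cast; exact h
  rw [Padic.norm_intCast_lt_one_iff] at h1
  have h2 := Int.eq_zero_of_abs_lt_dvd h1 (by rw [abs_lt]; constructor <;> omega)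
  ext; omega

instance : MeasurableMul (F1 p d) := inferInstance

lemma lowerF_mem_Kmax {γ : ℚ_[p]} (h : ‖γ‖ ≤ 1) : lowerF p d γ ∈ Kmax p d := by
  intro i j
  fin_cases i <;> fin_cases j
  exacts [IsInt.one, IsInt.zero, isInt_algebraMap.2 h, IsInt.one]

lemma weylF_mem_Kmax : weylF p d ∈ Kmax p d := by
  intro i j
  fin_cases i <;> fin_cases j
  exacts [IsInt.zero, IsInt.one, IsInt.one.neg, IsInt.zero]

lemma ent_lowerF_inv_mul (γ : ℚ_[p]) (h : F1 p d) :
    ent ((lowerF p d γ)⁻¹ * h) 1 0 = ent h 1 0 - algebraMap _ _ γ * ent h 0 0 := by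
  rw [ent_mul_apply, ent_inv]
  simp [lowerF]
  ring

lemma ent_weylF_inv_mul (h : F1 p d) : ent ((weylF p d)⁻¹ * h) 1 0 = ent h 0 0 := by
  rw [ent_mul_apply, ent_inv]
  simp [weylF]

section volume
variable [hin : Fact (legendreSym p (-d) = -1)]

/-- Elements of the open cell of `U(1,1)`, as elements of the group. -/
lemma exists_cell_ent {h : F1 p d} (ha : ent h 0 0 ≠ 0) :
    ∃ (y : Lv p d) (β γ : ℚ_[p]), y ≠ 0 ∧ ent h 0 0 = y⁻¹ ∧ ent h 0 1 = y⁻¹ * algebraMap _ _ β ∧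
      ent h 1 0 = y⁻¹ * algebraMap _ _ γ ∧
      ent h 1 1 = star y + y⁻¹ * algebraMap _ _ γ * algebraMap _ _ β := by
  obtain ⟨y, β, γ, hy, e⟩ := exists_cell (ent_unitary h) ha
  exact ⟨y, β, γ, hy, by rw [e]; rfl, by rw [e]; rfl, by rw [e]; rfl, by rw [e]; rfl⟩

/-- Cosets are indexed by `ℙ¹(𝔽_p)`, not by the projective line over `𝔽_{p²}`: when `h 0 0` is a
unit, the ratio `γ` of the first column lies in `ℤ_p` and is matched modulo `p` by some `lowerF j`;
otherwise the Weyl element represents the point at infinity. -/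
lemma measure_Kmax (μ : Measure (F1 p d)) [μ.IsMulLeftInvariant] :
    μ (Kmax p d) = (p + 1) * μ (K1 p d) := by
  let x : Option (Fin p) → F1 p d := fun o => o.elim (weylF p d) fun j => lowerF p d (j : ℕ)
  have hx : ∀ i, x i ∈ Kmax p d := by
    rintro (_ | j)
    · exact weylF_mem_Kmax
    · exact lowerF_mem_Kmax (by simpa using Padic.norm_int_le_one (p := p) (j : ℕ))
  rw [measure_eq_card_mul μ (A := (Kmax p d : Set (F1 p d))) (B := K1 p d) isOpen_K1.measurableSet x]
  · simp
  · intro h hh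
    rcases (isInt_iff_nrm.1 (hh 0 0)).lt_or_eq with h0 | h0
    · refine ⟨none, (Kmax p d).mul_mem ((Kmax p d).inv_mem (hx none)) hh, ?_⟩
      change IsP (ent ((weylF p d)⁻¹ * h) 1 0)
      rw [ent_weylF_inv_mul]
      exact isP_iff_nrm.2 h0
    · have ha : ent h 0 0 ≠ 0 := fun e => by simp [e] at h0
      obtain ⟨y, β, γ, hy, e00, -, e10, -⟩ := exists_cell_ent ha
      have hγ : ‖γ‖ ≤ 1 := by
        have := hh 1 0
        rw [e10, isInt_iff_nrm, nrm_mul, ← e00, h0, one_mul, ← isInt_iff_nrm,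
          isInt_algebraMap] at this
        exact this
      obtain ⟨j, hj⟩ := exists_nat_norm_sub_lt hγ
      refine ⟨some j, (Kmax p d).mul_mem ((Kmax p d).inv_mem (hx (some j))) hh, ?_⟩
      change IsP (ent ((lowerF p d (j : ℕ))⁻¹ * h) 1 0)
      rw [ent_lowerF_inv_mul, e10, e00]
      have e : y⁻¹ * algebraMap ℚ_[p] (Lv p d) γ - algebraMap _ _ ((j : ℕ) : ℚ_[p]) * y⁻¹ =
          y⁻¹ * algebraMap _ _ (γ - (j : ℕ)) := by rw [map_sub]; ring
      rw [e, ← e00]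
      exact (hh 0 0).mul_isP (isP_algebraMap.2 hj)
  · intro i b hb
    exact (Kmax p d).mul_mem (hx i) hb.1
  · rintro (_ | i) (_ | j) ⟨-, h⟩
    · rfl
    · change IsP (ent ((weylF p d)⁻¹ * lowerF p d (j : ℕ)) 1 0) at h
      rw [ent_weylF_inv_mul] at h
      exact absurd h not_isP_one
    · change IsP (ent ((lowerF p d (i : ℕ))⁻¹ * weylF p d) 1 0) at h
      rw [ent_lowerF_inv_mul] at h
      have : IsP (-1 : Lv p d) := by simpa [weylF] using h
      exact absurd (by simpa using this.neg) (not_isP_one (p := p) (d := d))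
    · change IsP (ent ((lowerF p d (i : ℕ))⁻¹ * lowerF p d (j : ℕ)) 1 0) at h
      rw [ent_lowerF_inv_mul] at h
      have h' : IsP (algebraMap ℚ_[p] (Lv p d) (((j : ℕ) : ℚ_[p]) - (i : ℕ))) := by
        rw [map_sub]
        simpa [lowerF] using h
      rw [fin_eq_of_norm_lt (isP_algebraMap.1 h')]

/-- The diagonal element `diag(u⁻¹, ū)` of `U(1,1)`. -/
def diagF (u : Lv p d) (hu : u ≠ 0) : F1 p d :=
  ofEnt !![u⁻¹, 0; 0, star u] (by
    rw [U11_iff]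
    have : star u⁻¹ * star u = 1 := by rw [← star_mul', inv_mul_cancel₀ hu, star_one]
    simpa using this)

lemma diagF_mem_K1 {u : Lv p d} (hu : u ≠ 0) (h1 : nrm u = 1) : diagF u hu ∈ K1 p d := by
  refine ⟨fun i j => ?_, IsP.zero⟩
  fin_cases i <;> fin_cases j
  · exact isInt_iff_nrm.2 (by simp [diagF, h1])
  · exact IsInt.zero
  · exact IsInt.zero
  · exact isInt_iff_nrm.2 (by simp [diagF, h1])

/-- The remaining entries are built from `h 0 0` and the `p`-adic parameters `β, γ`, so only the
upper left entry can obstruct. -/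
lemma mem_K0_of_mem_K1 {h : F1 p d} (hh : h ∈ K1 p d) (h0 : IsO (ent h 0 0)) : h ∈ K0 p d := by
  have h1 := (K1_nrm hh).1
  have ha : ent h 0 0 ≠ 0 := fun e => by simp [e] at h1
  obtain ⟨y, β, γ, hy, e00, e01, e10, e11⟩ := exists_cell_ent ha
  have hβ : IsO (algebraMap ℚ_[p] (Lv p d) β) := by
    have := hh.1 0 1
    rw [e01, isInt_iff_nrm, nrm_mul, ← e00, h1, one_mul, ← isInt_iff_nrm, isInt_algebraMap] at this
    exact isO_algebraMap.2 this
  have hy' : IsO y := by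
    have := h0.inv h1
    rwa [e00, inv_inv] at this
  have h10 := hh.2
  refine ⟨fun i j => ?_, h10⟩
  fin_cases i <;> fin_cases j
  · exact h0
  · change IsO (ent h 0 1)
    rw [e01, ← e00]
    exact h0.mul hβ
  · exact h10.isO
  · change IsO (ent h 1 1)
    rw [e11, ← e10]
    exact hy'.star.add (h10.isO.mul hβ)

lemma ent_diagF_inv_mul {u : Lv p d} (hu : u ≠ 0) (h : F1 p d) :
    ent ((diagF u hu)⁻¹ * h) 0 0 = u * ent h 0 0 := by
  rw [ent_mul_apply, ent_inv]
  simp [diagF]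

/-- By `mem_K0_of_mem_K1` the cosets correspond to units of `ℤ_{L,p}` modulo units of `O`, that is
to `𝔽_{p²}ˣ/𝔽_pˣ`, with representatives given by `1` and `j + √-d` for `0 ≤ j < p`. -/
lemma measure_K1 (μ : Measure (F1 p d)) [μ.IsMulLeftInvariant] :
    μ (K1 p d) = (p + 1) * μ (K0 p d) := by
  have hu : ∀ j : Fin p, nrm (⟨((j : ℕ) : ℚ_[p]), 1⟩ : Lv p d) = 1 := fun j => by
    have : ‖((j : ℕ) : ℚ_[p])‖ ≤ 1 := by simpa using Padic.norm_int_le_one (p := p) (j : ℕ)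
    rw [nrm_eq_max]
    simp [this]
  have hu0 : ∀ j : Fin p, (⟨((j : ℕ) : ℚ_[p]), 1⟩ : Lv p d) ≠ 0 := fun j e => by
    have := hu j
    simp [e] at this
  let x : Option (Fin p) → F1 p d := fun o => o.elim 1 fun j => diagF _ (hu0 j)
  have hx : ∀ i, x i ∈ K1 p d := by
    rintro (_ | j)
    · exact (K1 p d).one_mem
    · exact diagF_mem_K1 (hu0 j) (hu j)
  rw [measure_eq_card_mul μ (A := (K1 p d : Set (F1 p d))) (B := K0 p d) isOpen_K0.measurableSet x]
  · simp
  · intro h hh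
    by_cases h0 : IsO (ent h 0 0)
    · exact ⟨none, by simpa [x] using mem_K0_of_mem_K1 hh h0⟩
    · set z := ent h 0 0 with hz
      have hzI : IsInt z := hh.1 0 0
      have him : ‖z.im‖ = 1 := le_antisymm hzI.2 (not_lt.1 fun hlt => h0 ⟨hzI.1, hlt⟩)
      have him0 : z.im ≠ 0 := fun e => by simp [e] at him
      -- The imaginary part of `(j + √-d) z` is `j z.im + z.re`, so this residue brings the product
      -- into `O`.
      obtain ⟨j, hj⟩ := exists_nat_norm_sub_lt (x := -(z.re / z.im)) (by
        rw [norm_neg, norm_div, him, div_one]; exact hzI.1)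
      refine ⟨some j, mem_K0_of_mem_K1 ((K1 p d).mul_mem ((K1 p d).inv_mem (hx _)) hh) ?_⟩
      change IsO (ent ((diagF _ (hu0 j))⁻¹ * h) 0 0)
      rw [ent_diagF_inv_mul]
      have hI : IsInt (⟨((j : ℕ) : ℚ_[p]), 1⟩ : Lv p d) := isInt_iff_nrm.2 (hu j).le
      refine ⟨(hI.mul hzI).1, ?_⟩
      have e : ((⟨((j : ℕ) : ℚ_[p]), 1⟩ : Lv p d) * z).im = -z.im * (-(z.re / z.im) - (j : ℕ)) := by
        rw [QuadraticAlgebra.im_mul]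
        field_simp
        ring
      rw [← hz, e, norm_mul, norm_neg, him, one_mul]
      exact hj
  · intro i b hb
    exact (K1 p d).mul_mem (hx i) (K0_le_K1 hb)
  · rintro (_ | i) (_ | j) ⟨h, -⟩
    · rfl
    · have h' := h 0 0
      change IsO (ent ((1 : F1 p d)⁻¹ * diagF _ (hu0 j)) 0 0) at h'
      rw [inv_one, one_mul] at h'
      have h2 : IsO (⟨((j : ℕ) : ℚ_[p]), 1⟩ : Lv p d) := by
        have := h'.inv (by simp [diagF, hu])
        simpa [diagF] using this
      exact absurd h2.2 (by simp)
    · have h' := h 0 0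
      change IsO (ent ((diagF _ (hu0 i))⁻¹ * (1 : F1 p d)) 0 0) at h'
      rw [ent_diagF_inv_mul] at h'
      have h2 : IsO (⟨((i : ℕ) : ℚ_[p]), 1⟩ : Lv p d) := by simpa using h'
      exact absurd h2.2 (by simp)
    · have h' := h 0 0
      change IsO (ent ((diagF _ (hu0 i))⁻¹ * diagF _ (hu0 j)) 0 0) at h'
      rw [ent_diagF_inv_mul] at h'
      set ui : Lv p d := ⟨((i : ℕ) : ℚ_[p]), 1⟩ with hui
      set uj : Lv p d := ⟨((j : ℕ) : ℚ_[p]), 1⟩ with huj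
      have h2 : IsO (ui * uj⁻¹) := h'
      have h3 : IsO (ui * star uj) := by
        have e : ui * star uj = ui * uj⁻¹ * algebraMap _ _ (QuadraticAlgebra.norm uj) := by
          rw [QuadraticAlgebra.algebraMap_norm_eq_mul_star, mul_assoc, inv_mul_cancel_left₀ (hu0 j)]
        rw [e]
        refine h2.mul (isO_algebraMap.2 ?_)
        exact (hu j).le
      have h4 := h3.2
      rw [QuadraticAlgebra.im_mul] at h4
      simp [hui, huj] at h4
      rw [neg_add_eq_sub] at h4
      rw [fin_eq_of_norm_lt h4]

lemma measureReal_K0 (μ : Measure (F1 p d)) [μ.IsMulLeftInvariant] (hμ : μ (KF1 p d) = 1) :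
    μ.real (K0 p d) = 1 / ((p : ℝ) + 1) ^ 2 := by
  have h : (KF1 p d : Set (F1 p d)) = Kmax p d := by
    ext; exact mem_KF1_iff
  rw [h, measure_Kmax, measure_K1] at hμ
  have := congrArg ENNReal.toReal hμ
  rw [ENNReal.toReal_mul, ENNReal.toReal_mul, ENNReal.toReal_add (by simp) (by simp)] at this
  simp at this
  rw [Measure.real, eq_div_iff (by positivity)]
  linarith

end volume

/-! ## Integrals of functions that transform by a character of an open subgroup -/

/-- On a coset `yB`, left translation by `y κ₀ y⁻¹` preserves the coset and multiplies `F` by `χ κ₀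
≠ 1`, so left invariance alone kills the integral there. Countably many cosets meet the support, and
integrability permits summing over them. -/
lemma integral_eq_zero_of_character {G ι : Type*} [Group G] [MeasurableSpace G] [MeasurableMul G]
    [Countable ι] (μ : Measure G) [μ.IsMulLeftInvariant] {B : Subgroup G}
    (hB : MeasurableSet (B : Set G)) {F : G → ℂ} (hF : Integrable F μ) {χ : G → ℂ}
    (hχ : ∀ x, ∀ κ ∈ B, F (x * κ) = χ κ * F x) {κ₀ : G} (hκ₀ : κ₀ ∈ B) (hne : χ κ₀ ≠ 1)
    (x : ι → G) (hcov : ∀ h, F h ≠ 0 → ∃ i, (x i)⁻¹ * h ∈ B) : ∫ h, F h ∂μ = 0 := by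
  let T : Set (G ⧸ B) := Set.range fun i => (x i : G ⧸ B)
  have hT : T.Countable := Set.countable_range _
  have : Countable T := hT.to_subtype
  let s : T → Set G := fun q => (QuotientGroup.mk : G → G ⧸ B) ⁻¹' {q.1}
  have hs : ∀ q : T, ∃ y : G, s q = (fun h => y⁻¹ * h) ⁻¹' B := by
    intro q
    obtain ⟨y, hy⟩ := QuotientGroup.mk_surjective q.1
    refine ⟨y, ?_⟩
    ext h
    simp only [s, Set.mem_preimage, Set.mem_singleton_iff, SetLike.mem_coe]
    rw [← hy, eq_comm, QuotientGroup.eq]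
  have hmeas : ∀ q, MeasurableSet (s q) := fun q => by
    obtain ⟨y, hy⟩ := hs q
    rw [hy]
    exact hB.preimage (measurable_const_mul _)
  have hdisj : Pairwise (Function.onFun Disjoint s) := by
    intro q q' hqq'
    refine Set.disjoint_left.2 fun h h1 h2 => hqq' (Subtype.ext ?_)
    exact (Set.mem_singleton_iff.1 h1).symm.trans (Set.mem_singleton_iff.1 h2)
  have hU : ∫ h in ⋃ q, s q, F h ∂μ = ∫ h, F h ∂μ := by
    refine setIntegral_eq_integral_of_forall_compl_eq_zero fun h hh => ?_
    by_contra hne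
    obtain ⟨i, hi⟩ := hcov h hne
    refine hh (Set.mem_iUnion.2 ⟨⟨_, i, rfl⟩, ?_⟩)
    exact (QuotientGroup.eq.2 hi).symm
  rw [← hU, integral_iUnion hmeas hdisj hF.integrableOn]
  refine (tsum_congr fun q => ?_).trans tsum_zero
  obtain ⟨y, hy⟩ := hs q
  rw [← integral_indicator (hmeas q)]
  set f : G → ℂ := (s q).indicator F with hf
  have key : ∀ h, f (y * κ₀ * y⁻¹ * h) = χ κ₀ * f h := by
    intro h
    have hiff : y * κ₀ * y⁻¹ * h ∈ s q ↔ h ∈ s q := by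
      rw [hy]
      simp only [Set.mem_preimage, SetLike.mem_coe]
      rw [show y⁻¹ * (y * κ₀ * y⁻¹ * h) = κ₀ * (y⁻¹ * h) by group]
      exact B.mul_mem_cancel_left hκ₀
    by_cases hh : h ∈ s q
    · rw [hf, Set.indicator_of_mem hh, Set.indicator_of_mem (hiff.2 hh)]
      rw [hy] at hh
      have h1 : F h = χ (y⁻¹ * h) * F y := by rw [← hχ y _ hh]; congr 1; group
      have h2 : F (y * κ₀ * y⁻¹ * h) = χ (y⁻¹ * h) * F (y * κ₀) := by
        rw [← hχ _ _ hh]; congr 1; group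
      rw [h2, h1, hχ y κ₀ hκ₀]
      ring
    · rw [hf, Set.indicator_of_notMem hh, Set.indicator_of_notMem (hiff.not.2 hh), mul_zero]
  have h1 : ∫ h, f h ∂μ = χ κ₀ * ∫ h, f h ∂μ := by
    calc ∫ h, f h ∂μ = ∫ h, f (y * κ₀ * y⁻¹ * h) ∂μ := (integral_mul_left_eq_self f _).symm
      _ = _ := by simp_rw [key]; exact integral_const_mul _ _
  have h2 : (χ κ₀ - 1) * ∫ h, f h ∂μ = 0 := by linear_combination -h1
  exact (mul_eq_zero.1 h2).resolve_left (sub_ne_zero.2 hne)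

/-! ## The part of the integrand supported off `K0` -/

section transform
variable [hin : Fact (legendreSym p (-d) = -1)]
  {Λ : (Lv p d)ˣ →* Circle} {W : Ft p d → ℂ} {g : Ft p d} {s : ℂ}

lemma exists_K1_cell {κ : F1 p d} (hκ : κ ∈ K1 p d) :
    ∃ (z : Lv p d) (β γ : ℚ_[p]), z ≠ 0 ∧ nrm z = 1 ∧ ‖β‖ ≤ 1 ∧ ‖γ‖ < 1 ∧ ent κ 0 0 = z⁻¹ ∧
      ent κ 0 1 = z⁻¹ * algebraMap _ _ β ∧ ent κ 1 0 = z⁻¹ * algebraMap _ _ γ ∧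
      IsInt (ent κ 1 1) ∧ ent κ 1 1 = star z + z⁻¹ * algebraMap _ _ γ * algebraMap _ _ β := by
  have h1 := (K1_nrm hκ).1
  have ha : ent κ 0 0 ≠ 0 := fun e => by simp [e] at h1
  obtain ⟨z, β, γ, hz, e00, e01, e10, e11⟩ := exists_cell_ent ha
  refine ⟨z, β, γ, hz, ?_, ?_, ?_, e00, e01, e10, hκ.1 1 1, e11⟩
  · rwa [e00, nrm_inv, inv_eq_one] at h1
  · have := hκ.1 0 1
    rwa [e01, isInt_iff_nrm, nrm_mul, ← e00, h1, one_mul, ← isInt_iff_nrm, isInt_algebraMap] at this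
  · have := hκ.2
    rwa [e10, isP_iff_nrm, nrm_mul, ← e00, h1, one_mul, ← isP_iff_nrm, isP_algebraMap] at this

/-- The effect of right translation by `K1` on the support condition and the upper left entry. -/
lemma supp_mul {h κ : F1 p d} (hh : Supp IsP (ent h)) (hκ : κ ∈ K1 p d) :
    Supp IsP (ent (h * κ)) ∧ ∃ r : ℚ_[p], ‖r‖ = 1 ∧
      ent (h * κ) 0 0 = ent h 0 0 * ent κ 0 0 * algebraMap _ _ r := by
  obtain ⟨ha, hP, hc, hb⟩ := hh
  obtain ⟨y, β, γ, hy, e00, e01, e10, e11⟩ := exists_cell_ent ha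
  obtain ⟨z, β', γ', hz, hz1, hβ', hγ', k00, k01, k10, k11I, k11⟩ := exists_K1_cell hκ
  have hy' : y⁻¹ ≠ 0 := inv_ne_zero hy
  have hz' : z⁻¹ ≠ 0 := inv_ne_zero hz
  have hβ : ‖β‖ ≤ 1 := by
    rw [e01, e00, mul_div_cancel_left₀ _ hy', isInt_algebraMap] at hb; exact hb
  have hγ : ‖γ‖ < 1 := by
    rw [e10, e00, mul_div_cancel_left₀ _ hy', isP_algebraMap] at hc; exact hc
  rw [e00, inv_inv] at hP
  -- The new upper left entry differs from the product of the old ones by `1 + βγ'`, a unit of `ℤ_p`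
  -- and thus invisible to both `nrm` and `Λ`.
  have hr : ‖1 + β * γ'‖ = 1 := by
    rw [IsUltrametricDist.norm_add_eq_max_of_norm_ne_norm]
    · rw [norm_one, max_eq_left (padic_mul_lt_right hβ hγ').le]
    · rw [norm_one]; exact (padic_mul_lt_right hβ hγ').ne'
  have hr0 : (1 + β * γ') ≠ 0 := fun e => by simp [e] at hr
  have hR0 : algebraMap ℚ_[p] (Lv p d) (1 + β * γ') ≠ 0 := by
    rwa [Ne, ← map_zero (algebraMap ℚ_[p] (Lv p d)), QuadraticAlgebra.algebraMap_inj]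
  have hRi : IsInt (algebraMap ℚ_[p] (Lv p d) (1 + β * γ'))⁻¹ := by
    rw [isInt_iff_nrm, nrm_inv, nrm_algebraMap, hr]; simp
  have hR : algebraMap ℚ_[p] (Lv p d) (1 + β * γ') =
      1 + algebraMap _ _ β * algebraMap _ _ γ' := by simp
  have m00 : ent (h * κ) 0 0 = y⁻¹ * z⁻¹ * algebraMap _ _ (1 + β * γ') := by
    rw [ent_mul_apply, e00, e01, k00, k10, hR]; ring
  have hzI : IsInt z := isInt_iff_nrm.2 hz1.le
  refine ⟨⟨?_, ?_, ?_, ?_⟩, 1 + β * γ', hr, by rw [m00, e00, k00]⟩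
  · rw [m00]
    exact mul_ne_zero (mul_ne_zero hy' hz') hR0
  · rw [m00, mul_inv, mul_inv, inv_inv, inv_inv]
    exact (hP.mul_int hzI).mul_int hRi
  · have e : ent (h * κ) 1 0 / ent (h * κ) 0 0 = (algebraMap _ _ γ +
        (y * star y + algebraMap _ _ γ * algebraMap _ _ β) * algebraMap _ _ γ') *
        (algebraMap _ _ (1 + β * γ'))⁻¹ := by
      rw [div_eq_iff (by rw [m00]; exact mul_ne_zero (mul_ne_zero hy' hz') hR0), m00, ent_mul_apply,
        e10, e11, k00, k10]
      field_simp
    rw [e]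
    have hγP : IsP (algebraMap ℚ_[p] (Lv p d) γ) := isP_algebraMap.2 hγ
    have hγP' : IsP (algebraMap ℚ_[p] (Lv p d) γ') := isP_algebraMap.2 hγ'
    exact (hγP.add (((hP.isInt.mul hP.isInt.star).add
      (hγP.isInt.mul (isInt_algebraMap.2 hβ))).mul_isP hγP')).mul_int hRi
  · have e : ent (h * κ) 0 1 / ent (h * κ) 0 0 = (algebraMap _ _ β' +
        algebraMap _ _ β * ent κ 1 1 * z) * (algebraMap _ _ (1 + β * γ'))⁻¹ := by
      rw [div_eq_iff (by rw [m00]; exact mul_ne_zero (mul_ne_zero hy' hz') hR0), m00, ent_mul_apply,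
        e00, e01, k01]
      field_simp
    rw [e]
    exact ((isInt_algebraMap.2 hβ').add (((isInt_algebraMap.2 hβ).mul k11I).mul hzI)).mul hRi

lemma cellFn_eq (h : F1 p d) : cellFn Λ W g s h =
    ((nrm (ent h 0 0)⁻¹ : ℝ) : ℂ) ^ (3 * (s + 1 / 2)) * charZ Λ (ent h 0 0)⁻¹ *
      W (g * Subgroup.inclusion (U_le_GU _) h) := rfl

lemma suppFn_mul (hΛ : ∀ x : ℚ_[p]ˣ, Λ (baseUnits p d x) = 1)
    (hWK : ∀ (h : Ft p d), ∀ κ ∈ K1 p d, W (h * Subgroup.inclusion (U_le_GU _) κ) = W h)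
    (h : F1 p d) {κ : F1 p d} (hκ : κ ∈ K1 p d) :
    suppFn IsP Λ W g s (h * κ) = (charZ Λ (ent κ 0 0))⁻¹ * suppFn IsP Λ W g s h := by
  by_cases hh : Supp IsP (ent h)
  · obtain ⟨h1, r, hr, e⟩ := supp_mul hh hκ
    rw [suppFn, Set.indicator_of_mem (by exact h1), Set.indicator_of_mem (by exact hh), cellFn_eq,
      cellFn_eq, e, map_mul, ← mul_assoc g, hWK _ κ hκ]
    have hr0 : r ≠ 0 := fun e => by simp [e] at hr
    simp only [nrm_inv, nrm_mul, (K1_nrm hκ).1, nrm_algebraMap, hr, charZ_inv, charZ_mul,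
      charZ_algebraMap hΛ hr0]
    simp only [one_pow, mul_one, mul_inv]
    ring
  · have h1 : ¬ Supp IsP (ent (h * κ)) := fun h1 => hh (by
      have := (supp_mul h1 ((K1 p d).inv_mem hκ)).1
      rwa [mul_inv_cancel_right] at this)
    rw [suppFn, Set.indicator_of_notMem (by exact h1), Set.indicator_of_notMem (by exact hh),
      mul_zero]

/-- The dichotomy is on `y = (h 0 0)⁻¹`: either it is a unit of the order, and then all entries are
integral, or it lies in `pℤ_{L,p}`. -/
lemma supp_isO_iff {h : F1 p d} : Supp IsO (ent h) ↔ h ∈ K0 p d ∨ Supp IsP (ent h) := by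
  constructor
  · rintro ⟨ha, hO, hc, hb⟩
    rcases hO.nrm_lt_or_eq with h1 | h1
    · left
      have h00 : IsO (ent h 0 0) := by simpa using hO.inv h1
      obtain ⟨y, β, γ, hy, e00, e01, e10, e11⟩ := exists_cell_ent ha
      have hy' : y⁻¹ ≠ 0 := inv_ne_zero hy
      rw [e01, e00, mul_div_cancel_left₀ _ hy', isInt_algebraMap] at hb
      rw [e10, e00, mul_div_cancel_left₀ _ hy', isP_algebraMap] at hc
      have hβ : IsInt (algebraMap ℚ_[p] (Lv p d) β) := isInt_algebraMap.2 hb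
      have hγ : IsP (algebraMap ℚ_[p] (Lv p d) γ) := isP_algebraMap.2 hc
      have h10 : IsP (ent h 1 0) := by
        rw [e10, ← e00]; exact h00.isInt.mul_isP hγ
      refine mem_K0_of_mem_K1 ⟨fun i j => ?_, h10⟩ h00
      rw [e00, inv_inv] at hO
      fin_cases i <;> fin_cases j
      · exact h00.isInt
      · change IsInt (ent h 0 1)
        rw [e01, ← e00]; exact h00.isInt.mul hβ
      · exact h10.isInt
      · change IsInt (ent h 1 1)
        rw [e11, ← e10]; exact hO.isInt.star.add (h10.isInt.mul hβ)
    · exact .inr ⟨ha, h1, hc, hb⟩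
  · rintro (hh | ⟨ha, hO, hc, hb⟩)
    · have h1 := (K1_nrm (K0_le_K1 hh)).1
      have ha : ent h 0 0 ≠ 0 := fun e => by simp [e] at h1
      have hi := (hh.1 0 0).inv h1
      refine ⟨ha, hi, ?_, ?_⟩
      · rw [div_eq_mul_inv]; exact hh.2.mul_int hi.isInt
      · rw [div_eq_mul_inv]; exact (hh.1 0 1).isInt.mul hi.isInt
    · exact ⟨ha, hO.isO, hc, hb⟩

lemma suppFn_isO (hΛ0 : ∀ u ∈ Gamma0L p d, Λ u = 1)
    (hWK : ∀ (h : Ft p d), ∀ κ ∈ K1 p d, W (h * Subgroup.inclusion (U_le_GU _) κ) = W h) :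
    suppFn IsO Λ W g s =
      Set.indicator (K0 p d : Set (F1 p d)) (fun _ => W g) + suppFn IsP Λ W g s := by
  funext h
  rw [Pi.add_apply]
  by_cases h0 : h ∈ K0 p d
  · have h1 := (K1_nrm (K0_le_K1 h0)).1
    have h2 : ¬ Supp IsP (ent h) := fun h2 => by
      have := h2.2.1
      rw [isP_iff_nrm, nrm_inv, h1, inv_one] at this
      exact lt_irrefl _ this
    rw [suppFn, Set.indicator_of_mem (by exact supp_isO_iff.2 (.inl h0)),
      Set.indicator_of_mem (by exact h0), suppFn, Set.indicator_of_notMem (by exact h2), cellFn_eq,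
      nrm_inv, h1, charZ_inv, charZ_unitO hΛ0 (h0.1 0 0) h1, hWK g h (K0_le_K1 h0)]
    simp
  · rw [Set.indicator_of_notMem (by exact h0), zero_add]
    by_cases h2 : Supp IsP (ent h)
    · rw [suppFn, suppFn, Set.indicator_of_mem (by exact supp_isO_iff.2 (.inr h2)),
        Set.indicator_of_mem (by exact h2)]
    · rw [suppFn, suppFn, Set.indicator_of_notMem, Set.indicator_of_notMem (by exact h2)]
      exact fun h3 => (supp_isO_iff.1 h3).elim h0 h2

/-! ## Convergence and vanishing -/

lemma padic_ne_zero : (p : ℚ_[p]) ≠ 0 := by exact_mod_cast (Fact.out : p.Prime).ne_zero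

/-- The diagonal element with upper left entry `p^(-m)`. -/
def diagP (p : ℕ) [Fact p.Prime] (d : ℤ) [Fact (legendreSym p (-d) = -1)] (m : ℕ) : F1 p d :=
  diagF (algebraMap ℚ_[p] _ ((p : ℚ_[p]) ^ m)) (by
    rw [Ne, ← map_zero (algebraMap ℚ_[p] (Lv p d)), QuadraticAlgebra.algebraMap_inj]
    exact pow_ne_zero _ padic_ne_zero)

/-- Representatives for the left cosets of `K1` in the support. -/
def cosetRep (p : ℕ) [Fact p.Prime] (d : ℤ) [Fact (legendreSym p (-d) = -1)] (m j : ℕ) : F1 p d :=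
  lowerF p d (p * j) * diagP p d m

lemma ent_cosetRep (m j : ℕ) :
    ent (cosetRep p d m j) 0 0 = (algebraMap _ _ ((p : ℚ_[p]) ^ m))⁻¹ := by
  rw [cosetRep, ent_mul_apply]
  simp [lowerF, diagP, diagF]

lemma exists_appr {x : ℚ_[p]} (hx : ‖x‖ ≤ 1) (n : ℕ) :
    ∃ j < p ^ n, ‖x - (j : ℕ)‖ ≤ ‖(p : ℚ_[p]) ^ n‖ := by
  refine ⟨PadicInt.appr ⟨x, hx⟩ n, PadicInt.appr_lt _ _, ?_⟩
  have := (PadicInt.norm_le_pow_iff_mem_span_pow _ n).2 (PadicInt.appr_spec n ⟨x, hx⟩)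
  rw [PadicInt.norm_def] at this
  rw [norm_pow, Padic.norm_p, inv_pow, ← zpow_natCast, ← _root_.zpow_neg]
  exact this

lemma exists_cosetRep {h : F1 p d} (hh : Supp IsP (ent h)) :
    ∃ m, ∃ j < p ^ (2 * m), (cosetRep p d m j)⁻¹ * h ∈ K1 p d := by
  obtain ⟨ha, hP, hc, hb⟩ := hh
  obtain ⟨y, β, γ, hy, e00, e01, e10, e11⟩ := exists_cell_ent ha
  have hy' : y⁻¹ ≠ 0 := inv_ne_zero hy
  rw [e01, e00, mul_div_cancel_left₀ _ hy', isInt_algebraMap] at hb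
  rw [e10, e00, mul_div_cancel_left₀ _ hy', isP_algebraMap] at hc
  rw [e00, inv_inv] at hP
  have hp0 := padic_ne_zero (p := p)
  -- As `p` is inert it is a uniformizer of `L_p`, so `y` is `p^m` times a unit.
  obtain ⟨m, hm⟩ : ∃ m : ℕ, nrm y = ‖(p : ℚ_[p]) ^ m‖ ^ 2 := by
    obtain ⟨r, hr, hry⟩ : ∃ r : ℚ_[p], r ≠ 0 ∧ nrm y = ‖r‖ ^ 2 := by
      have h0 := nrm_pos hy
      rw [nrm_eq_max] at h0 ⊢
      rcases max_cases ‖y.re‖ ‖y.im‖ with ⟨e, -⟩ | ⟨e, -⟩ <;> rw [e] at h0 ⊢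
      · exact ⟨y.re, fun e => by simp [e] at h0, rfl⟩
      · exact ⟨y.im, fun e => by simp [e] at h0, rfl⟩
    have hr1 : ‖r‖ < 1 := by
      have h1 := isP_iff_nrm.1 hP
      rw [hry] at h1
      exact (sq_lt_one_iff₀ (norm_nonneg _)).1 h1
    have hv := Padic.norm_eq_zpow_neg_valuation hr
    have hv0 : 0 ≤ r.valuation := (Padic.norm_le_one_iff_val_nonneg r).1 hr1.le
    refine ⟨r.valuation.toNat, ?_⟩
    have hv1 : ((r.valuation.toNat : ℕ) : ℤ) = r.valuation := Int.toNat_of_nonneg hv0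
    rw [hry, norm_pow, Padic.norm_p, hv, inv_pow, ← hv1, _root_.zpow_neg, zpow_natCast,
      Int.toNat_natCast]
  -- The exponent `2m` comes from the lower left entry `P⁻¹ y⁻¹ (γ - p j)` of the quotient, where `P
  -- = p^m`: it lies in `pℤ_{L,p}` once `|γ - p j| < nrm y = p^(-2m)`.
  obtain ⟨j, hj, hjn⟩ : ∃ j < p ^ (2 * m), ‖γ - p * (j : ℕ)‖ ≤ ‖(p : ℚ_[p]) * p ^ (2 * m)‖ := by
    obtain ⟨j, hj, hjn⟩ := exists_appr (x := γ / (p : ℚ_[p])) (by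
      have h1 : ‖γ‖ ≤ (p : ℝ) ^ (-1 : ℤ) := by
        rw [Padic.norm_le_pow_iff_norm_lt_pow_add_one]; simpa using hc
      have hp' : (0 : ℝ) < p := by exact_mod_cast (Fact.out : p.Prime).pos
      rw [norm_div, Padic.norm_p, div_inv_eq_mul]
      calc ‖γ‖ * p ≤ (p : ℝ) ^ (-1 : ℤ) * p := by gcongr
        _ = 1 := by rw [_root_.zpow_neg_one, inv_mul_cancel₀ hp'.ne']) (2 * m)
    refine ⟨j, hj, ?_⟩
    have e : γ - p * (j : ℕ) = p * (γ / (p : ℚ_[p]) - (j : ℕ)) := by field_simp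
    rw [e, norm_mul, norm_mul]
    gcongr
  refine ⟨m, j, hj, ?_⟩
  set P : Lv p d := algebraMap ℚ_[p] _ ((p : ℚ_[p]) ^ m) with hPdef
  have hPs : star P = P := star_algebraMap_padic _
  have hP0 : P ≠ 0 := by
    rw [hPdef, Ne, ← map_zero (algebraMap ℚ_[p] (Lv p d)), QuadraticAlgebra.algebraMap_inj]
    exact pow_ne_zero _ hp0
  set J : Lv p d := algebraMap ℚ_[p] _ ((p : ℚ_[p]) * (j : ℕ)) with hJ
  have hJs : star J = J := star_algebraMap_padic _
  have ec : ent (cosetRep p d m j) = !![P⁻¹, 0; J * P⁻¹, P] := by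
    ext i l : 1
    rw [cosetRep, ent_mul_apply]
    fin_cases i <;> fin_cases l <;> simp [lowerF, diagP, diagF, ← hPdef, ← hJ, hPs]
  have hnP : nrm P = nrm y := by rw [hPdef, nrm_algebraMap, hm]
  have hny := nrm_pos hy
  have hG : IsP (P⁻¹ * y⁻¹ * algebraMap _ _ (γ - p * (j : ℕ))) := by
    rw [isP_iff_nrm, nrm_mul, nrm_mul, nrm_inv, nrm_inv, hnP, nrm_algebraMap]
    have h1 : ‖γ - p * (j : ℕ)‖ ≤ ‖(p : ℚ_[p])‖ * nrm y := by
      refine hjn.trans_eq ?_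
      rw [hm, norm_mul, mul_comm 2 m, pow_mul, norm_pow _ 2]
    have h2 : ‖γ - p * (j : ℕ)‖ < nrm y :=
      h1.trans_lt (mul_lt_of_lt_one_left hny Padic.norm_p_lt_one)
    rw [← mul_inv, ← sq, ← div_eq_inv_mul, div_lt_one (by positivity)]
    gcongr
  have hPy : IsInt (P * y⁻¹) := by
    rw [isInt_iff_nrm, nrm_mul, nrm_inv, hnP, mul_inv_cancel₀ hny.ne']
  have hβ : IsInt (algebraMap ℚ_[p] (Lv p d) β) := isInt_algebraMap.2 hb
  have q00 : ent ((cosetRep p d m j)⁻¹ * h) 0 0 = P * y⁻¹ := by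
    rw [ent_mul_apply, ent_inv, ec, e00]
    simp [hPs]
  have q01 : ent ((cosetRep p d m j)⁻¹ * h) 0 1 = P * y⁻¹ * algebraMap _ _ β := by
    rw [ent_mul_apply, ent_inv, ec, e01]
    simp [hPs, mul_assoc]
  have hPs' : star P⁻¹ = P⁻¹ := by
    rw [← mul_right_inj' hP0]
    nth_rw 1 [← hPs]
    rw [← star_mul', mul_inv_cancel₀ hP0, star_one]
  have hG' : P⁻¹ * y⁻¹ * algebraMap ℚ_[p] (Lv p d) (γ - p * (j : ℕ)) =
      P⁻¹ * y⁻¹ * (algebraMap _ _ γ - J) := by rw [map_sub]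
  rw [hG'] at hG
  have q10 : ent ((cosetRep p d m j)⁻¹ * h) 1 0 = P⁻¹ * y⁻¹ * (algebraMap _ _ γ - J) := by
    rw [ent_mul_apply, ent_inv, ec, e00, e10]
    simp only [Matrix.of_apply, Matrix.cons_val, star_mul', hPs', hJs]
    ring
  have q11 : ent ((cosetRep p d m j)⁻¹ * h) 1 1 = P⁻¹ * star y +
      P⁻¹ * y⁻¹ * (algebraMap _ _ γ - J) * algebraMap _ _ β := by
    rw [ent_mul_apply, ent_inv, ec, e01, e11]
    simp only [Matrix.of_apply, Matrix.cons_val, star_mul', hPs', hJs]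
    ring
  refine ⟨fun i l => ?_, q10 ▸ hG⟩
  fin_cases i <;> fin_cases l
  · exact q00 ▸ hPy
  · exact q01 ▸ hPy.mul hβ
  · exact q10 ▸ hG.isInt
  · refine q11 ▸ IsInt.add ?_ (hG.isInt.mul hβ)
    rw [isInt_iff_nrm, nrm_mul, nrm_inv, nrm_star, hnP, inv_mul_cancel₀ hny.ne']

end transform

section convergence
variable [hin : Fact (legendreSym p (-d) = -1)]
  {Λ : (Lv p d)ˣ →* Circle} {W : Ft p d → ℂ} {g : Ft p d} {s : ℂ}

/-- The function is constant on left cosets of the open subgroup `K0`, since `Λ` is trivial on upper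
left entries of `K0`. -/
lemma continuous_suppFn (hΛ : ∀ x : ℚ_[p]ˣ, Λ (baseUnits p d x) = 1)
    (hΛ0 : ∀ u ∈ Gamma0L p d, Λ u = 1)
    (hWK : ∀ (h : Ft p d), ∀ κ ∈ K1 p d, W (h * Subgroup.inclusion (U_le_GU _) κ) = W h) :
    Continuous (suppFn IsP Λ W g s) := by
  refine IsLocallyConstant.continuous ((IsLocallyConstant.iff_exists_open _).2 fun x => ?_)
  refine ⟨(fun h => x⁻¹ * h) ⁻¹' K0 p d, isOpen_K0.preimage (continuous_const_mul _), ?_, ?_⟩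
  · simp
  · intro h hh
    have h1 := K0_le_K1 hh
    have := suppFn_mul (g := g) (s := s) hΛ hWK x h1
    rwa [mul_inv_cancel_left, charZ_unitO hΛ0 (hh.1 0 0) (K1_nrm h1).1, inv_one, one_mul] at this

lemma norm_suppFn_le (hΛ : ∀ x : ℚ_[p]ˣ, Λ (baseUnits p d x) = 1)
    (hWK : ∀ (h : Ft p d), ∀ κ ∈ K1 p d, W (h * Subgroup.inclusion (U_le_GU _) κ) = W h)
    {C : ℝ} (hC : ∀ h, ‖W h‖ ≤ C) {m j : ℕ} {h : F1 p d}
    (hh : (cosetRep p d m j)⁻¹ * h ∈ K1 p d) :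
    ‖suppFn IsP Λ W g s h‖ ≤ C * (((p : ℝ)⁻¹ ^ 2) ^ (3 * (s.re + 1 / 2))) ^ m := by
  have hC0 : 0 ≤ C := (norm_nonneg _).trans (hC 1)
  have hp0 : (0 : ℝ) < p := by exact_mod_cast (Fact.out : p.Prime).pos
  have hP0 : algebraMap ℚ_[p] (Lv p d) ((p : ℚ_[p]) ^ m) ≠ 0 := by
    rw [Ne, ← map_zero (algebraMap ℚ_[p] (Lv p d)), QuadraticAlgebra.algebraMap_inj]
    exact pow_ne_zero _ padic_ne_zero
  have h1 := suppFn_mul (g := g) (s := s) hΛ hWK (cosetRep p d m j) hh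
  have hκ0 : ent ((cosetRep p d m j)⁻¹ * h) 0 0 ≠ 0 := fun e => by
    have := (K1_nrm hh).1
    simp [e] at this
  rw [mul_inv_cancel_left] at h1
  rw [h1, norm_mul, norm_inv, norm_charZ Λ hκ0, inv_one, one_mul]
  refine (norm_indicator_le_norm_self _ _).trans ?_
  rw [cellFn_eq, ent_cosetRep, inv_inv, norm_mul, norm_mul, norm_charZ Λ hP0, mul_one,
    Complex.norm_cpow_eq_rpow_re_of_pos (nrm_pos hP0), nrm_algebraMap, norm_pow, Padic.norm_p,
    mul_comm]
  have e1 : (3 * (s + 1 / 2)).re = 3 * (s.re + 1 / 2) := by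
    simp
  rw [e1, ← pow_mul, mul_comm m 2, pow_mul]
  have key : ∀ {x : ℝ} (t : ℝ), 0 ≤ x → (x ^ m) ^ t = (x ^ t) ^ m := fun {x} t hx => by
    rw [← Real.rpow_natCast, ← Real.rpow_mul hx, mul_comm, Real.rpow_mul hx, Real.rpow_natCast]
  rw [key _ (by positivity)]
  gcongr
  exact hC _

lemma integrable_suppFn (hΛ : ∀ x : ℚ_[p]ˣ, Λ (baseUnits p d x) = 1)
    (hΛ0 : ∀ u ∈ Gamma0L p d, Λ u = 1)
    (hWK : ∀ (h : Ft p d), ∀ κ ∈ K1 p d, W (h * Subgroup.inclusion (U_le_GU _) κ) = W h)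
    {C : ℝ} (hC : ∀ h, ‖W h‖ ≤ C) (hs : -(1 / 6 : ℝ) < s.re)
    (μ : Measure (F1 p d)) [μ.IsMulLeftInvariant] (hμ : μ (K1 p d) ≤ 1) :
    Integrable (suppFn IsP Λ W g s) μ := by
  have hC0 : 0 ≤ C := (norm_nonneg _).trans (hC 1)
  have hp1 : (1 : ℝ) < p := by exact_mod_cast (Fact.out : p.Prime).one_lt
  have hp0 : (0 : ℝ) < p := by linarith
  set r : ℝ := ((p : ℝ)⁻¹ ^ 2) ^ (3 * (s.re + 1 / 2)) with hr
  have hr0 : 0 ≤ r := by positivity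
  refine ⟨(continuous_suppFn hΛ hΛ0 hWK).aestronglyMeasurable, ?_⟩
  let A : (Σ m : ℕ, Fin (p ^ (2 * m))) → Set (F1 p d) := fun i =>
    (fun h => (cosetRep p d i.1 i.2)⁻¹ * h) ⁻¹' K1 p d
  have hA : ∀ h, h ∉ ⋃ i, A i → ‖suppFn IsP Λ W g s h‖ₑ = 0 := by
    intro h hh
    rw [suppFn, Set.indicator_of_notMem, enorm_zero]
    intro h1
    obtain ⟨m, j, hj, hmj⟩ := exists_cosetRep h1
    exact hh (Set.mem_iUnion.2 ⟨⟨m, ⟨j, hj⟩⟩, hmj⟩)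
  have hmeas : ∀ i, MeasurableSet (A i) := fun i =>
    (isOpen_K1.preimage (continuous_const_mul _)).measurableSet
  have hb : ∀ i, ∫⁻ h in A i, ‖suppFn IsP Λ W g s h‖ₑ ∂μ ≤ ENNReal.ofReal (C * r ^ i.1) := by
    intro i
    calc ∫⁻ h in A i, ‖suppFn IsP Λ W g s h‖ₑ ∂μ
        ≤ ∫⁻ h in A i, ENNReal.ofReal (C * r ^ i.1) ∂μ := by
          refine setLIntegral_mono' (hmeas i) fun h hh => ?_
          rw [← ofReal_norm]
          exact ENNReal.ofReal_le_ofReal (norm_suppFn_le hΛ hWK hC hh)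
      _ = ENNReal.ofReal (C * r ^ i.1) * μ (K1 p d) := by
          rw [setLIntegral_const, measure_preimage_mul]
      _ ≤ _ := mul_le_of_le_one_right' hμ
  have hsum : Summable fun m : ℕ => (p : ℝ) ^ (2 * m) * (C * r ^ m) := by
    have e : (fun m : ℕ => (p : ℝ) ^ (2 * m) * (C * r ^ m)) = fun m => C * (p ^ 2 * r) ^ m := by
      funext m; rw [pow_mul, mul_pow]; ring
    rw [e]
    refine (summable_geometric_of_lt_one (by positivity) ?_).mul_left C
    have hq : (0 : ℝ) < (p : ℝ)⁻¹ ^ 2 := by positivity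
    have e2 : (p : ℝ) ^ 2 = ((p : ℝ)⁻¹ ^ 2) ^ (-1 : ℝ) := by
      rw [Real.rpow_neg_one, inv_pow, inv_inv]
    -- The ratio is `(p⁻²)^(-1 + 3(Re s + 1/2))`; it is less than `1` exactly when `Re s > -1/6`.
    rw [e2, hr, ← Real.rpow_add hq]
    refine Real.rpow_lt_one hq.le ?_ (by linarith)
    exact pow_lt_one₀ (by positivity) (inv_lt_one_of_one_lt₀ hp1) (by norm_num)
  calc ∫⁻ h, ‖suppFn IsP Λ W g s h‖ₑ ∂μ
      = ∫⁻ h in ⋃ i, A i, ‖suppFn IsP Λ W g s h‖ₑ ∂μ := by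
        rw [← lintegral_indicator (MeasurableSet.iUnion hmeas)]
        refine lintegral_congr fun h => ?_
        by_cases hh : h ∈ ⋃ i, A i
        · rw [Set.indicator_of_mem hh]
        · rw [Set.indicator_of_notMem hh, hA h hh]
    _ ≤ ∑' i, ∫⁻ h in A i, ‖suppFn IsP Λ W g s h‖ₑ ∂μ := lintegral_iUnion_le _ _
    _ ≤ ∑' i : (Σ m : ℕ, Fin (p ^ (2 * m))), ENNReal.ofReal (C * r ^ i.1) := ENNReal.tsum_le_tsum hb
    _ = ∑' m : ℕ, ENNReal.ofReal ((p : ℝ) ^ (2 * m) * (C * r ^ m)) := by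
        rw [ENNReal.tsum_sigma' fun i : (Σ m : ℕ, Fin (p ^ (2 * m))) => ENNReal.ofReal (C * r ^ i.1)]
        refine tsum_congr fun m => ?_
        change ∑' _ : Fin (p ^ (2 * m)), ENNReal.ofReal (C * r ^ m) = _
        rw [tsum_fintype, Finset.sum_const, Finset.card_univ, Fintype.card_fin, nsmul_eq_mul,
          ENNReal.ofReal_mul (p := (p : ℝ) ^ (2 * m)) (by positivity), ENNReal.ofReal_pow hp0.le, ENNReal.ofReal_natCast]
        push_cast
        rfl
    _ < ⊤ := hsum.tsum_ofReal_lt_top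

lemma integral_suppFn (hΛ : ∀ x : ℚ_[p]ˣ, Λ (baseUnits p d x) = 1)
    (hΛ1 : ∃ u ∈ intUnits p d, Λ u ≠ 1)
    (hWK : ∀ (h : Ft p d), ∀ κ ∈ K1 p d, W (h * Subgroup.inclusion (U_le_GU _) κ) = W h)
    (μ : Measure (F1 p d)) [μ.IsMulLeftInvariant] (hF : Integrable (suppFn IsP Λ W g s) μ) :
    ∫ h, suppFn IsP Λ W g s h ∂μ = 0 := by
  obtain ⟨u, ⟨hu, hu'⟩, hne⟩ := hΛ1
  have h1 : nrm (u : Lv p d) = 1 := by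
    refine le_antisymm (isInt_iff_nrm.1 hu) ?_
    have h2 := isInt_iff_nrm.1 hu'
    rw [Units.val_inv_eq_inv_val, nrm_inv] at h2
    exact (inv_le_one₀ (nrm_pos u.ne_zero)).1 h2
  refine integral_eq_zero_of_character μ isOpen_K1.measurableSet hF
    (χ := fun κ => (charZ Λ (ent κ 0 0))⁻¹) (fun x κ hκ => suppFn_mul hΛ hWK x hκ)
    -- On `diag(u⁻¹, star u)`, which lies in `K1`, the transformation factor is `Λ u ≠ 1`.
    (diagF_mem_K1 u.ne_zero h1) ?_ (fun i : ℕ × ℕ => cosetRep p d i.1 i.2) ?_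
  · have e : ent (diagF (u : Lv p d) u.ne_zero) 0 0 = (u : Lv p d)⁻¹ := rfl
    rw [e, charZ_inv, inv_inv, charZ_coe]
    exact fun e => hne (Circle.coe_eq_one.1 e)
  · intro h hh
    have h1 : Supp IsP (ent h) := by
      by_contra h1
      exact hh (Set.indicator_of_notMem (by exact h1) _)
    obtain ⟨m, j, -, hmj⟩ := exists_cosetRep h1
    exact ⟨(m, j), hmj⟩

end convergence

/-! ## Boundedness of Whittaker new vectors -/

lemma lt_norm_add_iff {a b : ℚ_[p]} {r : ℝ} (h : ‖a‖ ≤ r) : r < ‖a + b‖ ↔ r < ‖b‖ := by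
  constructor
  · intro h1
    by_contra h2
    exact absurd ((Padic.nonarchimedean a b).trans (max_le h (not_lt.1 h2))) (not_le.2 h1)
  · intro h1
    rw [IsUltrametricDist.norm_add_eq_max_of_norm_ne_norm (h.trans_lt h1).ne,
      max_eq_right (h.trans_lt h1).le]
    exact h1

lemma row_ne_zero (x : GL (Fin 2) ℚ_[p]) : x 1 0 ≠ 0 ∨ x 1 1 ≠ 0 := by
  by_contra! h
  have h1 : x.val.det ≠ 0 := (x.isUnit.map Matrix.detMonoidHom).ne_zero
  rw [Matrix.det_fin_two] at h1
  have h2 : x.val 1 0 = 0 := h.1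
  have h3 : x.val 1 1 = 0 := h.2
  simp [h2, h3] at h1

lemma GL_mul_apply (x y : GL (Fin 2) ℚ_[p]) (i j : Fin 2) :
    (x * y) i j = x i 0 * y 0 j + x i 1 * y 1 j := by
  change (x.val * y.val) i j = _
  rw [Matrix.mul_apply, Fin.sum_univ_two]

/-- Functions on the projective line only depend on the bottom row, up to scalars. -/
lemma indTrivial_eq_of_row (f : indTrivial p) {x y : GL (Fin 2) ℚ_[p]}
    (h : x 1 0 * y 1 1 = x 1 1 * y 1 0) : f.1 x = f.1 y := by
  obtain ⟨z, rfl⟩ : ∃ z, x = z * y := ⟨x * y⁻¹, by group⟩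
  refine f.2.2 _ _ ?_
  have hd : y 0 0 * y 1 1 - y 0 1 * y 1 0 ≠ 0 := by
    have h1 : y.val.det ≠ 0 := (y.isUnit.map Matrix.detMonoidHom).ne_zero
    rwa [Matrix.det_fin_two] at h1
  rw [GL_mul_apply, GL_mul_apply] at h
  have : z 1 0 * (y 0 0 * y 1 1 - y 0 1 * y 1 0) = 0 := by linear_combination h
  exact (mul_eq_zero.1 this).resolve_right hd

/-- The diagonal matrix `diag(p^n, 1)`. -/
def diagPow (p : ℕ) [Fact p.Prime] (n : ℤ) : GL (Fin 2) ℚ_[p] :=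
  Matrix.GeneralLinearGroup.mkOfDetNeZero !![(p : ℚ_[p]) ^ n, 0; 0, 1]
    (by simpa using zpow_ne_zero n padic_ne_zero)

lemma row_mul_diagPow (x : GL (Fin 2) ℚ_[p]) (n : ℤ) :
    (x * diagPow p n) 1 0 = x 1 0 * (p : ℚ_[p]) ^ n ∧ (x * diagPow p n) 1 1 = x 1 1 := by
  rw [GL_mul_apply, GL_mul_apply]
  have h : ∀ i j, diagPow p n i j = !![(p : ℚ_[p]) ^ n, 0; 0, 1] i j := fun _ _ => rfl
  simp [h]

lemma row_mul_unip (x : GL (Fin 2) ℚ_[p]) (t : ℚ_[p]) :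
    (x * unip t) 1 0 = x 1 0 ∧ (x * unip t) 1 1 = x 1 0 * t + x 1 1 := by
  rw [GL_mul_apply, GL_mul_apply]
  have h : ∀ i j, unip t i j = !![1, t; 0, 1] i j := fun _ _ => rfl
  simp [h]

/-- If `|γ pⁿ| < |δ|` every `j` satisfies the inequality; otherwise exactly one fails, the residue
of `-δ/(γ pⁿ)`. -/
lemma sum_hecke {A B : ℂ} {γ δ : ℚ_[p]} (h0 : γ ≠ 0 ∨ δ ≠ 0) (n : ℕ) :
    ∑ j : Fin p, (if ‖γ * (p : ℚ_[p]) ^ (n + 1)‖ < ‖γ * (((j : ℕ) : ℚ_[p]) * (p : ℚ_[p]) ^ n) + δ‖ then A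
      else B) = (if ‖γ * (p : ℚ_[p]) ^ n‖ < ‖δ‖ then A else B) + (p - 1) * A := by
  have hp0 := padic_ne_zero (p := p)
  have hj1 : ∀ j : Fin p, ‖((j : ℕ) : ℚ_[p])‖ ≤ 1 := fun j => by
    simpa using Padic.norm_int_le_one (p := p) (j : ℕ)
  by_cases h1 : ‖γ * (p : ℚ_[p]) ^ n‖ < ‖δ‖
  · have : ∀ j : Fin p, ‖γ * (p : ℚ_[p]) ^ (n + 1)‖ < ‖γ * (((j : ℕ) : ℚ_[p]) * (p : ℚ_[p]) ^ n) + δ‖ := by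
      intro j
      have h2 : ‖γ * (p : ℚ_[p]) ^ (n + 1)‖ ≤ ‖γ * (p : ℚ_[p]) ^ n‖ := by
        rw [pow_succ, ← mul_assoc, norm_mul _ (p : ℚ_[p])]
        exact mul_le_of_le_one_right (norm_nonneg _) Padic.norm_p_lt_one.le
      refine h2.trans_lt ((lt_norm_add_iff ?_).2 h1)
      rw [show γ * (((j : ℕ) : ℚ_[p]) * (p : ℚ_[p]) ^ n) = (j : ℕ) * (γ * (p : ℚ_[p]) ^ n) by ring, norm_mul]
      exact mul_le_of_le_one_left (norm_nonneg _) (hj1 j)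
    simp only [this, h1, if_true, Finset.sum_const, Finset.card_univ, Fintype.card_fin,
      nsmul_eq_mul]
    ring
  · have hγ : γ ≠ 0 := by
      rintro rfl
      simp at h1 h0
      exact h0 h1
    have hq : γ * (p : ℚ_[p]) ^ n ≠ 0 := mul_ne_zero hγ (pow_ne_zero _ hp0)
    set q := γ * (p : ℚ_[p]) ^ n with hqd
    have ht : ‖-(δ / q)‖ ≤ 1 := by
      rw [norm_neg, norm_div]
      exact div_le_one_of_le₀ (not_lt.1 h1) (norm_nonneg _)
    obtain ⟨i, hi⟩ := exists_nat_norm_sub_lt ht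
    have hiff : ∀ j : Fin p, ‖γ * (p : ℚ_[p]) ^ (n + 1)‖ <
        ‖γ * (((j : ℕ) : ℚ_[p]) * (p : ℚ_[p]) ^ n) + δ‖ ↔ j ≠ i := by
      intro j
      have e1 : γ * (p : ℚ_[p]) ^ (n + 1) = q * p := by rw [hqd]; ring
      have e2 : γ * (((j : ℕ) : ℚ_[p]) * (p : ℚ_[p]) ^ n) + δ = -(q * (-(δ / q) - (j : ℕ))) := by
        field_simp; rw [hqd]; ring
      rw [e1, e2, norm_neg, norm_mul q, norm_mul q, mul_lt_mul_iff_right₀ (norm_pos_iff.2 hq)]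
      constructor
      · rintro h2 rfl
        have h3 : ‖-(δ / q) - ((j : ℕ) : ℚ_[p])‖ ≤ (p : ℝ) ^ (-1 : ℤ) := by
          rw [Padic.norm_le_pow_iff_norm_lt_pow_add_one]; simpa using hi
        rw [Padic.norm_p, ← _root_.zpow_neg_one] at h2
        exact absurd h3 (not_le.2 h2)
      · intro h2
        by_contra h3
        have h4 : ‖-(δ / q) - ((j : ℕ) : ℚ_[p])‖ < 1 := (not_lt.1 h3).trans_lt Padic.norm_p_lt_one
        refine h2 (fin_eq_of_norm_lt ?_)
        have e3 : ((j : ℕ) : ℚ_[p]) - (i : ℕ) =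
            (-(δ / q) - (i : ℕ)) + -(-(δ / q) - (j : ℕ)) := by ring
        rw [e3]
        exact padic_add_lt hi (by rwa [norm_neg])
    simp only [hiff, h1, if_false]
    rw [← Finset.add_sum_erase _ _ (Finset.mem_univ i)]
    have : ∀ j ∈ Finset.univ.erase i, (if j ≠ i then A else B) = A := fun j hj =>
      if_pos (Finset.ne_of_mem_erase hj)
    rw [Finset.sum_congr rfl this, Finset.sum_const, Finset.card_erase_of_mem (Finset.mem_univ _),
      Finset.card_univ, Fintype.card_fin, nsmul_eq_mul,
      Nat.cast_sub (Fact.out : p.Prime).one_lt.le]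
    simp

section bounded
variable {L : indTrivial p →ₗ[ℂ] ℂ} {ψ : AddChar ℚ_[p] Circle} {f : indTrivial p} {A B : ℂ}

/-- For `n < 0` one has `|t| ≤ p ≤ |pⁿ|`, so the translate is fixed by `unip t`, while the
functional scales by `ψ t ≠ 1`. -/
lemma apply_diagPow_neg (hLψ : ∀ x F, L (rightTranslation p (unip x) F) = (ψ x : ℂ) * L F)
    (hψ_cond : ∃ x : ℚ_[p], ‖x‖ ≤ p ∧ ψ x ≠ 1)
    (hf : ∀ x : GL (Fin 2) ℚ_[p], f.1 x = if ‖x 1 0‖ < ‖x 1 1‖ then A else B) {n : ℤ} (hn : n < 0) :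
    L (rightTranslation p (diagPow p n) f) = 0 := by
  obtain ⟨t, ht, hne⟩ := hψ_cond
  have hp1 : (1 : ℝ) ≤ p := by exact_mod_cast (Fact.out : p.Prime).one_lt.le
  have e : rightTranslation p (unip t) (rightTranslation p (diagPow p n) f) =
      rightTranslation p (diagPow p n) f := by
    refine Subtype.ext (funext fun x => ?_)
    change f.1 (x * unip t * diagPow p n) = f.1 (x * diagPow p n)
    rw [hf, hf]
    simp only [row_mul_diagPow, row_mul_unip]
    have h1 : ‖x 1 0 * t‖ ≤ ‖x 1 0 * (p : ℚ_[p]) ^ n‖ := by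
      rw [norm_mul, norm_mul, norm_zpow, Padic.norm_p, _root_.inv_zpow']
      gcongr
      refine ht.trans ?_
      nth_rw 1 [← zpow_one (p : ℝ)]
      exact zpow_le_zpow_right₀ hp1 (by omega)
    simp only [lt_norm_add_iff h1]
  have h1 := hLψ t (rightTranslation p (diagPow p n) f)
  rw [e] at h1
  have h2 : ((ψ t : ℂ) - 1) * L (rightTranslation p (diagPow p n) f) = 0 := by
    linear_combination -h1
  exact (mul_eq_zero.1 h2).resolve_left (sub_ne_zero.2 fun h => hne (Circle.coe_eq_one.1 h))

/-- The `U_p` relation: summing the `unip (j pⁿ)`-translates of the next vector gives the present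
one modulo constants, and `ψ` is trivial on each `j pⁿ`. -/
lemma apply_diagPow_succ (hLc : ∀ F ∈ constants p, L F = 0)
    (hLψ : ∀ x F, L (rightTranslation p (unip x) F) = (ψ x : ℂ) * L F)
    (hψ_int : ∀ x : ℚ_[p], ‖x‖ ≤ 1 → ψ x = 1)
    (hf : ∀ x : GL (Fin 2) ℚ_[p], f.1 x = if ‖x 1 0‖ < ‖x 1 1‖ then A else B) (n : ℕ) :
    L (rightTranslation p (diagPow p n) f) =
      (p : ℂ) * L (rightTranslation p (diagPow p (n + 1 : ℕ)) f) := by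
  set F := rightTranslation p (diagPow p (n + 1 : ℕ)) f with hF
  have hc : (∑ j : Fin p, rightTranslation p (unip (((j : ℕ) : ℚ_[p]) * (p : ℚ_[p]) ^ n)) F) -
      rightTranslation p (diagPow p n) f ∈ constants p := by
    refine ⟨(p - 1) * A, fun x => ?_⟩
    have e : ((∑ j : Fin p, rightTranslation p (unip (((j : ℕ) : ℚ_[p]) * (p : ℚ_[p]) ^ n)) F) -
      rightTranslation p (diagPow p n) f : indTrivial p).1 x =
        (∑ j : Fin p, f.1 (x * unip (((j : ℕ) : ℚ_[p]) * (p : ℚ_[p]) ^ n) * diagPow p (n + 1 : ℕ))) -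
          f.1 (x * diagPow p n) := by
      simp only [Submodule.coe_sub, Submodule.coe_sum, Pi.sub_apply, Finset.sum_apply]
      rfl
    rw [e]
    simp only [hf, row_mul_diagPow, row_mul_unip, zpow_natCast]
    rw [sum_hecke (row_ne_zero x)]
    ring
  have h1 := hLc _ hc
  rw [map_sub, map_sum] at h1
  have h2 : ∀ j : Fin p, L (rightTranslation p (unip (((j : ℕ) : ℚ_[p]) * (p : ℚ_[p]) ^ n)) F) = L F := by
    intro j
    rw [hLψ, hψ_int, Circle.coe_one, one_mul]
    rw [norm_mul, norm_pow]
    refine mul_le_one₀ (by simpa using Padic.norm_int_le_one (p := p) (j : ℕ)) (by positivity) ?_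
    exact pow_le_one₀ (norm_nonneg _) Padic.norm_p_lt_one.le
  simp only [h2, Finset.sum_const, Finset.card_univ, Fintype.card_fin, nsmul_eq_mul] at h1
  linear_combination -h1

lemma norm_apply_diagPow_le (hLc : ∀ F ∈ constants p, L F = 0)
    (hLψ : ∀ x F, L (rightTranslation p (unip x) F) = (ψ x : ℂ) * L F)
    (hψ_int : ∀ x : ℚ_[p], ‖x‖ ≤ 1 → ψ x = 1)
    (hψ_cond : ∃ x : ℚ_[p], ‖x‖ ≤ p ∧ ψ x ≠ 1)
    (hf : ∀ x : GL (Fin 2) ℚ_[p], f.1 x = if ‖x 1 0‖ < ‖x 1 1‖ then A else B) (n : ℤ) :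
    ‖L (rightTranslation p (diagPow p n) f)‖ ≤ ‖L (rightTranslation p (diagPow p 0) f)‖ := by
  rcases lt_or_ge n 0 with hn | hn
  · rw [apply_diagPow_neg hLψ hψ_cond hf hn, norm_zero]
    exact norm_nonneg _
  lift n to ℕ using hn
  induction n with
  | zero => exact le_rfl
  | succ n ih =>
    refine le_trans ?_ ih
    rw [apply_diagPow_succ hLc hLψ hψ_int hf n, norm_mul]
    refine le_mul_of_one_le_left (norm_nonneg _) ?_
    rw [Complex.norm_natCast]
    exact_mod_cast (Fact.out : p.Prime).one_lt.le

/-- Upper triangular translates. -/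
lemma exists_norm_apply_upper (hLψ : ∀ x F, L (rightTranslation p (unip x) F) = (ψ x : ℂ) * L F)
    (hf : ∀ x : GL (Fin 2) ℚ_[p], f.1 x = if ‖x 1 0‖ < ‖x 1 1‖ then A else B)
    {g : GL (Fin 2) ℚ_[p]} (hg : g 1 0 = 0) :
    ∃ n : ℤ, ‖L (rightTranslation p g f)‖ = ‖L (rightTranslation p (diagPow p n) f)‖ := by
  have hg' : g 1 1 ≠ 0 := (row_ne_zero g).resolve_left (not_not.2 hg)
  have hg0 : g 0 0 ≠ 0 := by
    intro h
    have h1 : g.val.det ≠ 0 := (g.isUnit.map Matrix.detMonoidHom).ne_zero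
    rw [Matrix.det_fin_two] at h1
    have h2 : g.val 1 0 = 0 := hg
    have h3 : g.val 0 0 = 0 := h
    simp [h2, h3] at h1
  set n := (g 0 0 / g 1 1).valuation with hn
  have hv := Padic.norm_eq_zpow_neg_valuation (div_ne_zero hg0 hg')
  refine ⟨n, ?_⟩
  -- The two-valued function depends only on absolute values of the bottom row, up to scaling, so
  -- units and the centre may be discarded.
  have e : rightTranslation p g f =
      rightTranslation p (unip (g 0 1 / g 1 1)) (rightTranslation p (diagPow p n) f) := by
    refine Subtype.ext (funext fun x => ?_)
    change f.1 (x * g) = f.1 (x * unip _ * diagPow p n)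
    rw [hf, hf]
    simp only [row_mul_diagPow, row_mul_unip]
    rw [GL_mul_apply, GL_mul_apply, hg, mul_zero, add_zero]
    have e1 : ‖x 1 0 * (p : ℚ_[p]) ^ n‖ = ‖x 1 0 * g 0 0‖ / ‖g 1 1‖ := by
      rw [norm_mul, norm_mul, mul_div_assoc, ← norm_div, hv, norm_zpow, Padic.norm_p,
        _root_.inv_zpow']
    have e2 : x 1 0 * (g 0 1 / g 1 1) + x 1 1 = (x 1 0 * g 0 1 + x 1 1 * g 1 1) / g 1 1 := by
      field_simp
    rw [e1, e2, norm_div]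
    simp only [div_lt_div_iff_of_pos_right (norm_pos_iff.2 hg')]
  rw [e, hLψ, norm_mul, Circle.norm_coe, one_mul]

end bounded

/-- Lower triangular unipotent matrices. -/
def lowerGL (c : ℚ_[p]) : GL (Fin 2) ℚ_[p] :=
  Matrix.GeneralLinearGroup.mkOfDetNeZero !![1, 0; c, 1] (by simp)

/-- The Weyl element. -/
def weylGL (p : ℕ) [Fact p.Prime] : GL (Fin 2) ℚ_[p] :=
  Matrix.GeneralLinearGroup.mkOfDetNeZero !![0, 1; -1, 0] (by simp)

lemma row_mul_lowerGL (x : GL (Fin 2) ℚ_[p]) (c : ℚ_[p]) :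
    (x * lowerGL c) 1 0 = x 1 0 + x 1 1 * c ∧ (x * lowerGL c) 1 1 = x 1 1 := by
  rw [GL_mul_apply, GL_mul_apply]
  have h : ∀ i j, lowerGL c i j = !![1, 0; c, 1] i j := fun _ _ => rfl
  simp [h]

lemma row_mul_weylGL (x : GL (Fin 2) ℚ_[p]) :
    (x * weylGL p) 1 0 = -x 1 1 ∧ (x * weylGL p) 1 1 = x 1 0 := by
  rw [GL_mul_apply, GL_mul_apply]
  have h : ∀ i j, weylGL p i j = !![0, 1; -1, 0] i j := fun _ _ => rfl
  simp [h]

lemma row_one : (1 : GL (Fin 2) ℚ_[p]) 1 0 = 0 ∧ (1 : GL (Fin 2) ℚ_[p]) 1 1 = 1 := ⟨rfl, rfl⟩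

lemma row_weylGL : weylGL p 1 0 = -1 ∧ weylGL p 1 1 = 0 := ⟨rfl, rfl⟩

lemma GL_inv_apply {k : GL (Fin 2) ℚ_[p]} (h : k.val.det = 1) :
    (k⁻¹).val = !![k 1 1, -k 0 1; -k 1 0, k 0 0] := by
  rw [Matrix.coe_units_inv, Matrix.inv_def, h, Matrix.adjugate_fin_two]
  simp

lemma mem_Gamma0p_of_det {k : GL (Fin 2) ℚ_[p]} (h : k.val.det = 1) (hk : ∀ i j, ‖k i j‖ ≤ 1)
    (h10 : ‖k 1 0‖ < 1) : k ∈ Gamma0p p := by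
  refine ⟨hk, fun i j => ?_, h10⟩
  rw [GL_inv_apply h]
  fin_cases i <;> fin_cases j <;> simp [hk]

lemma lowerGL_mem_Gamma0p {c : ℚ_[p]} (hc : ‖c‖ < 1) : lowerGL c ∈ Gamma0p p := by
  refine mem_Gamma0p_of_det (by simp [lowerGL, Matrix.GeneralLinearGroup.mkOfDetNeZero]) ?_ hc
  have h : ∀ i j, lowerGL c i j = !![1, 0; c, 1] i j := fun _ _ => rfl
  intro i j
  rw [h]
  fin_cases i <;> fin_cases j <;> simp [hc.le]

lemma det_unip (t : ℚ_[p]) : (unip t).val.det = 1 := by simp [unip]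

lemma unip_mem_Gamma0p {t : ℚ_[p]} (ht : ‖t‖ ≤ 1) : unip t ∈ Gamma0p p := by
  have h : ∀ i j, unip t i j = !![1, t; 0, 1] i j := fun _ _ => rfl
  refine mem_Gamma0p_of_det (det_unip t) ?_ ?_
  · intro i j
    rw [h]
    fin_cases i <;> fin_cases j <;> simp [ht]
  · rw [h]; simp

/-! ### Iwahori-invariant vectors as two-valued functions on the projective line -/

section invariant
variable {f : indTrivial p}

/-- Invariance in the quotient becomes invariance of the function itself: the constant discrepancy
can be read off at a point of the projective line fixed by `k`, where it is zero. -/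
lemma apply_mul_of_fixed {k x₀ : GL (Fin 2) ℚ_[p]} (hk : rightTranslation p k f - f ∈ constants p)
    (h0 : f.1 (x₀ * k) = f.1 x₀) (x : GL (Fin 2) ℚ_[p]) : f.1 (x * k) = f.1 x := by
  obtain ⟨c, hc⟩ := hk
  have h1 : ∀ x, f.1 (x * k) - f.1 x = c := hc
  have h2 := h1 x₀
  rw [h0, sub_self] at h2
  exact sub_eq_zero.1 ((h1 x).trans h2.symm)

variable (hf : ∀ k ∈ Gamma0p p, rightTranslation p k f - f ∈ constants p)
include hf

lemma apply_mul_lowerGL {c : ℚ_[p]} (hc : ‖c‖ < 1) (x : GL (Fin 2) ℚ_[p]) :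
    f.1 (x * lowerGL c) = f.1 x :=
  apply_mul_of_fixed (x₀ := weylGL p) (hf _ (lowerGL_mem_Gamma0p hc))
    (indTrivial_eq_of_row f (by simp only [row_mul_lowerGL, row_weylGL]; ring)) x

lemma apply_mul_unip {t : ℚ_[p]} (ht : ‖t‖ ≤ 1) (x : GL (Fin 2) ℚ_[p]) :
    f.1 (x * unip t) = f.1 x :=
  apply_mul_of_fixed (x₀ := 1) (hf _ (unip_mem_Gamma0p ht))
    (indTrivial_eq_of_row f (by simp only [row_mul_unip, row_one]; ring)) x

/-- The projective line has two orbits, through `(0 : 1)` and `(1 : 0)`, reached by lower unipotents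
from `pℤ_p` and upper unipotents from `ℤ_p`. -/
lemma eq_ite_of_invariant (x : GL (Fin 2) ℚ_[p]) :
    f.1 x = if ‖x 1 0‖ < ‖x 1 1‖ then f.1 1 else f.1 (weylGL p) := by
  split_ifs with h
  · have h1 : x 1 1 ≠ 0 := norm_pos_iff.1 ((norm_nonneg _).trans_lt h)
    have hc : ‖x 1 0 / x 1 1‖ < 1 := by
      rwa [norm_div, div_lt_one (norm_pos_iff.2 h1)]
    rw [← apply_mul_lowerGL hf hc 1]
    refine indTrivial_eq_of_row f ?_
    simp only [row_mul_lowerGL, row_one]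
    field_simp
    ring
  · have h1 : x 1 0 ≠ 0 := (row_ne_zero x).elim id fun h1 h2 => h (by
      rw [h2, norm_zero]; exact norm_pos_iff.2 h1)
    have ht : ‖x 1 1 / x 1 0‖ ≤ 1 := by
      rw [norm_div]; exact div_le_one_of_le₀ (not_lt.1 h) (norm_nonneg _)
    rw [← apply_mul_unip hf ht (weylGL p)]
    refine indTrivial_eq_of_row f ?_
    simp only [row_mul_unip, row_weylGL]
    field_simp
    ring

end invariant

lemma norm_mul_p_lt_iff {a b : ℚ_[p]} (h : a ≠ 0 ∨ b ≠ 0) : ‖a * p‖ < ‖b‖ ↔ ¬ ‖b‖ < ‖a‖ := by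
  by_cases ha : a = 0
  · subst ha
    simpa using h
  · have ha' := norm_pos_iff.2 ha
    have h1 := Padic.norm_le_pow_iff_norm_lt_pow_add_one (b / a) (-1)
    rw [neg_add_cancel, zpow_zero, norm_div, div_lt_one ha', div_le_iff₀ ha',
      _root_.zpow_neg_one, ← Padic.norm_p, ← norm_mul, mul_comm] at h1
    rw [← h1, not_le]

lemma norm_apply_rightTranslation_le {L : indTrivial p →ₗ[ℂ] ℂ} {ψ : AddChar ℚ_[p] Circle}
    {f : indTrivial p} (hLc : ∀ F ∈ constants p, L F = 0)
    (hLψ : ∀ x F, L (rightTranslation p (unip x) F) = (ψ x : ℂ) * L F)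
    (hψ_int : ∀ x : ℚ_[p], ‖x‖ ≤ 1 → ψ x = 1)
    (hψ_cond : ∃ x : ℚ_[p], ‖x‖ ≤ p ∧ ψ x ≠ 1)
    (hf : ∀ k ∈ Gamma0p p, rightTranslation p k f - f ∈ constants p) (g : GL (Fin 2) ℚ_[p]) :
    ‖L (rightTranslation p g f)‖ ≤ ‖L (rightTranslation p (diagPow p 0) f)‖ := by
  have hf' := eq_ite_of_invariant hf
  suffices H : ∃ b : GL (Fin 2) ℚ_[p], b 1 0 = 0 ∧
      ‖L (rightTranslation p g f)‖ = ‖L (rightTranslation p b f)‖ by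
    obtain ⟨b, hb, e⟩ := H
    obtain ⟨n, hn⟩ := exists_norm_apply_upper hLψ hf' hb
    rw [e, hn]
    exact norm_apply_diagPow_le hLc hLψ hψ_int hψ_cond hf' n
  by_cases h : ‖g 1 0‖ < ‖g 1 1‖
  · have h1 : g 1 1 ≠ 0 := norm_pos_iff.1 ((norm_nonneg _).trans_lt h)
    have hc : ‖-(g 1 0 / g 1 1)‖ < 1 := by
      rwa [norm_neg, norm_div, div_lt_one (norm_pos_iff.2 h1)]
    refine ⟨g * lowerGL (-(g 1 0 / g 1 1)), ?_, ?_⟩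
    · rw [(row_mul_lowerGL _ _).1]
      field_simp
      ring
    · congr 2
      refine Subtype.ext (funext fun x => ?_)
      change f.1 (x * g) = f.1 (x * (g * lowerGL _))
      rw [← mul_assoc, apply_mul_lowerGL hf hc]
  · have h1 : g 1 0 ≠ 0 := (row_ne_zero g).elim id fun h1 h2 => h (by
      rw [h2, norm_zero]; exact norm_pos_iff.2 h1)
    have ht : ‖-(g 1 1 / g 1 0)‖ ≤ 1 := by
      rw [norm_neg, norm_div]; exact div_le_one_of_le₀ (not_lt.1 h) (norm_nonneg _)
    obtain ⟨b, e⟩ : ∃ b, b * weylGL p = g * unip (-(g 1 1 / g 1 0)) :=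
      ⟨g * unip (-(g 1 1 / g 1 0)) * (weylGL p)⁻¹, by group⟩
    have hb0 : b 1 0 = 0 := by
      rw [← (row_mul_weylGL b).2, e, (row_mul_unip _ _).2]
      field_simp
      ring
    refine ⟨b * diagPow p 1, by rw [(row_mul_diagPow _ _).1, hb0, zero_mul], ?_⟩
    -- Atkin–Lehner relation: of the conditions defining the two translates exactly one holds at
    -- every point, so their sum is the constant `f(1) + f(w)`. This trades the Weyl element for
    -- `-diag(p, 1)`.
    have hsum : rightTranslation p g f + rightTranslation p (b * diagPow p 1) f ∈ constants p := by
      refine ⟨f.1 1 + f.1 (weylGL p), fun x => ?_⟩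
      change f.1 (x * g) + f.1 (x * (b * diagPow p 1)) = _
      rw [← apply_mul_unip hf ht, mul_assoc, ← e, ← mul_assoc, ← mul_assoc, hf' (x * b * weylGL p),
        hf' (x * b * diagPow p 1)]
      simp only [row_mul_weylGL, row_mul_diagPow, norm_neg, zpow_one]
      simp only [norm_mul_p_lt_iff (row_ne_zero (x * b))]
      split_ifs <;> ring
    have := hLc _ hsum
    rw [map_add] at this
    rw [eq_neg_of_add_eq_zero_left this, norm_neg]

/-! ## Consequences for the function `W` -/

lemma norm_xi {ξ : ℚ_[p]ˣ →* ℂˣ} (hξ : ∀ x : ℚ_[p]ˣ, ξ x ^ 2 = 1) (x : ℚ_[p]ˣ) :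
    ‖(ξ x : ℂ)‖ = 1 := by
  have h1 : (ξ x : ℂ) ^ 2 = 1 := by rw [← Units.val_pow_eq_pow_val, hξ, Units.val_one]
  have h2 : ‖(ξ x : ℂ)‖ ^ 2 = 1 := by rw [← norm_pow, h1, norm_one]
  exact (pow_eq_one_iff_of_nonneg (norm_nonneg _) two_ne_zero).1 h2

lemma norm_det_of_mem_Gamma0p {k : GL (Fin 2) ℚ_[p]} (hk : k ∈ Gamma0p p) :
    ‖(Matrix.GeneralLinearGroup.det k : ℚ_[p])‖ = 1 := by
  have key : ∀ k : GL (Fin 2) ℚ_[p], (∀ i j, ‖k i j‖ ≤ 1) →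
      ‖(Matrix.GeneralLinearGroup.det k : ℚ_[p])‖ ≤ 1 := by
    intro k hk
    rw [Matrix.GeneralLinearGroup.val_det_apply, Matrix.det_fin_two, sub_eq_add_neg]
    refine (Padic.nonarchimedean _ _).trans (max_le ?_ ?_)
    · rw [norm_mul]; exact mul_le_one₀ (hk _ _) (norm_nonneg _) (hk _ _)
    · rw [norm_neg, norm_mul]; exact mul_le_one₀ (hk _ _) (norm_nonneg _) (hk _ _)
  refine le_antisymm (key k hk.1) ?_
  have h2 := key _ hk.2.1
  rw [map_inv, Units.val_inv_eq_inv_val, norm_inv] at h2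
  exact (inv_le_one₀ (norm_pos_iff.2 (Units.ne_zero _))).1 h2

lemma IsWhittakerNewvector.mul_Gamma0p {ψ : AddChar ℚ_[p] Circle} {ξ : ℚ_[p]ˣ →* ℂˣ}
    {W₀ : GL (Fin 2) ℚ_[p] → ℂ} (hW : IsWhittakerNewvector ψ ξ W₀) (g : GL (Fin 2) ℚ_[p])
    {k : GL (Fin 2) ℚ_[p]} (hk : k ∈ Gamma0p p) : W₀ (g * k) = W₀ g := by
  obtain ⟨ℓ, v, -, hv, hW⟩ := hW
  rw [hW, hW, map_mul, Module.End.mul_apply, hv k hk]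

lemma IsWhittakerNewvector.bounded {ψ : AddChar ℚ_[p] Circle} {ξ : ℚ_[p]ˣ →* ℂˣ}
    {W₀ : GL (Fin 2) ℚ_[p] → ℂ} (hW : IsWhittakerNewvector ψ ξ W₀)
    (hψ_int : ∀ x : ℚ_[p], ‖x‖ ≤ 1 → ψ x = 1)
    (hψ_cond : ∃ x : ℚ_[p], ‖x‖ ≤ p ∧ ψ x ≠ 1)
    (hξ_unram : ∀ u : ℚ_[p]ˣ, ‖(u : ℚ_[p])‖ = 1 → ξ u = 1)
    (hξ_sq : ∀ x : ℚ_[p]ˣ, ξ x ^ 2 = 1) : ∃ C, ∀ g, ‖W₀ g‖ ≤ C := by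
  obtain ⟨ℓ, v, hℓ, hv, hW⟩ := hW
  obtain ⟨f, rfl⟩ := Submodule.Quotient.mk_surjective _ v
  set L : indTrivial p →ₗ[ℂ] ℂ := ℓ ∘ₗ (constants p).mkQ with hL
  have hπ : ∀ g F, twistedSteinberg p ξ g ((constants p).mkQ F) =
      (ξ (Matrix.GeneralLinearGroup.det g) : ℂ) • (constants p).mkQ (rightTranslation p g F) :=
    fun _ _ => rfl
  have hdet : ∀ x : ℚ_[p], Matrix.GeneralLinearGroup.det (unip x) = 1 := fun x =>
    Units.ext (det_unip x)
  refine ⟨‖L (rightTranslation p (diagPow p 0) f)‖, fun g => ?_⟩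
  have e : W₀ g = (ξ (Matrix.GeneralLinearGroup.det g) : ℂ) * L (rightTranslation p g f) := by
    rw [hW]
    change ℓ (twistedSteinberg p ξ g ((constants p).mkQ f)) = _
    rw [hπ, map_smul]; rfl
  rw [e, norm_mul, norm_xi hξ_sq, one_mul]
  refine norm_apply_rightTranslation_le (ψ := ψ) ?_ ?_ hψ_int hψ_cond ?_ g
  · intro F hF
    change ℓ ((constants p).mkQ F) = 0
    rw [Submodule.mkQ_apply, (Submodule.Quotient.mk_eq_zero _).2 hF, map_zero]
  · intro x F
    have := hℓ x ((constants p).mkQ F)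
    rw [hπ, hdet, map_one, Units.val_one, one_smul] at this
    exact this
  · intro k hk
    have := hv k hk
    change twistedSteinberg p ξ k ((constants p).mkQ f) = (constants p).mkQ f at this
    rw [hπ, hξ_unram _ (norm_det_of_mem_Gamma0p hk), Units.val_one, one_smul] at this
    exact (Submodule.Quotient.eq _).1 this

section similitudes
variable [hin : Fact (legendreSym p (-d) = -1)]

/-- Over a unitary similitude group in two variables, conjugation is multiplication by a scalar. -/
lemma star_mul_det {h : Matrix (Fin 2) (Fin 2) (Lv p d)} {μ : ℚ_[p]}
    (hh : hᴴ * J1 _ * h = μ • J1 _) (i j : Fin 2) :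
    star (h i j) * (h 0 0 * h 1 1 - h 0 1 * h 1 0) = algebraMap _ _ μ * h i j := by
  have key : ∀ i j, star (h 0 i) * h 1 j - star (h 1 i) * h 0 j =
      algebraMap _ _ μ * J1 (Lv p d) i j := fun i j => by
    rw [← conjTranspose_J1_mul_apply, hh, Matrix.smul_apply, Algebra.smul_def]
  have e1 : star (h 0 0) * h 1 0 - star (h 1 0) * h 0 0 = 0 := by
    rw [key]; simp [J1]
  have e2 : star (h 0 0) * h 1 1 - star (h 1 0) * h 0 1 = algebraMap _ _ μ := by
    rw [key]; simp [J1]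
  have e3 : star (h 0 1) * h 1 0 - star (h 1 1) * h 0 0 = -algebraMap _ _ μ := by
    rw [key]; simp [J1]
  have e4 : star (h 0 1) * h 1 1 - star (h 1 1) * h 0 1 = 0 := by
    rw [key]; simp [J1]
  fin_cases i <;> fin_cases j <;> simp only [Fin.zero_eta, Fin.mk_one]
  · linear_combination h 0 0 * e2 - h 0 1 * e1
  · linear_combination h 0 0 * e4 - h 0 1 * e3
  · linear_combination h 1 0 * e2 - h 1 1 * e1
  · linear_combination h 1 0 * e4 - h 1 1 * e3

/-- The decomposition `GU(1,1) = L_pˣ · GL₂(ℚ_p)`. -/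
lemma exists_smul_map (h : Ft p d) : ∃ (a : (Lv p d)ˣ) (g : GL (Fin 2) ℚ_[p]),
    ((h : GL (Fin 2) (Lv p d)) : Matrix (Fin 2) (Fin 2) (Lv p d)) =
      (a : Lv p d) • (g : Matrix (Fin 2) (Fin 2) ℚ_[p]).map (algebraMap ℚ_[p] (Lv p d)) := by
  obtain ⟨μ, hμ⟩ := h.2
  set M := (h : GL (Fin 2) (Lv p d)).val with hM
  have hD : M 0 0 * M 1 1 - M 0 1 * M 1 0 ≠ 0 := by
    rw [← Matrix.det_fin_two]
    exact ((h : GL (Fin 2) (Lv p d)).isUnit.map Matrix.detMonoidHom).ne_zero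
  have hs := star_mul_det hμ
  obtain ⟨i₀, j₀, hz⟩ : ∃ i j, M i j ≠ 0 := by
    by_contra! H
    simp [H] at hD
  have hz' : star (M i₀ j₀) ≠ 0 := by simpa using hz
  -- By `star_mul_det` conjugation scales all entries by one common factor, so their ratios lie in
  -- `ℚ_p`.
  have hr : ∀ i j, M i j = M i₀ j₀ * algebraMap _ _ (M i j / M i₀ j₀).re := fun i j => by
    rw [← eq_algebraMap_of_star, mul_div_cancel₀ _ hz]
    rw [star_div₀, div_eq_div_iff hz' hz]
    refine mul_right_cancel₀ hD ?_
    linear_combination M i₀ j₀ * hs i j - M i j * hs i₀ j₀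
  set R : Matrix (Fin 2) (Fin 2) ℚ_[p] := Matrix.of fun i j => (M i j / M i₀ j₀).re with hR
  have hMR : M = M i₀ j₀ • R.map (algebraMap ℚ_[p] (Lv p d)) := by
    ext i j : 1
    exact hr i j
  have hdet : R.det ≠ 0 := fun h0 => hD (by
    rw [← Matrix.det_fin_two, hMR, Matrix.det_smul, ← RingHom.mapMatrix_apply, ← RingHom.map_det,
      h0, map_zero, mul_zero])
  exact ⟨Units.mk0 _ hz, Matrix.GeneralLinearGroup.mkOfDetNeZero R hdet, hMR⟩

variable {ψ : AddChar ℚ_[p] Circle} {ξ : ℚ_[p]ˣ →* ℂˣ} {W : Ft p d → ℂ}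

/-- Although `K1` has entries in `L_p`, each of its elements is `z⁻¹` times the matrix `(1, β; γ, N
z + γβ)` of `Γ_{0,p}`, and `W` ignores scalars. -/
lemma IsLocalWhittaker.mul_K1 (hW : IsLocalWhittaker ψ ξ W) (h : Ft p d) {κ : F1 p d}
    (hκ : κ ∈ K1 p d) : W (h * Subgroup.inclusion (U_le_GU _) κ) = W h := by
  obtain ⟨W₀, hW₀, hW⟩ := hW
  obtain ⟨a, g, hag⟩ := exists_smul_map h
  obtain ⟨z, β, γ, hz, hz1, hβ, hγ, k00, k01, k10, -, k11⟩ := exists_K1_cell hκ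
  set ν := QuadraticAlgebra.norm z with hν
  have hν1 : ‖ν‖ = 1 := hz1
  have hdet : (!![1, β; γ, ν + γ * β] : Matrix (Fin 2) (Fin 2) ℚ_[p]).det = ν := by
    rw [Matrix.det_fin_two_of]; ring
  set k : GL (Fin 2) ℚ_[p] := Matrix.GeneralLinearGroup.mkOfDetNeZero !![1, β; γ, ν + γ * β]
    (by rw [hdet, ← norm_pos_iff, hν1]; exact one_pos) with hk
  have hkv : k.val = !![1, β; γ, ν + γ * β] := rfl
  have h11 : ‖ν + γ * β‖ ≤ 1 := padic_add_le hν1.le (by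
    rw [norm_mul]; exact mul_le_one₀ hγ.le (norm_nonneg _) hβ)
  have hkΓ : k ∈ Gamma0p p := by
    refine ⟨fun i j => ?_, fun i j => ?_, hγ⟩
    · rw [hkv]
      fin_cases i <;> fin_cases j <;> simp [hβ, hγ.le, h11]
    · rw [Matrix.coe_units_inv, hkv, Matrix.inv_def, hdet, Matrix.adjugate_fin_two_of,
        Ring.inverse_eq_inv', Matrix.smul_apply, norm_smul, norm_inv, hν1, inv_one, one_mul]
      fin_cases i <;> fin_cases j <;> simp [hβ, hγ.le, h11]
  have hκv : (κ : GL (Fin 2) (Lv p d)).val = z⁻¹ • k.val.map (algebraMap ℚ_[p] (Lv p d)) := by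
    change ent κ = _
    ext i j : 1
    rw [hkv]
    fin_cases i <;> fin_cases j <;> simp only [Fin.zero_eta, Fin.mk_one, Matrix.smul_apply,
      Matrix.map_apply, Matrix.of_apply, Matrix.cons_val, smul_eq_mul]
    · rw [k00, map_one, mul_one]
    · rw [k01]
    · rw [k10]
    · rw [k11, map_add, map_mul, hν, QuadraticAlgebra.algebraMap_norm_eq_mul_star]
      field_simp
  rw [hW a g h hag, hW (a * (Units.mk0 z hz)⁻¹) (g * k) _ ?_, hW₀.mul_Gamma0p g hkΓ]
  change (h : GL (Fin 2) (Lv p d)).val * (κ : GL (Fin 2) (Lv p d)).val = _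
  rw [hag, hκv, Matrix.smul_mul, Matrix.mul_smul, smul_smul, ← Matrix.map_mul]
  rfl

lemma IsLocalWhittaker.bounded (hW : IsLocalWhittaker ψ ξ W)
    (hψ_int : ∀ x : ℚ_[p], ‖x‖ ≤ 1 → ψ x = 1)
    (hψ_cond : ∃ x : ℚ_[p], ‖x‖ ≤ p ∧ ψ x ≠ 1)
    (hξ_unram : ∀ u : ℚ_[p]ˣ, ‖(u : ℚ_[p])‖ = 1 → ξ u = 1)
    (hξ_sq : ∀ x : ℚ_[p]ˣ, ξ x ^ 2 = 1) : ∃ C, ∀ h, ‖W h‖ ≤ C := by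
  obtain ⟨W₀, hW₀, hW⟩ := hW
  obtain ⟨C, hC⟩ := hW₀.bounded hψ_int hψ_cond hξ_unram hξ_sq
  refine ⟨C, fun h => ?_⟩
  obtain ⟨a, g, hag⟩ := exists_smul_map h
  rw [hW a g h hag]
  exact hC g

end similitudes

end LocalZeta

end

theorem propositionp (p : ℕ) [Fact p.Prime] (hp2 : p ≠ 2)
    (a b d : ℤ) (hd : 0 < d) (habd : -d = b ^ 2 - 4 * a)
    (hinert : legendreSym p (-d) = -1)
    (Λ : (LocalZeta.Lv p d)ˣ →* Circle)
    (hΛ_base : ∀ x : ℚ_[p]ˣ, Λ (LocalZeta.baseUnits p d x) = 1)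
    (hΛ_nontrivial : ∃ u ∈ LocalZeta.intUnits p d, Λ u ≠ 1)
    (hΛ_Gamma0 : ∀ u ∈ LocalZeta.Gamma0L p d, Λ u = 1)
    (ψ : AddChar ℚ_[p] Circle)
    (hψ_int : ∀ x : ℚ_[p], ‖x‖ ≤ 1 → ψ x = 1)
    (hψ_cond : ∃ x : ℚ_[p], ‖x‖ ≤ p ∧ ψ x ≠ 1)
    (ξ : ℚ_[p]ˣ →* ℂˣ)
    (hξ_unram : ∀ u : ℚ_[p]ˣ, ‖(u : ℚ_[p])‖ = 1 → ξ u = 1)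
    (hξ_sq : ∀ x : ℚ_[p]ˣ, ξ x ^ 2 = 1)
    (W : LocalZeta.Ft p d → ℂ) (hW : LocalZeta.IsLocalWhittaker ψ ξ W)
    (μ : MeasureTheory.Measure (LocalZeta.F1 p d)) [μ.IsHaarMeasure]
    (hμ : μ (LocalZeta.KF1 p d) = 1)
    (g : LocalZeta.Ft p d) (k : Matrix (Fin 4) (Fin 4) (LocalZeta.Lv p d))
    (hk : k ∈ LocalZeta.Y p d b) :
    (∀ s : ℂ, -(1 / 6 : ℝ) < s.re →
      MeasureTheory.Integrable (LocalZeta.zetaIntegrand Λ W g k s) μ) ∧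
    (∀ s : ℂ, MeasureTheory.Integrable (LocalZeta.zetaIntegrand Λ W g k s) μ →
      ((k = 1 ∨ k = LocalZeta.s1 _) →
        LocalZeta.zetaIntegral μ Λ W g k s = W g / ((p : ℂ) + 1) ^ 2) ∧
      ((k ≠ 1 ∧ k ≠ LocalZeta.s1 _) →
        LocalZeta.zetaIntegral μ Λ W g k s = 0)) := by
  open LocalZeta in
  have : Fact (legendreSym p (-d) = -1) := ⟨hinert⟩
  have hWK : ∀ (h : Ft p d), ∀ κ ∈ K1 p d, W (h * Subgroup.inclusion (U_le_GU _) κ) = W h :=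
    fun h κ hκ => hW.mul_K1 h hκ
  obtain ⟨C, hC⟩ := hW.bounded hψ_int hψ_cond hξ_unram hξ_sq
  have hsub : (K1 p d : Set (F1 p d)) ⊆ KF1 p d := fun h hh => mem_KF1_iff.2 hh.1
  have hK1 : μ (K1 p d) ≤ 1 := hμ ▸ measure_mono hsub
  have hint := fun (s : ℂ) (hs : -(1 / 6 : ℝ) < s.re) =>
    integrable_suppFn (g := g) hΛ_base hΛ_Gamma0 hWK hC hs μ hK1
  have hzero := fun (s : ℂ) (hF : Integrable (suppFn IsP Λ W g s) μ) =>
    integral_suppFn hΛ_base hΛ_nontrivial hWK μ hF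
  have hK0 : Integrable (Set.indicator (K0 p d : Set (F1 p d)) fun _ => W g) μ := by
    refine (integrable_indicator_iff isOpen_K0.measurableSet).2 (integrableOn_const ?_)
    exact ((measure_mono (K0_le_K1 (p := p) (d := d))).trans hK1).trans_lt ENNReal.one_lt_top |>.ne
  have hK0' : ∫ h, Set.indicator (K0 p d : Set (F1 p d)) (fun _ => W g) h ∂μ =
      W g / ((p : ℂ) + 1) ^ 2 := by
    rw [integral_indicator isOpen_K0.measurableSet, setIntegral_const, measureReal_K0 μ hμ,
      Complex.real_smul]
    push_cast
    ring
  have main : (k = 1 ∨ k = s1 _) → ∀ s, zetaIntegrand Λ W g k s =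
      Set.indicator (K0 p d : Set (F1 p d)) (fun _ => W g) + suppFn IsP Λ W g s := by
    rintro (rfl | rfl) s
    · rw [zetaIntegrand_one hΛ_base hΛ_Gamma0, suppFn_isO hΛ_Gamma0 hWK]
    · rw [zetaIntegrand_s1 hΛ_base hΛ_Gamma0, suppFn_isO hΛ_Gamma0 hWK]
  have other : (k = 1 ∨ k = s1 _) ∨ (∀ s, zetaIntegrand Λ W g k s = suppFn IsP Λ W g s) ∨
      ∀ s, zetaIntegrand Λ W g k s = 0 := by
    rcases hk with h | h | h | h | h | h | h | h
    · exact .inl (.inl h)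
    · exact .inl (.inr h)
    · exact .inr (.inr fun s => zetaIntegrand_eq_zero hp2 b (.inl h))
    · exact .inr (.inr fun s => zetaIntegrand_eq_zero hp2 b (.inr (.inl h)))
    · exact .inr (.inl fun s => by rw [h, zetaIntegrand_Theta hp2 b hΛ_base hΛ_Gamma0])
    · exact .inr (.inr fun s => zetaIntegrand_eq_zero hp2 b (.inr (.inr (.inl h))))
    · exact .inr (.inr fun s => zetaIntegrand_eq_zero hp2 b (.inr (.inr (.inr (.inl h)))))
    · exact .inr (.inr fun s => zetaIntegrand_eq_zero hp2 b (.inr (.inr (.inr (.inr h)))))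
  refine ⟨fun s hs => ?_, fun s hF => ⟨fun h => ?_, fun h => ?_⟩⟩
  · rcases other with h | h | h
    · rw [main h]; exact hK0.add (hint s hs)
    · rw [h]; exact hint s hs
    · rw [h]; exact integrable_zero _ _ _
  · rw [main h] at hF
    -- The part on `K0` is always integrable, so integrability of the whole passes to the other
    -- part, whose integral then vanishes for this `s` even outside the half-plane.
    have hF' : Integrable (suppFn IsP Λ W g s) μ := by simpa using hF.sub hK0
    rw [zetaIntegral, main h]
    simp only [Pi.add_apply]
    rw [integral_add hK0 hF', hK0', hzero s hF', add_zero]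
  · rcases other with h' | h' | h'
    · exact absurd h' (by tauto)
    · rw [h'] at hF
      rw [zetaIntegral, h', hzero s hF]
    · rw [zetaIntegral, h']
      simp
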